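/- Let $\tau=\tau(n)>0$ and $\gamma=\gamma(n)\ge 1$ be arbitrary real-valued functions of the positive integer $n$. For a lattice $\mathcal L$ of rank $n\ge 1$ generated by linearly independent vectors of $\mathbb Q^m$ and a target $\vec t\in\mathbb Q^m$, let $\mathrm{dist}(\vec t,\mathcal L)$ be the Euclidean distance of $\vec t$ from $\mathcal L$, let $\lambda_1(\mathcal L)$ be the length of a shortest nonzero vector of $\mathcal L$, and let $\phi(\mathcal L)=\sqrt{1+\tau(n)^{-2}}\cdot\lambda_1(\mathcal L)$. Consider the following two search problems, whose input is a basis of such a lattice $\mathcal L$ together with $\vec t$. * $\mathrm{CVP}_{\gamma\sqrt{1+\tau^2}}$: output $\vec y\in\mathcal L$ with $\|\vec t-\vec y\|\le\gamma(n)\sqrt{1+\tau(n)^2}\cdot\mathrm{dist}(\vec t,\mathcal L)$. * $\mathrm{CVP}_{\gamma}^{\phi}$: if $\mathrm{dist}(\vec t,\mathcal L)<\phi(\mathcal L)$, output $\vec y\in\mathcal L$ with $\|\vec t-\vec y\|\le\gamma(n)\cdot\mathrm{dist}(\vec t,\mathcal L)$; otherwise any output is acceptable. Then there is a randomized polynomial-time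 (Turing) reduction from $\mathrm{CVP}_{\gamma\sqrt{1+\tau^2}}$ to $\mathrm{CVP}_{\gamma}^{\phi}$. That is, there is an oracle algorithm that uses polynomially many uniformly random bits and, for every oracle and every outcome of the random bits, runs in time polynomial in the bit length of its input; whenever the oracle solves $\mathrm{CVP}_{\gamma}^{\phi}$, the algorithm outputs a solution of $\mathrm{CVP}_{\gamma\sqrt{1+\tau^2}}$ on every input with probability at least $2/3$. (Each query specifies, and is charged, a number of bits reserved for the answer; a longer answer is not delivered.) The same holds when both problems are restricted to lattices of full rank, $n=m$. -/

import Mathlib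

namespace LatticeReduction

/-! ### A programming language with a cost semantics

Data are binary trees whose leaves are integers; their size is the number of bits
needed to write them down (up to a constant factor). -/

/-- Binary trees with integer leaves. -/
inductive Data : Type where
  | int (z : ℤ) : Data
  | pair (a b : Data) : Data

namespace Data

/-- Bit size: an integer counts one plus its number of binary digits. -/
def size : Data → ℕ
  | int z => Nat.size z.natAbs + 1
  | pair a b => size a + size b + 1

/-- Lists, with `int 0` as the empty list and `pair` as cons. -/
def ofList : List Data → Data
  | [] => int 0
  | a :: l => pair a (ofList l)

/-- A rational number in lowest terms, as numerator and (positive) denominator. -/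
def ofRat (q : ℚ) : Data := pair (int q.num) (int q.den)

/-- A rational vector, as the list of its coordinates. -/
def ofVec {m : ℕ} (v : Fin m → ℚ) : Data := ofList (List.ofFn fun j => ofRat (v j))

end Data

/-- Elementary instructions. -/
inductive Op : Type where
  | id
  | const (d : Data)
  | fst
  | snd
  | isPair
  | add
  | sub
  | mul
  | div
  | mod
  | lt

open Data in
/-- The function computed by an elementary instruction. The arithmetic instructions expect
a pair of integers; an instruction applied to data of the wrong form returns `int 0`. -/
def Op.eval : Op → Data → Data
  | .id, x => x
  | .const d, _ => d
  | .fst, pair a _ => a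
  | .snd, pair _ b => b
  | .isPair, pair _ _ => int 1
  | .add, pair (int a) (int b) => int (a + b)
  | .sub, pair (int a) (int b) => int (a - b)
  | .mul, pair (int a) (int b) => int (a * b)
  | .div, pair (int a) (int b) => int (a / b)
  | .mod, pair (int a) (int b) => int (a % b)
  | .lt, pair (int a) (int b) => int (if a < b then 1 else 0)
  | _, _ => int 0

/-- Deterministic oracle programs. A program transforms an input into an output.
`seq f g` runs `f`, then `g` on the result; `fork f g` runs both on the same input and pairs the
results; `ite c f g` and `loop c f` are "if c then f else g" and "while c do f", where the test
succeeds when its value is not `int 0`; `query` consults the oracle. -/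
inductive Prog : Type where
  | op (o : Op)
  | seq (f g : Prog)
  | fork (f g : Prog)
  | ite (c f g : Prog)
  | loop (c f : Prog)
  | query

/-- The number of bits that a query reserves for the answer (see `reply`). -/
def budget : Data → ℕ
  | .pair (.int b) _ => b.toNat
  | _ => 0

/-- The effect of a query to the oracle `O`. The program supplies a number `b` and the query `q`.
The answer `O q` is delivered if it has at most `b` bits; otherwise (the program has not reserved
enough time to read it) the program just receives `int 0`. All `b` bits are charged. -/
def reply (O : Data → Data) : Data → Data
  | .pair (.int b) q => if (O q).size ≤ b.toNat then O q else .int 0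
  | _ => .int 0

/-- `Runs O P x y c`: with oracle `O`, the program `P` halts on input `x` with output `y`, and the
run has cost `c`. An elementary instruction costs one plus the size of the data it reads and
writes; a query costs one plus the size of the query plus the number of bits reserved for the
answer (the answer itself is computed for free); every control step costs one. -/
inductive Runs (O : Data → Data) : Prog → Data → Data → ℕ → Prop where
  | op (o : Op) (x : Data) : Runs O (.op o) x (o.eval x) (1 + x.size + (o.eval x).size)
  | seq {f g : Prog} {x y z : Data} {s t : ℕ} :
      Runs O f x y s → Runs O g y z t → Runs O (.seq f g) x z (s + t + 1)
  | fork {f g : Prog} {x y z : Data} {s t : ℕ} :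
      Runs O f x y s → Runs O g x z t → Runs O (.fork f g) x (.pair y z) (s + t + 1)
  | ite_true {c f g : Prog} {x b y : Data} {s t : ℕ} :
      Runs O c x b s → b ≠ .int 0 → Runs O f x y t → Runs O (.ite c f g) x y (s + t + 1)
  | ite_false {c f g : Prog} {x y : Data} {s t : ℕ} :
      Runs O c x (.int 0) s → Runs O g x y t → Runs O (.ite c f g) x y (s + t + 1)
  | loop_stop {c f : Prog} {x : Data} {s : ℕ} :
      Runs O c x (.int 0) s → Runs O (.loop c f) x x (s + 1)
  | loop_step {c f : Prog} {x b y z : Data} {s t u : ℕ} :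
      Runs O c x b s → b ≠ .int 0 → Runs O f x y t → Runs O (.loop c f) y z u →
        Runs O (.loop c f) x z (s + t + u + 1)
  | query (x : Data) : Runs O .query x (reply O x) (1 + x.size + budget x)

/-! ### Search problems and randomized reductions -/

/-- A search problem: instances with their encoding, and the acceptable outputs for each. -/
structure SearchProblem where
  Instance : Type
  encode : Instance → Data
  IsSolution : Instance → Data → Prop

namespace SearchProblem

/-- The same problem on those instances only that satisfy `p`. -/
def restrict (P : SearchProblem) (p : P.Instance → Prop) : SearchProblem where
  Instance := {I : P.Instance // p I}
  encode I := P.encode I.1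
  IsSolution I := P.IsSolution I.1

/-- The oracle `O` returns an acceptable output on (the encoding of) every instance. On data that
encode no instance, it may return anything. -/
def SolvedBy (P : SearchProblem) (O : Data → Data) : Prop :=
  ∀ I : P.Instance, P.IsSolution I (O (P.encode I))

/-- There is a randomized polynomial-time (Turing) reduction from `P` to `Q`: a fixed oracle
program that receives an instance of `P`, of bit size `ℓ`, together with `bits(ℓ)` uniformly random
bits (as an integer `R` below `2 ^ bits(ℓ)`), such that
* whatever the oracle and the random bits, it halts after time at most `time(ℓ)`;
* if the oracle solves `Q` then, with probability at least `2/3` over the random bits,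
  the output is a solution of the instance. -/
def RandPolyTimeReducesTo (P Q : SearchProblem) : Prop :=
  ∃ (M : Prog) (bits time : Polynomial ℕ), ∀ (O : Data → Data) (I : P.Instance),
    (∀ R : Fin (2 ^ bits.eval (P.encode I).size), ∃ (y : Data) (c : ℕ),
      Runs O M (.pair (P.encode I) (.int (R : ℕ))) y c ∧
        c ≤ time.eval (P.encode I).size) ∧
    (Q.SolvedBy O →
      (2 / 3 : ℝ) * 2 ^ bits.eval (P.encode I).size ≤
        ({R : Fin (2 ^ bits.eval (P.encode I).size) | ∃ (y : Data) (c : ℕ),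
          Runs O M (.pair (P.encode I) (.int (R : ℕ))) y c ∧ P.IsSolution I y}.ncard : ℝ))

end SearchProblem

/-! ### Lattices and the closest vector problem -/

/-- A rational vector as a point of Euclidean space. -/
noncomputable def toEuclidean {m : ℕ} (v : Fin m → ℚ) : EuclideanSpace ℝ (Fin m) :=
  WithLp.toLp 2 fun j => (v j : ℝ)

/-- The length of a shortest nonzero vector. -/
noncomputable def lambdaOne {m : ℕ} (L : Submodule ℤ (EuclideanSpace ℝ (Fin m))) : ℝ :=
  sInf {r : ℝ | ∃ v ∈ L, v ≠ 0 ∧ r = ‖v‖}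

/-- An input of the closest vector problem: a basis of a rational lattice of rank `n ≥ 1` in
`m`-dimensional space, and a rational target. -/
structure CVPInput where
  n : ℕ
  m : ℕ
  n_pos : 0 < n
  basis : Fin n → Fin m → ℚ
  linearIndependent : LinearIndependent ℝ fun i => toEuclidean (basis i)
  target : Fin m → ℚ

namespace CVPInput

/-- Binary encoding of the basis vectors and the target. -/
def encode (I : CVPInput) : Data :=
  .pair (Data.ofList (List.ofFn fun i => Data.ofVec (I.basis i))) (Data.ofVec I.target)

/-- The lattice generated by the basis. -/
noncomputable def lattice (I : CVPInput) : Submodule ℤ (EuclideanSpace ℝ (Fin I.m)) :=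
  Submodule.span ℤ (Set.range fun i => toEuclidean (I.basis i))

/-- The distance of the target from the lattice. -/
noncomputable def targetDist (I : CVPInput) : ℝ :=
  Metric.infDist (toEuclidean I.target) (I.lattice : Set (EuclideanSpace ℝ (Fin I.m)))

/-- `y` encodes a lattice vector whose distance from the target is within the factor `g` of
optimal. -/
def IsApproxClosest (I : CVPInput) (g : ℝ) (y : Data) : Prop :=
  ∃ v : Fin I.m → ℚ, y = Data.ofVec v ∧ toEuclidean v ∈ I.lattice ∧
    ‖toEuclidean I.target - toEuclidean v‖ ≤ g * I.targetDist

/-- The lattice has full rank. -/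
def FullRank (I : CVPInput) : Prop := I.n = I.m

end CVPInput

/-- The `γ`-approximate closest vector problem, where `γ` depends on the rank of the lattice. -/
def CVP (γ : ℕ → ℝ) : SearchProblem where
  Instance := CVPInput
  encode := CVPInput.encode
  IsSolution I y := I.IsApproxClosest (γ I.n) y

/-- The `γ`-approximate closest vector problem with the promise that the target has distance
less than `φ` from the lattice, where `φ` depends on the lattice and its rank. If the promise fails,
every output is acceptable. -/
def PromiseCVP (γ : ℕ → ℝ)
    (φ : (n : ℕ) → {m : ℕ} → Submodule ℤ (EuclideanSpace ℝ (Fin m)) → ℝ) : SearchProblem where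
  Instance := CVPInput
  encode := CVPInput.encode
  IsSolution I y := I.targetDist < φ I.n I.lattice → I.IsApproxClosest (γ I.n) y

end LatticeReduction

namespace LatticeReduction

open Polynomial

/-! ### Polynomial-time functions of typed arguments -/

/-! Clear denominators, and let F be the squared distance of the target t from the lattice L. Let S
be the set of lattice points at squared distance at most (1+τ²)F from t, and T the set of nonzero
lattice vectors of squared length at most τ²F. Suppose that a sublattice L' avoids T while its coset
c·b₀ + L' meets S, where b₀ is the first basis vector. Then t - c·b₀ has squared distance at most
(1+τ²)F from L', and λ₁(L')² > τ²F, so the promise holds strictly. The answer of the oracle, shifted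
back by c·b₀, lies within γ√(1+τ²)√F of t, as required (`candidate_good`).

Such a sublattice is found at random. In coordinates it is x₀ - ∑ zᵢxᵢ ≡ 0 mod 2^k with random zᵢ,
the coset is given by a random residue c, and 2^k·b₀, bᵢ + zᵢ·b₀ is a basis. If 2^k exceeds |S| and
|T| by a moderate factor, most z avoid T and separate a given point of S from the others, and the
coset then hits S with probability about |S|/2^k. This needs |T| = O(|S|), which is the
parallelogram law: for a closest point x₀ and v in T, the squared distances of x₀+v and x₀-v from t
sum to 2F + 2‖v‖² ≤ 2(1+τ²)F, so one of them is in S and |T| ≤ 2|S| (`exists_good_level`).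

A modulus that is a power of two lets uniform bits serve directly as uniform digits and avoids
primes, but a vector divisible by 2^j falls into the sublattice with probability up to 2^j/2^k.
Convexity compensates: T and the differences from a point of S contain with every vector its
positive integral fractions, so at most a 2^(-j) part of either set is divisible by 2^j. Summing
over j costs only a factor k+1 (`RayClosed.sum_card_le`).

The right k depends on |S|, which is unknown, so all k up to K = `coeffBits` are tried, and the
candidate nearest to t is kept, 0 being one of them. If 0 is not already good enough then (1+τ²)F ≤
‖t‖², which bounds |S| and justifies K. Some k then succeeds with probability at least 1/(24(K+1)),
and 48(K+1) independent trials fail with probability at most e⁻² < 1/3 (`card_searchClosest_ge`).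
The candidate 0 also covers the case that an answer exceeds the reserved bits.

For the running time, `PolyTime` is closed under the usual constructions, and `polyTime_reduction`
assembles the program from them. Lattice coefficients of an answer are recovered by the
division-controlled Faddeev-LeVerrier recursion (`leVerrier_matL`), so the output is a lattice
vector whatever the oracle says. Neither τ nor γ enters the program, and queries keep the rank and
the dimension of the input; hence τ and γ may be arbitrary, and one program proves both claims. -/

theorem eval_mono_of_nat (p : ℕ[X]) : Monotone fun n : ℕ => p.eval n := by
  induction p using Polynomial.induction_on' with
  | add p q hp hq =>
    intro a b h
    simpa using add_le_add (hp h) (hq h)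
  | monomial k c =>
    intro a b h
    simpa using Nat.mul_le_mul_left c (Nat.pow_le_pow_left h k)

theorem eval_le_eval (p : ℕ[X]) {a b : ℕ} (h : a ≤ b) : p.eval a ≤ p.eval b :=
  eval_mono_of_nat p h

theorem Data.one_le_size (d : Data) : 1 ≤ d.size := by
  cases d <;> simp [Data.size]

theorem size_reply_le (O : Data → Data) (x : Data) : (reply O x).size ≤ 1 + budget x := by
  rcases x with z | ⟨⟨b⟩ | ⟨b, c⟩, q⟩ <;> simp only [reply, budget]
  · simp [Data.size]
  · split_ifs with h
    · omega
    · simp [Data.size]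
  · simp [Data.size]

theorem Runs.size_input_le {O : Data → Data} {P : Prog} {x y : Data} {c : ℕ}
    (h : Runs O P x y c) : x.size ≤ c := by
  induction h <;> omega

theorem Runs.size_output_le {O : Data → Data} {P : Prog} {x y : Data} {c : ℕ}
    (h : Runs O P x y c) : y.size ≤ c := by
  induction h with
  | op o x => omega
  | fork => simp only [Data.size]; omega
  | loop_stop h => have := h.size_input_le; omega
  | query x => have := size_reply_le O x; have := x.one_le_size; omega
  | _ => omega

/-- Types whose elements are represented by data. -/
class Enc (α : Type) where
  enc : α → Data

open Enc

instance : Enc Data := ⟨fun d => d⟩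
instance : Enc ℤ := ⟨Data.int⟩
instance : Enc ℕ := ⟨fun n => .int n⟩
instance : Enc Bool := ⟨fun b => .int (if b then 1 else 0)⟩
instance : Enc ℚ := ⟨Data.ofRat⟩
instance {α β : Type} [Enc α] [Enc β] : Enc (α × β) := ⟨fun p => .pair (enc p.1) (enc p.2)⟩
instance {α : Type} [Enc α] : Enc (List α) := ⟨fun l => Data.ofList (l.map enc)⟩

/-- Bit size of the representation. -/
def esize {α : Type} [Enc α] (a : α) : ℕ := (enc a).size

section Types
variable {α β γ σ : Type} [Enc α] [Enc β] [Enc γ] [Enc σ]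

theorem one_le_esize (a : α) : 1 ≤ esize a := (enc a).one_le_size

theorem esize_pair (a : α) (b : β) : esize (a, b) = esize a + esize b + 1 := rfl

@[simp] theorem esize_nil : esize ([] : List α) = 1 := rfl

@[simp] theorem esize_cons (a : α) (l : List α) : esize (a :: l) = esize a + esize l + 1 := rfl

theorem esize_int (z : ℤ) : esize z = Nat.size z.natAbs + 1 := rfl

theorem esize_nat (n : ℕ) : esize n = Nat.size n + 1 := rfl

theorem esize_append (l l' : List α) : esize (l ++ l') + 1 = esize l + esize l' := by
  induction l with
  | nil => simp; omega
  | cons a l ih => simp; omega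

@[simp] theorem esize_reverse (l : List α) : esize l.reverse = esize l := by
  induction l with
  | nil => rfl
  | cons a l ih =>
    have := esize_append l.reverse [a]
    simp at this ⊢
    omega

theorem esize_le_of_mem {a : α} {l : List α} (h : a ∈ l) : esize a ≤ esize l := by
  induction l with
  | nil => simp at h
  | cons b l ih =>
    rcases List.mem_cons.1 h with rfl | h
    · simp; omega
    · have := ih h; simp; omega

theorem length_lt_esize (l : List α) : l.length < esize l := by
  induction l with
  | nil => simp
  | cons b l ih => simp; omega

theorem esize_list_le {l : List α} {s : ℕ} (h : ∀ a ∈ l, esize a ≤ s) :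
    esize l ≤ l.length * (s + 1) + 1 := by
  induction l with
  | nil => simp
  | cons b l ih =>
    have := ih fun a ha => h a (List.mem_cons_of_mem _ ha)
    have := h b (by simp)
    simp only [esize_cons, List.length_cons]
    linarith

theorem esize_le_of_suffix {l l' : List α} (h : l <:+ l') : esize l ≤ esize l' := by
  obtain ⟨t, rfl⟩ := h
  have := esize_append t l
  have := one_le_esize t
  omega

theorem esize_le_of_prefix {l l' : List α} (h : l <+: l') : esize l ≤ esize l' := by
  obtain ⟨t, rfl⟩ := h
  have := esize_append l t
  have := one_le_esize t
  omega

/-- `f` is computed by an oracle program in time polynomial in the size of its argument. -/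
def PolyTime (f : (Data → Data) → α → β) : Prop :=
  ∃ (M : Prog) (p : ℕ[X]), ∀ O a, ∃ c, Runs O M (enc a) (enc (f O a)) c ∧ c ≤ p.eval (esize a)

/-- The value of `f` is polynomially bounded in the size of its argument. -/
def SmallVal (f : (Data → Data) → α → ℕ) : Prop :=
  ∃ p : ℕ[X], ∀ O a, f O a ≤ p.eval (esize a)

theorem PolyTime.smallVal {f : (Data → Data) → α → β} (h : PolyTime f) :
    SmallVal fun O a => esize (f O a) := by
  obtain ⟨M, p, h⟩ := h
  refine ⟨p, fun O a => ?_⟩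
  obtain ⟨c, hc, hp⟩ := h O a
  exact hc.size_output_le.trans hp

theorem SmallVal.mono {f g : (Data → Data) → α → ℕ} (h : SmallVal f) (hg : ∀ O a, g O a ≤ f O a) :
    SmallVal g := by
  obtain ⟨p, h⟩ := h
  exact ⟨p, fun O a => (hg O a).trans (h O a)⟩

theorem SmallVal.const (n : ℕ) : SmallVal fun _ (_ : α) => n := ⟨C n, fun _ _ => by simp⟩

theorem SmallVal.esize_self : SmallVal fun _ (a : α) => esize a := ⟨X, fun _ _ => by simp⟩

theorem SmallVal.add {f g : (Data → Data) → α → ℕ} (hf : SmallVal f) (hg : SmallVal g) :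
    SmallVal fun O a => f O a + g O a := by
  obtain ⟨p, hp⟩ := hf
  obtain ⟨q, hq⟩ := hg
  exact ⟨p + q, fun O a => by simpa using add_le_add (hp O a) (hq O a)⟩

theorem SmallVal.mul {f g : (Data → Data) → α → ℕ} (hf : SmallVal f) (hg : SmallVal g) :
    SmallVal fun O a => f O a * g O a := by
  obtain ⟨p, hp⟩ := hf
  obtain ⟨q, hq⟩ := hg
  exact ⟨p * q, fun O a => by simpa using Nat.mul_le_mul (hp O a) (hq O a)⟩

/-- A polynomially bounded function of a polynomially bounded quantity. -/
theorem SmallVal.poly {f : (Data → Data) → α → ℕ} (hf : SmallVal f) (q : ℕ[X]) :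
    SmallVal fun O a => q.eval (f O a) := by
  obtain ⟨p, hp⟩ := hf
  exact ⟨q.comp p, fun O a => by simpa using eval_le_eval q (hp O a)⟩

theorem SmallVal.comp {f : (Data → Data) → β → ℕ} {g : (Data → Data) → α → β}
    (hf : SmallVal f) (hg : PolyTime g) : SmallVal fun O a => f O (g O a) := by
  obtain ⟨p, hp⟩ := hf
  exact (hg.smallVal.poly p).mono fun O a => hp _ _

/-- Running a fixed program whose cost is bounded by a `SmallVal`. -/
theorem PolyTime.of_runs {f : (Data → Data) → α → β} (M : Prog) {b : (Data → Data) → α → ℕ}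
    (hb : SmallVal b) (h : ∀ O a, ∃ c, Runs O M (enc a) (enc (f O a)) c ∧ c ≤ b O a) :
    PolyTime f := by
  obtain ⟨p, hp⟩ := hb
  refine ⟨M, p, fun O a => ?_⟩
  obtain ⟨c, hc, hcb⟩ := h O a
  exact ⟨c, hc, hcb.trans (hp O a)⟩

/-- A function computed by an elementary instruction that does not enlarge its argument too much. -/
theorem PolyTime.of_op {f : (Data → Data) → α → β} (o : Op)
    (h : ∀ O a, o.eval (enc a) = enc (f O a)) (hs : SmallVal fun O a => esize (f O a)) :
    PolyTime f :=
  .of_runs (.op o) (((SmallVal.const 1).add .esize_self).add hs) fun O a =>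
    ⟨1 + esize a + esize (f O a), by
      have := Runs.op (O := O) o (enc a)
      rwa [h O a] at this, le_rfl⟩

theorem PolyTime.comp {f : (Data → Data) → β → γ} {g : (Data → Data) → α → β}
    (hf : PolyTime f) (hg : PolyTime g) : PolyTime fun O a => f O (g O a) := by
  have hs := hg.smallVal
  obtain ⟨M, p, hM⟩ := hf
  obtain ⟨N, q, hN⟩ := hg
  refine .of_runs (.seq N M) (((SmallVal.esize_self.poly q).add (hs.poly p)).add (.const 1))
    fun O a => ?_
  obtain ⟨c, hc, hcq⟩ := hN O a
  obtain ⟨d, hd, hdp⟩ := hM O (g O a)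
  exact ⟨_, hc.seq hd, by gcongr⟩

theorem PolyTime.id : PolyTime fun _ (a : α) => a :=
  .of_op .id (fun _ _ => rfl) .esize_self

theorem PolyTime.const (b : β) : PolyTime fun _ (_ : α) => b :=
  .of_op (.const (enc b)) (fun _ _ => rfl) (.const _)

theorem PolyTime.pair {f : (Data → Data) → α → β} {g : (Data → Data) → α → γ}
    (hf : PolyTime f) (hg : PolyTime g) : PolyTime fun O a => (f O a, g O a) := by
  obtain ⟨M, p, hM⟩ := hf
  obtain ⟨N, q, hN⟩ := hg
  refine .of_runs (.fork M N) (((SmallVal.esize_self.poly p).add (SmallVal.esize_self.poly q)).add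
    (.const 1)) fun O a => ?_
  obtain ⟨c, hc, hcp⟩ := hM O a
  obtain ⟨d, hd, hdq⟩ := hN O a
  exact ⟨_, hc.fork hd, by gcongr⟩

theorem PolyTime.fst_op : PolyTime fun _ (p : α × β) => p.1 :=
  .of_op .fst (fun _ _ => rfl) (SmallVal.esize_self.mono fun _ a => by
    obtain ⟨a, b⟩ := a; simp only [esize_pair]; omega)

theorem PolyTime.snd_op : PolyTime fun _ (p : α × β) => p.2 :=
  .of_op .snd (fun _ _ => rfl) (SmallVal.esize_self.mono fun _ a => by
    obtain ⟨a, b⟩ := a; simp only [esize_pair]; omega)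

theorem PolyTime.fst {f : (Data → Data) → α → β × γ} (hf : PolyTime f) :
    PolyTime fun O a => (f O a).1 := PolyTime.fst_op.comp hf

theorem PolyTime.snd {f : (Data → Data) → α → β × γ} (hf : PolyTime f) :
    PolyTime fun O a => (f O a).2 := PolyTime.snd_op.comp hf

/-- Reinterpretation of data. -/
theorem PolyTime.recast {f : (Data → Data) → α → β} {g : (Data → Data) → α → γ}
    (hf : PolyTime f) (h : ∀ O a, enc (f O a) = enc (g O a)) : PolyTime g := by
  obtain ⟨M, p, hM⟩ := hf
  exact ⟨M, p, fun O a => by simpa only [h] using hM O a⟩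

theorem PolyTime.ite {b : (Data → Data) → α → Bool} {f g : (Data → Data) → α → β}
    (hb : PolyTime b) (hf : PolyTime f) (hg : PolyTime g) :
    PolyTime fun O a => if b O a then f O a else g O a := by
  obtain ⟨B, r, hB⟩ := hb
  obtain ⟨M, p, hM⟩ := hf
  obtain ⟨N, q, hN⟩ := hg
  refine .of_runs (.ite B M N) ((((SmallVal.esize_self.poly r).add
    (SmallVal.esize_self.poly p)).add (SmallVal.esize_self.poly q)).add (.const 1)) fun O a => ?_
  obtain ⟨e, he, her⟩ := hB O a
  obtain ⟨c, hc, hcp⟩ := hM O a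
  obtain ⟨d, hd, hdq⟩ := hN O a
  cases h : b O a
  · exact ⟨_, .ite_false (by simpa [h, enc] using he) (by simpa using hd), by omega⟩
  · exact ⟨_, .ite_true he (by simp [h, enc]) (by simpa using hc), by omega⟩

/-! #### Arithmetic -/

theorem natAbs_ediv_le (a b : ℤ) : (a / b).natAbs ≤ a.natAbs := by
  exact Int.natAbs_ediv_le_natAbs a b

theorem size_add_le (a b : ℕ) : Nat.size (a + b) ≤ Nat.size a + Nat.size b + 1 := by
  rw [Nat.size_le]
  have ha := Nat.lt_size_self a
  have hb := Nat.lt_size_self b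
  have h1 : 2 ^ a.size ≤ 2 ^ (a.size + b.size) := Nat.pow_le_pow_right (by norm_num) (by omega)
  have h2 : 2 ^ b.size ≤ 2 ^ (a.size + b.size) := Nat.pow_le_pow_right (by norm_num) (by omega)
  rw [pow_succ]
  omega

theorem size_mul_le (a b : ℕ) : Nat.size (a * b) ≤ Nat.size a + Nat.size b := by
  rw [Nat.size_le, pow_add]
  exact Nat.mul_lt_mul'' (Nat.lt_size_self a) (Nat.lt_size_self b)

theorem esize_int_add_le (a b : ℤ) : esize (a + b) ≤ esize a + esize b := by
  have := size_add_le a.natAbs b.natAbs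
  have := Nat.size_le_size (Int.natAbs_add_le a b)
  simp only [esize_int]
  omega

theorem esize_int_sub_le (a b : ℤ) : esize (a - b) ≤ esize a + esize b := by
  have := esize_int_add_le a (-b)
  rwa [← sub_eq_add_neg, show esize (-b) = esize b by simp [esize_int]] at this

theorem esize_int_mul_le (a b : ℤ) : esize (a * b) ≤ esize a + esize b := by
  have := size_mul_le a.natAbs b.natAbs
  simp only [esize_int, Int.natAbs_mul]
  omega

theorem esize_nat_mul_le (a b : ℕ) : esize (a * b) ≤ esize a + esize b := by
  have := size_mul_le a b
  simp only [esize_nat]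
  omega

theorem PolyTime.int_add {f g : (Data → Data) → α → ℤ} (hf : PolyTime f) (hg : PolyTime g) :
    PolyTime fun O a => f O a + g O a := by
  refine PolyTime.comp (f := fun _ (p : ℤ × ℤ) => p.1 + p.2) (.of_op .add (fun _ _ => rfl) ?_)
    (hf.pair hg)
  exact SmallVal.esize_self.mono fun _ ⟨a, b⟩ => by
    have := esize_int_add_le a b; simp only [esize_pair]; omega

theorem PolyTime.int_sub {f g : (Data → Data) → α → ℤ} (hf : PolyTime f) (hg : PolyTime g) :
    PolyTime fun O a => f O a - g O a := by
  refine PolyTime.comp (f := fun _ (p : ℤ × ℤ) => p.1 - p.2) (.of_op .sub (fun _ _ => rfl) ?_)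
    (hf.pair hg)
  exact SmallVal.esize_self.mono fun _ ⟨a, b⟩ => by
    have := esize_int_sub_le a b; simp only [esize_pair]; omega

theorem PolyTime.int_mul {f g : (Data → Data) → α → ℤ} (hf : PolyTime f) (hg : PolyTime g) :
    PolyTime fun O a => f O a * g O a := by
  refine PolyTime.comp (f := fun _ (p : ℤ × ℤ) => p.1 * p.2) (.of_op .mul (fun _ _ => rfl) ?_)
    (hf.pair hg)
  exact SmallVal.esize_self.mono fun _ ⟨a, b⟩ => by
    have := esize_int_mul_le a b; simp only [esize_pair]; omega

theorem PolyTime.int_div {f g : (Data → Data) → α → ℤ} (hf : PolyTime f) (hg : PolyTime g) :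
    PolyTime fun O a => f O a / g O a := by
  refine PolyTime.comp (f := fun _ (p : ℤ × ℤ) => p.1 / p.2) (.of_op .div (fun _ _ => rfl) ?_)
    (hf.pair hg)
  exact SmallVal.esize_self.mono fun _ ⟨a, b⟩ => by
    have := Nat.size_le_size (natAbs_ediv_le a b)
    simp only [esize_pair, esize_int]; omega

theorem PolyTime.int_lt {f g : (Data → Data) → α → ℤ} (hf : PolyTime f) (hg : PolyTime g) :
    PolyTime fun O a => decide (f O a < g O a) := by
  refine PolyTime.comp (f := fun _ (p : ℤ × ℤ) => decide (p.1 < p.2))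
    (.of_op .lt (fun _ ⟨a, b⟩ => by simp [enc, Op.eval]) ?_) (hf.pair hg)
  exact (SmallVal.const 2).mono fun _ ⟨a, b⟩ => by
    by_cases h : a < b <;> simp [h, esize, enc, Data.size]

theorem PolyTime.natCast {f : (Data → Data) → α → ℕ} (hf : PolyTime f) :
    PolyTime fun O a => (f O a : ℤ) := hf.recast fun _ _ => rfl

theorem PolyTime.of_natCast {f : (Data → Data) → α → ℕ} (hf : PolyTime fun O a => (f O a : ℤ)) :
    PolyTime f := hf.recast fun _ _ => rfl

theorem PolyTime.nat_add {f g : (Data → Data) → α → ℕ} (hf : PolyTime f) (hg : PolyTime g) :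
    PolyTime fun O a => f O a + g O a :=
  .of_natCast (by simpa using hf.natCast.int_add hg.natCast)

theorem PolyTime.nat_mul {f g : (Data → Data) → α → ℕ} (hf : PolyTime f) (hg : PolyTime g) :
    PolyTime fun O a => f O a * g O a :=
  .of_natCast (by simpa using hf.natCast.int_mul hg.natCast)

theorem PolyTime.nat_div {f g : (Data → Data) → α → ℕ} (hf : PolyTime f) (hg : PolyTime g) :
    PolyTime fun O a => f O a / g O a :=
  .of_natCast (by simpa using hf.natCast.int_div hg.natCast)

theorem PolyTime.nat_mod {f g : (Data → Data) → α → ℕ} (hf : PolyTime f) (hg : PolyTime g) :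
    PolyTime fun O a => f O a % g O a := by
  refine PolyTime.comp (f := fun _ (p : ℕ × ℕ) => p.1 % p.2)
    (.of_op .mod (fun _ ⟨a, b⟩ => by simp [enc, Op.eval]) ?_) (hf.pair hg)
  exact SmallVal.esize_self.mono fun _ ⟨a, b⟩ => by
    have := Nat.size_le_size (Nat.mod_le a b)
    simp only [esize_pair, esize_nat]; omega

theorem PolyTime.nat_pred {f : (Data → Data) → α → ℕ} (hf : PolyTime f) :
    PolyTime fun O a => f O a - 1 := by
  have h := PolyTime.ite (PolyTime.int_lt (.const 0) hf.natCast)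
    (hf.natCast.int_sub (.const 1)) (.const (0 : ℤ))
  refine .of_natCast (h.recast fun O a => ?_)
  congr 1
  rcases Nat.eq_zero_or_pos (f O a) with h | h
  · simp [h]
  · simp [h]

theorem PolyTime.natAbs {f : (Data → Data) → α → ℤ} (hf : PolyTime f) :
    PolyTime fun O a => (f O a).natAbs := by
  refine .of_natCast ((PolyTime.ite (hf.int_lt (.const 0)) ((PolyTime.const 0).int_sub hf)
    hf).recast fun O a => ?_)
  congr 1
  by_cases h : f O a < 0
  · simp [h, abs_of_neg h]
  · simp [h, abs_of_nonneg (not_lt.1 h)]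

theorem PolyTime.pos {f : (Data → Data) → α → ℕ} (hf : PolyTime f) :
    PolyTime fun O a => decide (0 < f O a) := by
  simpa using PolyTime.int_lt (.const 0) hf.natCast

/-! #### Lists and queries -/

theorem PolyTime.cons {f : (Data → Data) → α → β} {l : (Data → Data) → α → List β}
    (hf : PolyTime f) (hl : PolyTime l) : PolyTime fun O a => f O a :: l O a :=
  (hf.pair hl).recast fun _ _ => rfl

/-- Case distinction on a list. -/
def listCase (l : List β) (g : γ) (h : β → List β → γ) : γ :=
  match l with
  | [] => g
  | b :: t => h b t

/-- A nonempty list has the same encoding as the pair of its head and its tail, and the empty list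
is `int 0`. So `isPair` decides the case, and forking the input with the list already produces the
argument of the second branch. -/
theorem PolyTime.listCase {l : (Data → Data) → α → List β} {g : (Data → Data) → α → γ}
    {h : (Data → Data) → α → β → List β → γ} (hl : PolyTime l) (hg : PolyTime g)
    (hh : PolyTime fun O (p : α × β × List β) => h O p.1 p.2.1 p.2.2) :
    PolyTime fun O a => listCase (l O a) (g O a) (h O a) := by
  obtain ⟨L, r, hL⟩ := hl
  obtain ⟨M, p, hM⟩ := hg
  obtain ⟨N, q, hN⟩ := hh
  refine .of_runs (.ite (.seq L (.op .isPair)) (.seq (.fork (.op .id) L) N) M)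
    (b := fun O a => 2 * r.eval (esize a) + p.eval (esize a)
      + q.eval (esize a + r.eval (esize a) + 2) + (r.eval (esize a) + 2 * esize a + 10)) ?_ ?_
  · exact ((((SmallVal.const 2).mul (SmallVal.esize_self.poly r)).add
      (SmallVal.esize_self.poly p)).add
      (((SmallVal.esize_self.add (SmallVal.esize_self.poly r)).add (.const 2)).poly q)).add
      (((SmallVal.esize_self.poly r).add ((SmallVal.const 2).mul SmallVal.esize_self)).add
        (.const 10))
  · intro O a
    obtain ⟨e, he, her⟩ := hL O a
    obtain ⟨c, hc, hcp⟩ := hM O a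
    have hsz := he.size_output_le
    cases h1 : l O a with
    | nil =>
      rw [h1] at he
      have hi : Runs O (.op .isPair) (enc ([] : List β)) (.int 0) 3 := Runs.op .isPair (.int 0)
      exact ⟨_, .ite_false (he.seq hi) hc, by omega⟩
    | cons b t =>
      obtain ⟨d, hd, hdq⟩ := hN O (a, b, t)
      rw [h1] at he hsz
      have hi := Runs.op (O := O) .isPair (enc (b :: t))
      refine ⟨_, .ite_true (he.seq hi) (by simp [enc, Data.ofList, Op.eval])
        (((Runs.op .id (enc a)).fork he).seq hd), ?_⟩
      have h2 : esize (a, b, t) ≤ esize a + r.eval (esize a) + 2 := by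
        have : esize (b :: t) ≤ e := hsz
        simp only [esize_pair, esize_cons] at this ⊢
        omega
      have h3 := eval_le_eval q h2
      have h4 : (Op.eval .id (enc a)).size = esize a := rfl
      have h5 : (Op.eval .isPair (enc (b :: t))).size = 2 := by
        simp [enc, Data.ofList, Op.eval, Data.size]
      rw [h4, h5]
      change e + (1 + esize (b :: t) + 2) + 1 + ((1 + esize a + esize a) + e + 1 + d + 1) + 1 ≤ _
      have h6 : esize (b :: t) ≤ e := hsz
      omega

theorem PolyTime.tail {l : (Data → Data) → α → List β} (hl : PolyTime l) :
    PolyTime fun O a => (l O a).tail := by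
  refine (PolyTime.listCase (g := fun _ _ => []) (h := fun _ _ _ t => t) hl (.const [])
    PolyTime.id.snd.snd).recast fun O a => ?_
  cases l O a <;> rfl

theorem PolyTime.headD {l : (Data → Data) → α → List β} (hl : PolyTime l) (d : β) :
    PolyTime fun O a => (l O a).headD d := by
  refine (PolyTime.listCase (g := fun _ _ => d) (h := fun _ _ b _ => b) hl (.const d)
    PolyTime.id.snd.fst).recast fun O a => ?_
  cases l O a <;> rfl

/-- All reserved bits are charged, so the reservation must be polynomial as a number and not merely
in its bit length. -/
theorem PolyTime.query {b : (Data → Data) → α → ℕ} {q : (Data → Data) → α → Data}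
    (hb : PolyTime b) (hq : PolyTime q) (hs : SmallVal b) :
    PolyTime fun O a => reply O (.pair (.int (b O a)) (q O a)) := by
  have hsz := (hb.pair hq).smallVal
  obtain ⟨M, p, hM⟩ := hb.pair hq
  refine .of_runs (.seq M .query) (((SmallVal.esize_self.poly p).add
    (((SmallVal.const 1).add hsz).add hs)).add (.const 1)) fun O a => ?_
  obtain ⟨c, hc, hcp⟩ := hM O a
  refine ⟨_, hc.seq (.query _), ?_⟩
  have : budget (enc (b O a, q O a)) = b O a := by simp [enc, budget]
  rw [this]
  simp only [esize] at *
  omega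

/-! #### Iteration -/

/-- The exact number `N` of iterations is prescribed in advance, so that the result is an iterate
and termination needs no separate argument. -/
theorem runs_loop {O : Data → Data} {test : σ → Bool} {step : σ → σ} {B S : Prog} {p q : ℕ[X]}
    (hB : ∀ x, ∃ c, Runs O B (enc x) (enc (test x)) c ∧ c ≤ p.eval (esize x))
    (hS : ∀ x, ∃ c, Runs O S (enc x) (enc (step x)) c ∧ c ≤ q.eval (esize x)) (s : ℕ) :
    ∀ (N : ℕ) (x : σ), (∀ i < N, test (step^[i] x) = true) → test (step^[N] x) = false →
      (∀ i ≤ N, esize (step^[i] x) ≤ s) →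
      ∃ c, Runs O (.loop B S) (enc x) (enc (step^[N] x)) c ∧
        c ≤ (N + 1) * (p.eval s + q.eval s + 1) := by
  intro N
  induction N with
  | zero =>
    intro x _ hf hs
    obtain ⟨c, hc, hcp⟩ := hB x
    have hf : test x = false := hf
    rw [hf] at hc
    refine ⟨_, Runs.loop_stop hc, ?_⟩
    have := eval_le_eval p (hs 0 le_rfl)
    simp only [Function.iterate_zero, _root_.id] at this
    omega
  | succ N ih =>
    intro x ht hf hs
    obtain ⟨c, hc, hcp⟩ := hB x
    obtain ⟨d, hd, hdq⟩ := hS x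
    obtain ⟨e, he, hee⟩ := ih (step x) (fun i hi => ht (i + 1) (by omega)) hf
      fun i hi => hs (i + 1) (by omega)
    have h0 : test x = true := ht 0 (by omega)
    rw [h0] at hc
    refine ⟨_, .loop_step hc (by simp [enc]) hd he, ?_⟩
    have h1 := eval_le_eval p (hs 0 (by omega))
    have h2 := eval_le_eval q (hs 0 (by omega))
    simp only [Function.iterate_zero, _root_.id] at h1 h2
    have : (N + 1 + 1) * (p.eval s + q.eval s + 1)
      = (N + 1) * (p.eval s + q.eval s + 1) + (p.eval s + q.eval s + 1) := by ring
    omega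

theorem PolyTime.while {test : (Data → Data) → σ → Bool} {step : (Data → Data) → σ → σ}
    (ht : PolyTime test) (hs : PolyTime step) {init : (Data → Data) → α → σ} (hi : PolyTime init)
    {N s : (Data → Data) → α → ℕ} (hN : SmallVal N) (hsz : SmallVal s)
    (htrue : ∀ O a, ∀ i < N O a, test O ((step O)^[i] (init O a)) = true)
    (hfalse : ∀ O a, test O ((step O)^[N O a] (init O a)) = false)
    (hsize : ∀ O a, ∀ i ≤ N O a, esize ((step O)^[i] (init O a)) ≤ s O a) :
    PolyTime fun O a => (step O)^[N O a] (init O a) := by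
  obtain ⟨B, p, hB⟩ := ht
  obtain ⟨S, q, hS⟩ := hs
  obtain ⟨M, r, hM⟩ := hi
  refine .of_runs (.seq M (.loop B S)) (((SmallVal.esize_self.poly r).add
    ((hN.add (.const 1)).mul (((hsz.poly p).add (hsz.poly q)).add (.const 1)))).add (.const 1))
    fun O a => ?_
  obtain ⟨c, hc, hcr⟩ := hM O a
  obtain ⟨d, hd, hdb⟩ := runs_loop (hB O) (hS O) (s O a) (N O a) (init O a) (htrue O a)
    (hfalse O a) (hsize O a)
  exact ⟨_, hc.seq hd, by omega⟩

/-- The size hypothesis on every prefix is essential: polynomial steps alone allow repeated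
squaring, which doubles the size each time. -/
theorem PolyTime.foldl {l : (Data → Data) → α → List β} {init : (Data → Data) → α → σ}
    {f : (Data → Data) → α → σ → β → σ} (hl : PolyTime l) (hi : PolyTime init)
    (hf : PolyTime fun O (p : α × σ × β) => f O p.1 p.2.1 p.2.2)
    {s : (Data → Data) → α → ℕ} (hs : SmallVal s)
    (hsize : ∀ O a l', l' <+: l O a → esize (l'.foldl (f O a) (init O a)) ≤ s O a) :
    PolyTime fun O a => (l O a).foldl (f O a) (init O a) := by
  let test : (Data → Data) → α × List β × σ → Bool := fun O x =>
    LatticeReduction.listCase x.2.1 false fun _ _ => true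
  let step : (Data → Data) → α × List β × σ → α × List β × σ := fun O x =>
    LatticeReduction.listCase x.2.1 x fun b t => (x.1, t, f O x.1 x.2.2 b)
  have htest : PolyTime test := .listCase PolyTime.id.snd.fst (.const false) (.const true)
  have hstep : PolyTime step := by
    refine .listCase (h := fun O x b t => (x.1, t, f O x.1 x.2.2 b)) PolyTime.id.snd.fst .id
      (PolyTime.id.fst.fst.pair (PolyTime.id.snd.snd.pair ?_))
    exact hf.comp (PolyTime.id.fst.fst.pair (PolyTime.id.fst.snd.snd.pair PolyTime.id.snd.fst))
  have hit : ∀ O a (k : ℕ) (l : List β) (x : σ), k ≤ l.length →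
      (step O)^[k] (a, l, x) = (a, l.drop k, (l.take k).foldl (f O a) x) := by
    intro O a k
    induction k with
    | zero => intro l x _; simp
    | succ k ih =>
      intro l x hk
      cases l with
      | nil => simp at hk
      | cons b t =>
        have : step O (a, b :: t, x) = (a, t, f O a x b) := rfl
        simp only [Function.iterate_succ, Function.comp, this]
        rw [ih t _ (by simpa using hk)]
        simp
  refine (PolyTime.while htest hstep (init := fun O a => (a, l O a, init O a))
    (N := fun O a => (l O a).length) (PolyTime.id.pair (hl.pair hi))
    (hl.smallVal.mono fun O a => (length_lt_esize _).le)
    (s := fun O a => esize a + (esize (l O a) + s O a + 1) + 1)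
    ((SmallVal.esize_self.add ((hl.smallVal.add hs).add (.const 1))).add (.const 1))
    ?_ ?_ ?_).snd.snd.recast ?_
  · intro O a i hi
    rw [hit O a i _ _ hi.le, List.drop_eq_getElem_cons hi]
    rfl
  · intro O a
    rw [hit O a _ _ _ le_rfl, List.drop_length]
    rfl
  · intro O a i hi
    rw [hit O a i _ _ hi]
    have h1 := esize_le_of_suffix (List.drop_suffix i (l O a))
    have h2 := hsize O a _ (List.take_prefix i (l O a))
    simp only [esize_pair]
    omega
  · intro O a
    rw [hit O a _ _ _ le_rfl, List.take_length]

end Types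

end LatticeReduction

/-! ### Polynomial-time lists, gcds, rational numbers and decoding of answers. -/

namespace LatticeReduction

open Polynomial
open Enc

section Lists
variable {α β γ δ σ : Type} [Enc α] [Enc β] [Enc γ] [Enc δ] [Enc σ]

theorem foldl_cons_eq {B C : Type} (f : B → C) (l : List B) (acc : List C) :
    l.foldl (fun acc b => f b :: acc) acc = (l.map f).reverse ++ acc := by
  induction l generalizing acc with
  | nil => rfl
  | cons b l ih => simp [ih]

theorem PolyTime.reverse {l : (Data → Data) → α → List β} (hl : PolyTime l) :
    PolyTime fun O a => (l O a).reverse := by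
  refine (PolyTime.foldl (init := fun _ _ => ([] : List β)) (f := fun _ _ acc b => b :: acc) hl
    (.const []) (PolyTime.id.snd.snd.cons PolyTime.id.snd.fst) hl.smallVal ?_).recast ?_
  · intro O a l' h
    have := foldl_cons_eq (fun b : β => b) l' []
    simp only [List.map_id', List.append_nil] at this
    rw [this, esize_reverse]
    exact esize_le_of_prefix h
  · intro O a
    have := foldl_cons_eq (fun b : β => b) (l O a) []
    simp only [List.map_id', List.append_nil] at this
    rw [this]

theorem PolyTime.map {l : (Data → Data) → α → List β} {f : (Data → Data) → α → β → γ}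
    (hl : PolyTime l) (hf : PolyTime fun O (p : α × β) => f O p.1 p.2) :
    PolyTime fun O a => (l O a).map (f O a) := by
  obtain ⟨q, hq⟩ := hf.smallVal
  refine (PolyTime.foldl (init := fun _ _ => ([] : List γ))
    (f := fun O a acc b => f O a b :: acc) hl (.const [])
    ((hf.comp (PolyTime.id.fst.pair PolyTime.id.snd.snd)).cons PolyTime.id.snd.fst)
    (s := fun O a => esize (l O a) * (q.eval (esize a + esize (l O a) + 1) + 1) + 1)
    ((hl.smallVal.mul ((((SmallVal.esize_self.add hl.smallVal).add (.const 1)).poly q).add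
      (.const 1))).add (.const 1)) ?_).reverse.recast ?_
  · intro O a l' h
    rw [foldl_cons_eq, List.append_nil, esize_reverse]
    refine (esize_list_le (s := q.eval (esize a + esize (l O a) + 1)) ?_).trans ?_
    · intro c hc
      obtain ⟨b, hb, rfl⟩ := List.mem_map.1 hc
      refine (hq O (a, b)).trans (eval_le_eval q ?_)
      have := esize_le_of_mem (h.subset hb)
      simp only [esize_pair]
      omega
    · have h1 := h.length_le
      have h2 := length_lt_esize (l O a)
      rw [List.length_map]
      gcongr
      omega
  · intro O a
    rw [foldl_cons_eq, List.append_nil, List.reverse_reverse]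

/-- One step of the computation of a zipped list, kept in reverse order. -/
def zipStep {B C : Type} (s : List C × List (B × C)) (b : B) : List C × List (B × C) :=
  listCase s.1 ([], s.2) fun c t => (t, (b, c) :: s.2)

theorem foldl_zipStep {B C : Type} (l : List B) (s : List C × List (B × C)) :
    l.foldl zipStep s = (s.1.drop l.length, (l.zip s.1).reverse ++ s.2) := by
  induction l generalizing s with
  | nil => simp
  | cons b l ih =>
    obtain ⟨r, acc⟩ := s
    cases r with
    | nil => simp [ih, zipStep, listCase]
    | cons c t => simp [ih, zipStep, listCase]

theorem PolyTime.zip {l : (Data → Data) → α → List β} {l' : (Data → Data) → α → List γ}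
    (hl : PolyTime l) (hl' : PolyTime l') : PolyTime fun O a => (l O a).zip (l' O a) := by
  refine ((PolyTime.foldl (init := fun O a => (l' O a, ([] : List (β × γ))))
    (f := fun _ _ s b => zipStep s b) hl (hl'.pair (.const [])) ?_
    (s := fun O a => esize (l' O a) +
      (esize (l O a) * (esize (l O a) + esize (l' O a) + 1 + 1) + 1) + 1)
    ((hl'.smallVal.add ((hl.smallVal.mul (((hl.smallVal.add hl'.smallVal).add (.const 1)).add
      (.const 1))).add (.const 1))).add (.const 1)) ?_).snd).reverse.recast ?_
  · refine .listCase (h := fun _ (p : α × (List γ × List (β × γ)) × β) c t =>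
      (t, (p.2.2, c) :: p.2.1.2)) PolyTime.id.snd.fst.fst
      ((PolyTime.const []).pair PolyTime.id.snd.fst.snd)
      (PolyTime.id.snd.snd.pair ((PolyTime.id.fst.snd.snd.pair PolyTime.id.snd.fst).cons
        PolyTime.id.fst.snd.fst.snd))
  · intro O a l₁ h
    rw [foldl_zipStep]
    have h1 := esize_le_of_suffix (List.drop_suffix l₁.length (l' O a))
    have h2 : esize (l₁.zip (l' O a)) ≤
        esize (l O a) * (esize (l O a) + esize (l' O a) + 1 + 1) + 1 := by
      refine (esize_list_le (s := esize (l O a) + esize (l' O a) + 1) ?_).trans ?_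
      · rintro ⟨b, c⟩ hbc
        have hb := esize_le_of_mem (h.subset (List.of_mem_zip hbc).1)
        have hc := esize_le_of_mem (List.of_mem_zip hbc).2
        simp only [esize_pair]
        omega
      · have h1 := h.length_le
        have h2 := length_lt_esize (l O a)
        rw [List.length_zip]
        gcongr
        omega
    simp only [esize_pair, List.append_nil, esize_reverse]
    omega
  · intro O a
    rw [foldl_zipStep]
    simp

theorem PolyTime.zipWith {l : (Data → Data) → α → List β} {l' : (Data → Data) → α → List γ}
    {f : (Data → Data) → α → β → γ → δ} (hl : PolyTime l) (hl' : PolyTime l')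
    (hf : PolyTime fun O (p : α × β × γ) => f O p.1 p.2.1 p.2.2) :
    PolyTime fun O a => List.zipWith (f O a) (l O a) (l' O a) := by
  refine (PolyTime.map (f := fun O a p => f O a p.1 p.2) (hl.zip hl') hf).recast fun O a => ?_
  rw [List.map_zip_eq_zipWith]
  rfl

theorem PolyTime.int_sum {l : (Data → Data) → α → List ℤ} (hl : PolyTime l) :
    PolyTime fun O a => (l O a).sum := by
  have key : ∀ (l : List ℤ) (x : ℤ), esize (l.foldl (· + ·) x) ≤ esize x + esize l := by
    intro l
    induction l with
    | nil => intro x; simp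
    | cons b l ih =>
      intro x
      have := ih (x + b)
      have := esize_int_add_le x b
      simp only [List.foldl_cons, esize_cons]
      omega
  refine (PolyTime.foldl (init := fun _ _ => (0 : ℤ)) (f := fun _ _ s b => s + b) hl
    (.const 0) (PolyTime.id.snd.fst.int_add PolyTime.id.snd.snd) ((SmallVal.const 1).add
      hl.smallVal) ?_).recast ?_
  · intro O a l' h
    exact (key l' 0).trans (Nat.add_le_add (by simp [esize_int]) (esize_le_of_prefix h))
  · intro O a
    rw [List.sum_eq_foldl]

theorem PolyTime.nat_prod {l : (Data → Data) → α → List ℕ} (hl : PolyTime l) :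
    PolyTime fun O a => (l O a).prod := by
  have key : ∀ (l : List ℕ) (x : ℕ), esize (l.foldl (· * ·) x) ≤ esize x + esize l := by
    intro l
    induction l with
    | nil => intro x; simp
    | cons b l ih =>
      intro x
      have := ih (x * b)
      have := esize_nat_mul_le x b
      simp only [List.foldl_cons, esize_cons]
      omega
  refine (PolyTime.foldl (init := fun _ _ => (1 : ℕ)) (f := fun _ _ s b => s * b) hl
    (.const 1) (PolyTime.id.snd.fst.nat_mul PolyTime.id.snd.snd) ((SmallVal.const 2).add
      hl.smallVal) ?_).recast ?_
  · intro O a l' h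
    exact (key l' 1).trans (Nat.add_le_add (by simp [esize_nat]) (esize_le_of_prefix h))
  · intro O a
    rw [List.prod_eq_foldl]

theorem esize_nat_le (n : ℕ) : esize n ≤ n + 1 := by
  have : Nat.size n ≤ n := Nat.size_le.2 Nat.lt_two_pow_self
  simp only [esize_nat]
  omega

theorem esize_nat_mono {m n : ℕ} (h : m ≤ n) : esize m ≤ esize n := by
  simpa [esize_nat] using Nat.size_le_size h

/-- The list is as long as the number is large, hence the demand `SmallVal n` on its value. -/
theorem PolyTime.range {n : (Data → Data) → α → ℕ} (hn : PolyTime n) (hs : SmallVal n) :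
    PolyTime fun O a => List.range (n O a) := by
  let test : (Data → Data) → ℕ × List ℕ → Bool := fun _ x => decide (0 < x.1)
  let step : (Data → Data) → ℕ × List ℕ → ℕ × List ℕ := fun _ x => (x.1 - 1, (x.1 - 1) :: x.2)
  have htest : PolyTime test := PolyTime.id.fst.pos
  have hstep : PolyTime step :=
    PolyTime.id.fst.nat_pred.pair (PolyTime.id.fst.nat_pred.cons PolyTime.id.snd)
  have hit : ∀ (O : Data → Data) (n i : ℕ), i ≤ n →
      (step O)^[i] (n, []) = (n - i, List.range' (n - i) i) := by
    intro O n i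
    induction i with
    | zero => intro _; simp
    | succ i ih =>
      intro hi
      rw [Function.iterate_succ_apply', ih (by omega)]
      have : n - i = n - (i + 1) + 1 := by omega
      simp only [step, List.range'_succ, this]
      simp
  refine (PolyTime.while htest hstep (init := fun O a => (n O a, ([] : List ℕ)))
    (N := n) (hn.pair (.const [])) hs
    (s := fun O a => (n O a + 1) + (n O a * (n O a + 1 + 1) + 1) + 1)
    (((hs.add (.const 1)).add ((hs.mul ((hs.add (.const 1)).add (.const 1))).add
      (.const 1))).add (.const 1)) ?_ ?_ ?_).snd.recast ?_
  · intro O a i hi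
    rw [hit O _ i hi.le]
    simpa [test] using hi
  · intro O a
    rw [hit O _ _ le_rfl]
    simp [test]
  · intro O a i hi
    rw [hit O _ i hi, esize_pair]
    have h1 : esize (n O a - i) ≤ n O a + 1 := (esize_nat_le _).trans (by omega)
    have h2 : esize (List.range' (n O a - i) i) ≤ n O a * (n O a + 1 + 1) + 1 := by
      refine (esize_list_le (s := n O a + 1) fun b hb => ?_).trans ?_
      · obtain ⟨k, hk, rfl⟩ := List.mem_range'.1 hb
        exact (esize_nat_le _).trans (by omega)
      · rw [List.length_range']
        gcongr
    omega
  · intro O a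
    rw [hit O _ _ le_rfl, List.range_eq_range']
    simp

theorem PolyTime.length {l : (Data → Data) → α → List β} (hl : PolyTime l) :
    PolyTime fun O a => (l O a).length := by
  refine .of_natCast (((hl.map (f := fun _ _ _ => (1 : ℤ)) (.const 1)).int_sum).recast
    fun O a => ?_)
  simp

theorem SmallVal.length {l : (Data → Data) → α → List β} (hl : PolyTime l) :
    SmallVal fun O a => (l O a).length :=
  hl.smallVal.mono fun _ _ => (length_lt_esize _).le

theorem PolyTime.drop {l : (Data → Data) → α → List β} {n : (Data → Data) → α → ℕ}
    (hl : PolyTime l) (hn : PolyTime n) (hs : SmallVal n) :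
    PolyTime fun O a => (l O a).drop (n O a) := by
  have key : ∀ (l₁ : List ℕ) (l : List β),
      l₁.foldl (fun l _ => l.tail) l = l.drop l₁.length := by
    intro l₁
    induction l₁ with
    | nil => intro l; simp
    | cons _ _ ih => intro l; simp [ih]
  refine (PolyTime.foldl (init := l) (f := fun _ _ l _ => l.tail) (hn.range hs) hl
    PolyTime.id.snd.fst.tail hl.smallVal ?_).recast ?_
  · intro O a l₁ _
    rw [key]
    exact esize_le_of_suffix (List.drop_suffix _ _)
  · intro O a
    rw [key, List.length_range]

theorem PolyTime.getD {l : (Data → Data) → α → List β} {n : (Data → Data) → α → ℕ}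
    (hl : PolyTime l) (hn : PolyTime n) (hs : SmallVal n) (d : β) :
    PolyTime fun O a => (l O a).getD (n O a) d := by
  refine ((hl.drop hn hs).headD d).recast fun O a => ?_
  rw [List.headD_eq_head?_getD, List.head?_drop, List.getD_eq_getElem?_getD]

/-- Number of binary digits. -/
theorem PolyTime.nat_size {n : (Data → Data) → α → ℕ} (hn : PolyTime n) :
    PolyTime fun O a => Nat.size (n O a) := by
  let test : (Data → Data) → ℕ × ℕ → Bool := fun _ x => decide (0 < x.1)
  let step : (Data → Data) → ℕ × ℕ → ℕ × ℕ := fun _ x => (x.1 / 2, x.2 + 1)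
  have htest : PolyTime test := PolyTime.id.fst.pos
  have hstep : PolyTime step :=
    (PolyTime.id.fst.nat_div (.const 2)).pair (PolyTime.id.snd.nat_add (.const 1))
  have hit : ∀ (O : Data → Data) (n i : ℕ), (step O)^[i] (n, 0) = (n / 2 ^ i, i) := by
    intro O n i
    induction i with
    | zero => simp
    | succ i ih =>
      rw [Function.iterate_succ_apply', ih]
      simp only [step, Nat.div_div_eq_div_mul, pow_succ]
  refine (PolyTime.while htest hstep (init := fun O a => (n O a, 0))
    (N := fun O a => Nat.size (n O a)) (hn.pair (.const 0))
    (hn.smallVal.mono fun O a => by rw [esize_nat]; omega)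
    (s := fun O a => esize (n O a) + (esize (n O a) + 1) + 1)
    ((hn.smallVal.add (hn.smallVal.add (.const 1))).add (.const 1)) ?_ ?_ ?_).snd.recast ?_
  · intro O a i hi
    rw [hit O]
    have := Nat.lt_size.1 hi
    simpa [test] using this
  · intro O a
    rw [hit O]
    have := Nat.lt_size_self (n O a)
    simpa [test] using this
  · intro O a i hi
    rw [hit O, esize_pair]
    have h1 := esize_nat_mono (Nat.div_le_self (n O a) (2 ^ i))
    have h2 := esize_nat_le i
    have h3 := esize_nat (n O a)
    omega
  · intro O a
    rw [hit O]

theorem SmallVal.nat_size {n : (Data → Data) → α → ℕ} (hn : PolyTime n) :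
    SmallVal fun O a => Nat.size (n O a) :=
  hn.smallVal.mono fun O a => by rw [esize_nat]; omega

theorem PolyTime.two_pow {n : (Data → Data) → α → ℕ} (hn : PolyTime n) (hs : SmallVal n) :
    PolyTime fun O a => 2 ^ n O a := by
  refine ((hn.range hs).map (f := fun _ _ _ => 2) (.const 2)).nat_prod.recast fun O a => ?_
  simp

/-! #### Greatest common divisors and rational numbers -/

/-- Two Euclidean steps at least halve the first entry, so twice its binary length many steps
suffice. The step fixes pairs with first entry 0, which permits a fold of predetermined length. -/
theorem PolyTime.nat_gcd {m n : (Data → Data) → α → ℕ} (hm : PolyTime m) (hn : PolyTime n) :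
    PolyTime fun O a => Nat.gcd (m O a) (n O a) := by
  let f : ℕ × ℕ → ℕ × ℕ := fun x => if decide (0 < x.1) then (x.2 % x.1, x.1) else x
  have hgcd : ∀ x, Nat.gcd (f x).1 (f x).2 = Nat.gcd x.1 x.2 := by
    rintro ⟨x, y⟩
    by_cases h : 0 < x
    · simp only [f, h]
      exact (Nat.gcd_rec x y).symm
    · simp [f, h]
  have hle1 : ∀ x, (f x).1 ≤ x.1 := by
    rintro ⟨x, y⟩
    by_cases h : 0 < x
    · simpa [f, h] using (Nat.mod_lt y h).le
    · simp [f, h]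
  have hle2 : ∀ x, (f x).2 ≤ max x.1 x.2 := by
    rintro ⟨x, y⟩
    by_cases h : 0 < x
    · simp [f, h]
    · simp [f, h]
  have hhalf : ∀ x, (f (f x)).1 ≤ x.1 / 2 := by
    rintro ⟨x, y⟩
    by_cases h : 0 < x
    · by_cases h' : 0 < y % x
      · simp only [f, h, h', decide_true, if_true]
        have h1 := Nat.mod_lt y h
        have h2 := Nat.mod_lt x h'
        have h3 := Nat.div_add_mod x (y % x)
        have h4 : 1 ≤ x / (y % x) := Nat.div_pos h1.le h'
        have h5 : y % x ≤ y % x * (x / (y % x)) := Nat.le_mul_of_pos_right _ h4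
        omega
      · have : y % x = 0 := by omega
        simp [f, h, this]
    · have : x = 0 := by omega
      simp [f, this]
  have hzero : ∀ (k : ℕ) (x : ℕ × ℕ), Nat.size x.1 ≤ k → (f^[2 * k] x).1 = 0 := by
    intro k
    induction k with
    | zero =>
      intro x hx
      simpa [Nat.size_eq_zero] using hx
    | succ k ih =>
      intro x hx
      rw [show 2 * (k + 1) = 2 * k + 1 + 1 by ring, Function.iterate_succ_apply,
        Function.iterate_succ_apply]
      refine ih _ (Nat.size_le.2 ((hhalf x).trans_lt ?_))
      have := Nat.size_le.1 hx
      rw [pow_succ] at this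
      omega
  have hpow : ∀ k x, Nat.gcd (f^[k] x).1 (f^[k] x).2 = Nat.gcd x.1 x.2 ∧
      (f^[k] x).1 ≤ max x.1 x.2 ∧ (f^[k] x).2 ≤ max x.1 x.2 := by
    intro k x
    induction k with
    | zero => simp
    | succ k ih =>
      rw [Function.iterate_succ_apply']
      have h1 := hle1 (f^[k] x)
      have h2 := hle2 (f^[k] x)
      refine ⟨(hgcd _).trans ih.1, h1.trans ih.2.1, h2.trans (max_le ih.2.1 ih.2.2)⟩
  have hfold : ∀ (l : List ℕ) (x : ℕ × ℕ), l.foldl (fun x _ => f x) x = f^[l.length] x := by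
    intro l
    induction l with
    | nil => intro x; rfl
    | cons _ l ih => intro x; simp [ih]
  have hf : PolyTime fun _ (x : ℕ × ℕ) => f x :=
    .ite PolyTime.id.fst.pos ((PolyTime.id.snd.nat_mod PolyTime.id.fst).pair PolyTime.id.fst) .id
  refine ((PolyTime.foldl (init := fun O a => (m O a, n O a)) (f := fun _ _ x _ => f x)
    (((PolyTime.const 2).nat_mul hm.nat_size).range
      ((SmallVal.const 2).mul (SmallVal.nat_size hm)))
    (hm.pair hn) (hf.comp PolyTime.id.snd.fst) (s := fun O a => (esize (m O a) + esize (n O a)) +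
      (esize (m O a) + esize (n O a)) + 1) (((hm.smallVal.add hn.smallVal).add
        (hm.smallVal.add hn.smallVal)).add (.const 1)) ?_).snd).recast ?_
  · intro O a l' _
    rw [hfold]
    obtain ⟨-, h1, h2⟩ := hpow l'.length (m O a, n O a)
    have h3 : esize (max (m O a) (n O a)) ≤ esize (m O a) + esize (n O a) := by
      rcases max_choice (m O a) (n O a) with h | h <;> rw [h] <;> omega
    have h4 := (esize_nat_mono h1).trans h3
    have h5 := (esize_nat_mono h2).trans h3
    change esize (((f^[l'.length] (m O a, n O a)).1), ((f^[l'.length] (m O a, n O a)).2)) ≤ _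
    rw [esize_pair]
    omega
  · intro O a
    rw [hfold, List.length_range]
    obtain ⟨h1, -, -⟩ := hpow (2 * Nat.size (m O a)) (m O a, n O a)
    rw [hzero _ (m O a, n O a) le_rfl, Nat.gcd_zero_left] at h1
    rw [h1]

theorem PolyTime.rat_num {f : (Data → Data) → α → ℚ} (hf : PolyTime f) :
    PolyTime fun O a => (f O a).num := by
  have : PolyTime fun O a => ((f O a).num, (f O a).den) := hf.recast fun _ _ => rfl
  exact this.fst

theorem PolyTime.rat_den {f : (Data → Data) → α → ℚ} (hf : PolyTime f) :
    PolyTime fun O a => (f O a).den := by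
  have : PolyTime fun O a => ((f O a).num, (f O a).den) := hf.recast fun _ _ => rfl
  exact this.snd

theorem PolyTime.int_toRat {f : (Data → Data) → α → ℤ} (hf : PolyTime f) :
    PolyTime fun O a => (f O a : ℚ) :=
  (hf.pair (.const (1 : ℕ))).recast fun _ _ => rfl

theorem PolyTime.mkRat {f : (Data → Data) → α → ℤ} {g : (Data → Data) → α → ℕ}
    (hf : PolyTime f) (hg : PolyTime g) : PolyTime fun O a => mkRat (f O a) (g O a) := by
  have hd := hf.natAbs.nat_gcd hg
  refine ((PolyTime.ite hg.pos ((hf.int_div hd.natCast).pair (hg.nat_div hd))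
    (.const ((0 : ℤ), (1 : ℕ)))).recast fun O a => ?_)
  rcases Nat.eq_zero_or_pos (g O a) with h | h
  · simp only [h, Rat.mkRat_zero]
    rfl
  · simp only [h, decide_true, if_true]
    rw [← Rat.normalize_eq_mkRat h.ne', Rat.normalize_eq]
    simp only [enc, Data.ofRat]

/-! #### Reading a list of integers from arbitrary data -/

/-- The integer that is the first component of a pair. -/
def Data.readInt : Data → ℤ
  | .pair (.int z) _ => z
  | _ => 0

/-- The integers at the beginning of the entries of a list. -/
def Data.readList : Data → List ℤ
  | .pair a b => a.readInt :: b.readList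
  | .int _ => []

/-- First component of a pair. -/
def Data.left : Data → Data
  | .pair a _ => a
  | _ => .int 0

/-- Second component of a pair. -/
def Data.right : Data → Data
  | .pair _ b => b
  | _ => .int 0

/-- Whether the data is a pair. -/
def Data.isPair : Data → Bool
  | .pair _ _ => true
  | _ => false

theorem PolyTime.data_left {f : (Data → Data) → α → Data} (hf : PolyTime f) :
    PolyTime fun O a => (f O a).left := by
  refine PolyTime.comp (f := fun _ d => Data.left d) (.of_op .fst ?_ ?_) hf
  · rintro O (z | ⟨a, b⟩) <;> rfl
  · refine SmallVal.esize_self.mono ?_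
    rintro O (z | ⟨a, b⟩) <;> simp [esize, enc, Data.left, Data.size]; omega

theorem PolyTime.data_right {f : (Data → Data) → α → Data} (hf : PolyTime f) :
    PolyTime fun O a => (f O a).right := by
  refine PolyTime.comp (f := fun _ d => Data.right d) (.of_op .snd ?_ ?_) hf
  · rintro O (z | ⟨a, b⟩) <;> rfl
  · refine SmallVal.esize_self.mono ?_
    rintro O (z | ⟨a, b⟩) <;> simp [esize, enc, Data.right, Data.size]; omega

theorem PolyTime.data_isPair {f : (Data → Data) → α → Data} (hf : PolyTime f) :
    PolyTime fun O a => (f O a).isPair := by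
  refine PolyTime.comp (f := fun _ d => Data.isPair d) (.of_op .isPair ?_ ?_) hf
  · rintro O (z | ⟨a, b⟩) <;> rfl
  · refine (SmallVal.const 2).mono ?_
    rintro O (z | ⟨a, b⟩) <;> simp [esize, enc, Data.isPair, Data.size]

/-- The integer at the root, if there is one. -/
def Data.root : Data → ℤ
  | .int z => z
  | _ => 0

theorem PolyTime.data_root {f : (Data → Data) → α → Data} (hf : PolyTime f) :
    PolyTime fun O a => (f O a).root := by
  have h := PolyTime.ite hf.data_isPair (.const (Data.int 0)) hf
  refine h.recast fun O a => ?_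
  cases f O a <;> rfl

theorem PolyTime.readInt {f : (Data → Data) → α → Data} (hf : PolyTime f) :
    PolyTime fun O a => (f O a).readInt := by
  refine hf.data_left.data_root.recast fun O a => ?_
  rcases f O a with z | ⟨z | ⟨a, b⟩, c⟩ <;> rfl

/-- Number of pairs along the right spine. -/
def Data.spine : Data → ℕ
  | .pair _ b => b.spine + 1
  | _ => 0

theorem Data.spine_le_size (d : Data) : d.spine ≤ d.size := by
  induction d with
  | int z => simp [Data.spine]
  | pair a b _ ih => simp only [Data.spine, Data.size]; omega

theorem esize_readInt_le (d : Data) : esize d.readInt ≤ d.size := by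
  rcases d with z | ⟨z | ⟨a, b⟩, c⟩
  · simp [Data.readInt, Data.size, esize_int]
  · simp only [Data.readInt, Data.size, esize_int]; omega
  · simp only [Data.readInt, Data.size, esize_int, Int.natAbs_zero, Nat.size_zero]; omega

/-- The answer of an oracle is an arbitrary tree, so the loop runs down the right spine and makes no
assumption about its shape. -/
theorem PolyTime.readList {f : (Data → Data) → α → Data} (hf : PolyTime f) :
    PolyTime fun O a => (f O a).readList := by
  let step : (Data → Data) → Data × List ℤ → Data × List ℤ := fun _ x =>
    (x.1.right, x.1.left.readInt :: x.2)
  have hstep : PolyTime step :=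
    PolyTime.id.fst.data_right.pair (PolyTime.id.fst.data_left.readInt.cons PolyTime.id.snd)
  have main : ∀ O (d : Data) (acc : List ℤ),
      (∀ i < d.spine, ((step O)^[i] (d, acc)).1.isPair = true) ∧
      (step O)^[d.spine] (d, acc) = ((step O)^[d.spine] (d, acc)) ∧
      ((step O)^[d.spine] (d, acc)).1.isPair = false ∧
      ((step O)^[d.spine] (d, acc)).2 = d.readList.reverse ++ acc ∧
      ∀ i ≤ d.spine, esize ((step O)^[i] (d, acc)) ≤ esize d + esize acc + 1 := by
    intro O d
    induction d with
    | int z =>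
      intro acc
      refine ⟨by simp [Data.spine], rfl, rfl, rfl, fun i hi => ?_⟩
      obtain rfl : i = 0 := by simpa [Data.spine] using hi
      exact le_rfl
    | pair a b _ ih =>
      intro acc
      obtain ⟨h1, -, h2, h3, h4⟩ := ih (a.readInt :: acc)
      have hs : step O (.pair a b, acc) = (b, a.readInt :: acc) := rfl
      refine ⟨fun i hi => ?_, rfl, ?_, ?_, fun i hi => ?_⟩
      · cases i with
        | zero => rfl
        | succ i =>
          rw [Function.iterate_succ_apply, hs]
          exact h1 i (by simpa [Data.spine] using hi)
      · simp only [Data.spine, Function.iterate_succ_apply, hs]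
        exact h2
      · simp only [Data.spine, Function.iterate_succ_apply, hs, Data.readList]
        simp [h3]
      · cases i with
        | zero => exact le_rfl
        | succ i =>
          rw [Function.iterate_succ_apply, hs]
          refine (h4 i (by simpa [Data.spine] using hi)).trans ?_
          have := esize_readInt_le a
          have h5 : esize (Data.pair a b) = a.size + b.size + 1 := rfl
          have h6 : esize b = b.size := rfl
          rw [esize_cons, h5, h6]
          omega
  refine (PolyTime.while (test := fun _ x => x.1.isPair) PolyTime.id.fst.data_isPair hstep
    (init := fun O a => (f O a, ([] : List ℤ)))
    (N := fun O a => (f O a).spine) (hf.pair (.const []))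
    (hf.smallVal.mono fun O a => Data.spine_le_size _)
    (s := fun O a => esize (f O a) + 1 + 1) ((hf.smallVal.add (.const 1)).add (.const 1))
    (fun O a => (main O _ _).1) (fun O a => (main O _ _).2.2.1)
    (fun O a => (main O _ _).2.2.2.2)).snd.reverse.recast fun O a => ?_
  rw [(main O (f O a) []).2.2.2.1]
  simp

/-! #### Choosing the best element of a list -/

/-- The element of `b :: l` with least value of `g`, the first one if there are several. -/
def bestOf {B : Type} (g : B → ℤ) (b : B) (l : List B) : B :=
  l.foldl (fun b c => if decide (g c < g b) then c else b) b

theorem bestOf_mem {B : Type} (g : B → ℤ) (b : B) (l : List B) : bestOf g b l ∈ b :: l := by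
  induction l generalizing b with
  | nil => exact List.mem_singleton.2 rfl
  | cons c l ih =>
    have h := ih (if decide (g c < g b) then c else b)
    change bestOf g (if decide (g c < g b) then c else b) l ∈ _
    rcases List.mem_cons.1 h with h | h
    · rw [h]
      split_ifs <;> simp
    · exact List.mem_cons_of_mem _ (List.mem_cons_of_mem _ h)

theorem bestOf_le {B : Type} (g : B → ℤ) {b c : B} {l : List B} (hc : c ∈ b :: l) :
    g (bestOf g b l) ≤ g c := by
  induction l generalizing b c with
  | nil => obtain rfl := List.mem_singleton.1 hc; exact le_rfl
  | cons d l ih =>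
    have hstep : g (if decide (g d < g b) then d else b) ≤ min (g b) (g d) := by
      by_cases h : g d < g b
      · simp [h, h.le]
      · simp [h, not_lt.1 h]
    have hself := (ih (b := if decide (g d < g b) then d else b) List.mem_cons_self).trans hstep
    change g (bestOf g (if decide (g d < g b) then d else b) l) ≤ g c
    rcases List.mem_cons.1 hc with rfl | hc
    · exact hself.trans (min_le_left _ _)
    · rcases List.mem_cons.1 hc with rfl | hc
      · exact hself.trans (min_le_right _ _)
      · exact ih (List.mem_cons_of_mem _ hc)

theorem PolyTime.bestOf {g : (Data → Data) → α → β → ℤ} {b : (Data → Data) → α → β}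
    {l : (Data → Data) → α → List β} (hg : PolyTime fun O (p : α × β) => g O p.1 p.2)
    (hb : PolyTime b) (hl : PolyTime l) :
    PolyTime fun O a => bestOf (g O a) (b O a) (l O a) := by
  refine PolyTime.foldl (f := fun O a b c => if decide (g O a c < g O a b) then c else b) hl hb
    (.ite (PolyTime.int_lt (hg.comp (PolyTime.id.fst.pair PolyTime.id.snd.snd))
      (hg.comp (PolyTime.id.fst.pair PolyTime.id.snd.fst))) PolyTime.id.snd.snd
      PolyTime.id.snd.fst) (hb.smallVal.add hl.smallVal) fun O a l' h => ?_
  have := bestOf_mem (g O a) (b O a) l'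
  rcases List.mem_cons.1 this with h' | h'
  · change esize (LatticeReduction.bestOf (g O a) (b O a) l') ≤ _
    rw [h']
    omega
  · have := esize_le_of_mem (h.subset h')
    exact this.trans (by omega)

end Lists

end LatticeReduction

/-! ### Tabulation with small indices. -/

namespace LatticeReduction

open Polynomial
open Enc

section Small
variable {α β γ : Type} [Enc α] [Enc β] [Enc γ]

theorem PolyTime.nat_min {f g : (Data → Data) → α → ℕ} (hf : PolyTime f) (hg : PolyTime g) :
    PolyTime fun O a => min (f O a) (g O a) := by
  refine (PolyTime.ite (hf.natCast.int_lt hg.natCast) hf hg).recast fun O a => ?_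
  by_cases h : f O a < g O a
  · simp [h, h.le]
  · simp [h, not_lt.1 h]

theorem PolyTime.nat_eq {f g : (Data → Data) → α → ℕ} (hf : PolyTime f) (hg : PolyTime g) :
    PolyTime fun O a => decide (f O a = g O a) := by
  refine (PolyTime.ite (hf.natCast.int_lt hg.natCast) (.const false)
    (.ite (hg.natCast.int_lt hf.natCast) (.const false) (.const true))).recast fun O a => ?_
  congr 1
  rcases lt_trichotomy (f O a) (g O a) with h | h | h
  · simp [h, h.ne]
  · simp [h]
  · simp [h, h.ne']

theorem PolyTime.onFst {f : (Data → Data) → α → β} (hf : PolyTime f) :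
    PolyTime fun O (p : α × γ) => f O p.1 := hf.comp .fst_op

theorem SmallVal.onFst {f : (Data → Data) → α → ℕ} (hf : SmallVal f) :
    SmallVal fun O (p : α × γ) => f O p.1 := hf.comp .fst_op

/-- Tabulating a function whose argument is promised to be small. -/
theorem PolyTime.tabulate {n : (Data → Data) → α → ℕ} {f : (Data → Data) → α → ℕ → γ}
    (hn : PolyTime n) (hs : SmallVal n)
    (hf : ∀ k : (Data → Data) → α × ℕ → ℕ, PolyTime k → SmallVal k →
      PolyTime fun O p => f O p.1 (k O p)) :
    PolyTime fun O a => (List.range (n O a)).map (f O a) := by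
  have h1 : PolyTime fun O (p : α × ℕ) => n O p.1 := hn.onFst
  -- Mapping requires a function that is polynomial on all pairs, also those with a huge index.
  -- Truncating the index at `n` makes it small and changes nothing on the range.
  have h2 := hf (fun O p => min p.2 (n O p.1)) (PolyTime.id.snd.nat_min h1)
    ((SmallVal.onFst hs).mono fun O a => min_le_right _ _)
  refine (PolyTime.map (f := fun O a j => f O a (min j (n O a))) (hn.range hs) h2).recast
    fun O a => ?_
  congr 1
  refine List.map_congr_left fun j hj => ?_
  rw [min_eq_left (List.mem_range.1 hj).le]

end Small

/-! ### Linear algebra with lists -/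

/-- Dot product. -/
def dotL (u v : List ℤ) : ℤ := (List.zipWith (fun x y => x * y) u v).sum

/-- Product of a matrix, given by its rows, with the transpose of another one. -/
def mulTr (M N : List (List ℤ)) : List (List ℤ) := M.map fun r => N.map fun s => dotL r s

/-- The unit matrix. -/
def idL (n : ℕ) : List (List ℤ) :=
  (List.range n).map fun i => (List.range n).map fun j => if decide (i = j) then 1 else 0

/-- One step of the Faddeev-LeVerrier recursion for a symmetric matrix. -/
def leVerrierStep (A : List (List ℤ)) (s : List (List ℤ) × ℤ) (k : ℕ) : List (List ℤ) × ℤ :=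
  let N := List.zipWith (fun r r' => List.zipWith (fun x y => x + y) r r') (mulTr A s.1)
    ((idL A.length).map fun r => r.map fun x => s.2 * x)
  (N, (0 - (List.zipWith dotL A N).sum) / ((k + 1 : ℕ) : ℤ))

/-- The Faddeev-LeVerrier algorithm for a symmetric matrix `A`: it returns a matrix `N` and
an integer `c` such that `A * N = -c`. -/
def leVerrier (A : List (List ℤ)) : List (List ℤ) × ℤ :=
  (List.range A.length).foldl (leVerrierStep A)
    ((idL A.length).map fun r => r.map fun x => 0 * x, 1)

/-! ### Cost and coefficient growth of the Faddeev-LeVerrier recursion. -/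

section Linear
variable {α : Type} [Enc α]

theorem PolyTime.dotL {u v : (Data → Data) → α → List ℤ} (hu : PolyTime u) (hv : PolyTime v) :
    PolyTime fun O a => dotL (u O a) (v O a) :=
  (PolyTime.zipWith (f := fun _ _ x y => x * y) hu hv
    (PolyTime.id.snd.fst.int_mul PolyTime.id.snd.snd)).int_sum

theorem PolyTime.mulTr {M N : (Data → Data) → α → List (List ℤ)} (hM : PolyTime M)
    (hN : PolyTime N) : PolyTime fun O a => mulTr (M O a) (N O a) := by
  refine .map (f := fun O a r => (N O a).map fun s => LatticeReduction.dotL r s) hM ?_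
  refine .map (l := fun O (p : α × List ℤ) => N O p.1)
    (f := fun O p s => LatticeReduction.dotL p.2 s) (hN.onFst) ?_
  exact .dotL PolyTime.id.fst.snd PolyTime.id.snd

theorem PolyTime.idL {n : (Data → Data) → α → ℕ} (hn : PolyTime n) (hs : SmallVal n) :
    PolyTime fun O a => idL (n O a) := by
  refine .map (f := fun O a i => (List.range (n O a)).map fun j => if decide (i = j) then 1 else 0)
    (hn.range hs) ?_
  refine .map (l := fun O (p : α × ℕ) => List.range (n O p.1))
    (f := fun O p j => if decide (p.2 = j) then 1 else 0) ((hn.range hs).onFst) ?_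
  exact .ite (.nat_eq PolyTime.id.fst.snd PolyTime.id.snd) (.const 1) (.const 0)

theorem PolyTime.smul {c : (Data → Data) → α → ℤ} {u : (Data → Data) → α → List ℤ}
    (hc : PolyTime c) (hu : PolyTime u) :
    PolyTime fun O a => (u O a).map fun x => c O a * x :=
  .map (f := fun O a x => c O a * x) hu ((hc.onFst).int_mul .snd_op)

theorem PolyTime.smulMat {c : (Data → Data) → α → ℤ} {u : (Data → Data) → α → List (List ℤ)}
    (hc : PolyTime c) (hu : PolyTime u) :
    PolyTime fun O a => (u O a).map fun r => r.map fun x => c O a * x :=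
  .map (f := fun O a r => r.map fun x => c O a * x) hu
    (PolyTime.smul (c := fun O (p : α × List ℤ) => c O p.1) (hc.onFst) .snd_op)

theorem PolyTime.leVerrierStep {A : (Data → Data) → α → List (List ℤ)}
    {s : (Data → Data) → α → List (List ℤ) × ℤ} {k : (Data → Data) → α → ℕ} (hA : PolyTime A)
    (hs : PolyTime s) (hk : PolyTime k) :
    PolyTime fun O a => leVerrierStep (A O a) (s O a) (k O a) := by
  have hN : PolyTime fun O a => List.zipWith (fun r r' => List.zipWith (fun x y => x + y) r r')
      (LatticeReduction.mulTr (A O a) (s O a).1)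
      ((LatticeReduction.idL (A O a).length).map fun r => r.map fun x => (s O a).2 * x) := by
    refine .zipWith (f := fun _ _ r r' => List.zipWith (fun x y => x + y) r r')
      (hA.mulTr hs.fst) (hs.snd.smulMat (.idL hA.length (.length hA))) ?_
    exact .zipWith (f := fun _ _ x y => x + y) PolyTime.id.snd.fst PolyTime.id.snd.snd
      (PolyTime.id.snd.fst.int_add PolyTime.id.snd.snd)
  have htr := (PolyTime.zipWith (f := fun _ _ r r' => LatticeReduction.dotL r r') hA hN
    (.dotL PolyTime.id.snd.fst PolyTime.id.snd.snd)).int_sum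
  exact hN.pair (((PolyTime.const 0).int_sub htr).int_div (hk.nat_add (.const 1)).natCast)

theorem natAbs_sum_le {l : List ℤ} {b : ℕ} (h : ∀ x ∈ l, x.natAbs ≤ b) :
    l.sum.natAbs ≤ l.length * b := by
  induction l with
  | nil => simp
  | cons x l ih =>
    have h1 := ih fun y hy => h y (List.mem_cons_of_mem _ hy)
    have h2 := h x List.mem_cons_self
    have h3 := Int.natAbs_add_le x l.sum
    simp only [List.sum_cons, List.length_cons]
    nlinarith

theorem exists_of_mem_zipWith {A B C : Type} {f : A → B → C} {l : List A} {l' : List B} {c : C}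
    (h : c ∈ List.zipWith f l l') : ∃ a ∈ l, ∃ b ∈ l', f a b = c := by
  rw [← List.map_uncurry_zip_eq_zipWith] at h
  obtain ⟨⟨a, b⟩, hab, rfl⟩ := List.mem_map.1 h
  exact ⟨a, (List.of_mem_zip hab).1, b, (List.of_mem_zip hab).2, rfl⟩

theorem natAbs_dotL_le {u v : List ℤ} {a b : ℕ} (hu : ∀ x ∈ u, x.natAbs ≤ a)
    (hv : ∀ x ∈ v, x.natAbs ≤ b) : (dotL u v).natAbs ≤ u.length * (a * b) := by
  refine (natAbs_sum_le (b := a * b) ?_).trans (Nat.mul_le_mul_right _ (by simp))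
  intro x hx
  obtain ⟨y, hy, z, hz, rfl⟩ := exists_of_mem_zipWith hx
  rw [Int.natAbs_mul]
  exact Nat.mul_le_mul (hu y hy) (hv z hz)

theorem natAbs_lt_two_pow_esize (z : ℤ) : z.natAbs < 2 ^ esize z := by
  refine (Nat.lt_size_self _).trans_le (Nat.pow_le_pow_right (by norm_num) ?_)
  rw [esize_int]
  omega

theorem esize_int_le_of_natAbs_le {z : ℤ} {k : ℕ} (h : z.natAbs ≤ 2 ^ k) : esize z ≤ k + 2 := by
  rw [esize_int]
  have : Nat.size z.natAbs ≤ k + 1 := Nat.size_le.2 (h.trans_lt (Nat.pow_lt_pow_right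
    (by norm_num) (by omega)))
  omega

theorem natAbs_idL_le {n : ℕ} {r : List ℤ} (hr : r ∈ idL n) {x : ℤ} (hx : x ∈ r) :
    x.natAbs ≤ 1 := by
  obtain ⟨i, -, rfl⟩ := List.mem_map.1 hr
  obtain ⟨j, -, rfl⟩ := List.mem_map.1 hx
  split_ifs <;> simp

theorem length_of_mem_idL {n : ℕ} {r : List ℤ} (hr : r ∈ idL n) : r.length = n := by
  obtain ⟨i, -, rfl⟩ := List.mem_map.1 hr
  simp

/-- Bounds on the shape and the entries of the intermediate results. -/
structure LeVerrierBound (n : ℕ) (s : List (List ℤ) × ℤ) (k : ℕ) : Prop where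
  length_le : s.1.length ≤ n
  row_le : ∀ r ∈ s.1, r.length ≤ n
  entry_le : ∀ r ∈ s.1, ∀ x ∈ r, x.natAbs ≤ 2 ^ k
  coeff_le : s.2.natAbs ≤ 2 ^ k

/-- With L the size of `A` and a = 2^L, both L + 1 and the entries of `A` are at most a. A new entry
is then at most a²·2^k, and the trace costs three more factors a; the division only shrinks it. So
the exponent grows by the fixed amount 5L per step, with no symmetry or exactness needed. -/
theorem LeVerrierBound.step {A : List (List ℤ)} {s : List (List ℤ) × ℤ} {k : ℕ}
    (h : LeVerrierBound A.length s k) (j : ℕ) :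
    LeVerrierBound A.length (leVerrierStep A s j) (k + 5 * esize A) := by
  set L := esize A with hL
  have hn : A.length ≤ L := (length_lt_esize A).le
  have hrow : ∀ r ∈ A, r.length ≤ L := fun r hr =>
    (length_lt_esize r).le.trans (esize_le_of_mem hr)
  have hent : ∀ r ∈ A, ∀ x ∈ r, x.natAbs ≤ 2 ^ L := fun r hr x hx =>
    (natAbs_lt_two_pow_esize x).le.trans (Nat.pow_le_pow_right (by norm_num)
      ((esize_le_of_mem hx).trans (esize_le_of_mem hr)))
  have hLp : L + 1 ≤ 2 ^ L := Nat.lt_two_pow_self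
  set a := 2 ^ L with ha
  have hentry : ∀ r ∈ (leVerrierStep A s j).1, ∀ x ∈ r, x.natAbs ≤ a * a * 2 ^ k := by
    intro r hr x hx
    obtain ⟨u, hu, v, hv, rfl⟩ := exists_of_mem_zipWith hr
    obtain ⟨y, hy, z, hz, rfl⟩ := exists_of_mem_zipWith hx
    obtain ⟨r₁, hr₁, rfl⟩ := List.mem_map.1 hu
    obtain ⟨r₂, hr₂, rfl⟩ := List.mem_map.1 hy
    obtain ⟨r₃, hr₃, rfl⟩ := List.mem_map.1 hv
    obtain ⟨e, he, rfl⟩ := List.mem_map.1 hz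
    have h1 := natAbs_dotL_le (hent r₁ hr₁) (h.entry_le r₂ hr₂)
    have h2 : (s.2 * e).natAbs ≤ 2 ^ k := by
      rw [Int.natAbs_mul]
      calc _ ≤ 2 ^ k * 1 := Nat.mul_le_mul h.coeff_le (natAbs_idL_le hr₃ he)
        _ = _ := mul_one _
    calc _ ≤ _ := Int.natAbs_add_le _ _
      _ ≤ L * (a * 2 ^ k) + 2 ^ k :=
        add_le_add (h1.trans (Nat.mul_le_mul_right _ (hrow r₁ hr₁))) h2
      _ ≤ L * (a * 2 ^ k) + a * 2 ^ k := by
        gcongr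
        exact Nat.le_mul_of_pos_left _ (by omega)
      _ = (L + 1) * (a * 2 ^ k) := by ring
      _ ≤ a * (a * 2 ^ k) := Nat.mul_le_mul_right _ hLp
      _ = _ := by ring
  have hpow : 2 ^ (k + 5 * L) = a * a * a * (a * a * 2 ^ k) := by
    rw [pow_add, mul_comm 5 L, pow_mul]
    ring
  have ha3 : 1 ≤ a * a * a := Nat.one_le_iff_ne_zero.2 (by positivity)
  have hrows : (leVerrierStep A s j).1.length ≤ A.length := by
    simp [leVerrierStep, mulTr, idL]
  refine ⟨hrows, ?_, fun r hr x hx => ?_, ?_⟩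
  · intro r hr
    obtain ⟨u, hu, v, hv, rfl⟩ := exists_of_mem_zipWith hr
    obtain ⟨r₃, hr₃, rfl⟩ := List.mem_map.1 hv
    simp [length_of_mem_idL hr₃]
  · rw [hpow]
    exact (hentry r hr x hx).trans (Nat.le_mul_of_pos_left _ ha3)
  · refine (natAbs_ediv_le _ _).trans ?_
    rw [zero_sub, Int.natAbs_neg, hpow]
    refine (natAbs_sum_le (b := L * (a * (a * a * 2 ^ k))) ?_).trans ?_
    · intro x hx
      obtain ⟨u, hu, v, hv, rfl⟩ := exists_of_mem_zipWith hx
      exact (natAbs_dotL_le (hent u hu) (hentry v hv)).trans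
        (Nat.mul_le_mul_right _ (hrow u hu))
    · have h1 : (List.zipWith dotL A (leVerrierStep A s j).1).length ≤ a := by
        rw [List.length_zipWith]
        omega
      calc _ ≤ a * (a * (a * (a * a * 2 ^ k))) := by
            refine Nat.mul_le_mul h1 (Nat.mul_le_mul_right _ (by omega))
        _ = _ := by ring

theorem LeVerrierBound.esize_le {n : ℕ} {s : List (List ℤ) × ℤ} {k : ℕ}
    (h : LeVerrierBound n s k) :
    esize s ≤ (n * ((n * ((k + 2) + 1) + 1) + 1) + 1) + (k + 2) + 1 := by
  obtain ⟨N, c⟩ := s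
  have h1 : esize c ≤ k + 2 := esize_int_le_of_natAbs_le h.coeff_le
  have h2 : esize N ≤ n * ((n * ((k + 2) + 1) + 1) + 1) + 1 := by
    refine (esize_list_le (s := n * ((k + 2) + 1) + 1) fun r hr => ?_).trans ?_
    · refine (esize_list_le fun x hx => esize_int_le_of_natAbs_le (h.entry_le r hr x hx)).trans ?_
      have := h.row_le r hr
      gcongr
    · have := h.length_le
      gcongr
  rw [esize_pair]
  omega

/-- At most L steps add 5L each to the exponent, so every intermediate entry has O(L²) bits. -/
theorem PolyTime.leVerrier {A : (Data → Data) → α → List (List ℤ)} (hA : PolyTime A) :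
    PolyTime fun O a => leVerrier (A O a) := by
  refine PolyTime.comp (f := fun _ A => LatticeReduction.leVerrier A) ?_ hA
  have hlen : SmallVal fun _ (A : List (List ℤ)) => A.length := .length .id
  refine PolyTime.foldl (f := fun _ A s k => LatticeReduction.leVerrierStep A s k)
    (PolyTime.id.length.range hlen)
    ((PolyTime.smulMat (.const 0) (PolyTime.idL PolyTime.id.length hlen)).pair (.const 1))
    (.leVerrierStep .fst_op PolyTime.id.snd.fst PolyTime.id.snd.snd)
    (s := fun _ A => (esize A * ((esize A * ((5 * esize A * esize A + 2) + 1) + 1) + 1) + 1) +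
      (5 * esize A * esize A + 2) + 1) ?_ ?_
  · have h1 : SmallVal fun _ (A : List (List ℤ)) => 5 * esize A * esize A + 2 :=
      (((SmallVal.const 5).mul .esize_self).mul .esize_self).add (.const 2)
    exact (((SmallVal.esize_self.mul (((SmallVal.esize_self.mul (h1.add (.const 1))).add
      (.const 1)).add (.const 1))).add (.const 1)).add h1).add (.const 1)
  · intro O A l' hl'
    have h0 : LeVerrierBound A.length
        ((LatticeReduction.idL A.length).map fun r => r.map fun x => 0 * x, 1) 0 := by
      refine ⟨by simp [LatticeReduction.idL], fun r hr => ?_, fun r hr x hx => ?_, by simp⟩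
      · obtain ⟨r', hr', rfl⟩ := List.mem_map.1 hr
        simp [length_of_mem_idL hr']
      · obtain ⟨r', hr', rfl⟩ := List.mem_map.1 hr
        obtain ⟨y, -, rfl⟩ := List.mem_map.1 hx
        simp
    have key : ∀ (l : List ℕ) (s : List (List ℤ) × ℤ) (k : ℕ), LeVerrierBound A.length s k →
        LeVerrierBound A.length (l.foldl (LatticeReduction.leVerrierStep A) s)
          (k + 5 * esize A * l.length) := by
      intro l
      induction l with
      | nil => intro s k h; simpa using h
      | cons j l ih =>
        intro s k h
        have := ih _ _ (h.step j)
        rw [List.foldl_cons, List.length_cons]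
        convert this using 1
        ring
    have h := (key l' _ _ h0).esize_le
    have h1 : l'.length ≤ esize A := by
      have := hl'.length_le
      rw [List.length_range] at this
      exact this.trans (length_lt_esize A).le
    have h2 := (length_lt_esize A).le
    refine h.trans ?_
    rw [zero_add]
    gcongr

end Linear

end LatticeReduction

namespace LatticeReduction

open Polynomial
open Enc

/-! ### The reduction -/

/-- Coefficients, with respect to the rows of `B`, of a vector of the lattice they generate. -/
def coeffs (B : List (List ℤ)) (v : List ℤ) : List ℤ :=
  ((leVerrier (mulTr B B)).1.map fun r => dotL r (B.map fun b => dotL v b)).map fun x =>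
    x / (0 - (leVerrier (mulTr B B)).2)

/-- The combination of the rows of `B` with coefficients `x`, in dimension `m`. -/
def combine (B : List (List ℤ)) (m : ℕ) (x : List ℤ) : List ℤ :=
  (List.range m).map fun j => dotL x (B.map fun b => b.getD j 0)

/-- `u - c * v`. -/
def subMul (c : ℤ) (u v : List ℤ) : List ℤ := List.zipWith (fun x y => x - c * y) u v

/-- Squared distance. -/
def sqDist (t y : List ℤ) : ℤ := dotL (subMul 1 t y) (subMul 1 t y)

/-- Bit length of the random coefficients. -/
def coeffBits (t : List ℤ) : ℕ := 2 * (t.length * Nat.size (2 * (dotL t t).natAbs + 1)) + 10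

/-- Bits reserved for an answer. -/
def answerBits (B : List (List ℤ)) (t : List ℤ) : ℕ :=
  t.length * (Nat.size ((2 * dotL t t).natAbs +
    2 ^ coeffBits t * (dotL (B.headD []) (B.headD [])).natAbs) + 5) + 1

/-- The `i`-th digit of `w` in base `2 ^ k`. -/
def digit (k w i : ℕ) : ℕ := w / 2 ^ (k * i) % 2 ^ k

/-- The digits of `w` as random coefficients. -/
def coins (B : List (List ℤ)) (t : List ℤ) (w : ℕ) : List ℕ :=
  (List.range B.length).map fun i => digit (coeffBits t) w i

/-- Basis of a sublattice of index `q`. -/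
def sparseBasis (B : List (List ℤ)) (q : ℕ) (z : List ℕ) : List (List ℤ) :=
  ((B.headD []).map fun x => (q : ℤ) * x) ::
    List.zipWith (fun b (e : ℕ) => subMul (0 - e) b (B.headD [])) B.tail z

/-- The query for one sublattice. -/
def queryInput (B : List (List ℤ)) (t : List ℤ) (w k : ℕ) : List (List ℚ) × List ℚ :=
  ((sparseBasis B (2 ^ k) (coins B t w).tail).map fun r => r.map fun x : ℤ => (x : ℚ),
    (subMul ((coins B t w).headD 0) t (B.headD [])).map fun x : ℤ => (x : ℚ))

/-- The lattice vector obtained from one query. -/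
def candidate (O : Data → Data) (B : List (List ℤ)) (t : List ℤ) (w k : ℕ) : List ℤ :=
  subMul (0 - ((coins B t w).headD 0 : ℕ))
    (combine B t.length (coeffs B (reply O (.pair (.int (answerBits B t))
      (enc (queryInput B t w k)))).readList)) (B.headD [])

/-- The best candidate for given random bits. -/
def bestCandidate (O : Data → Data) (B : List (List ℤ)) (t : List ℤ) (w : ℕ) : List ℤ :=
  bestOf (sqDist t) (t.map fun x => 0 * x)
    ((List.range (coeffBits t + 1)).map fun k => candidate O B t w k)

/-- The best candidate of all trials. -/
def searchClosest (O : Data → Data) (B : List (List ℤ)) (t : List ℤ) (R : ℕ) : List ℤ :=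
  bestOf (sqDist t) (t.map fun x => 0 * x)
    ((List.range (48 * (coeffBits t + 1))).map fun j =>
      bestCandidate O B t (digit (coeffBits t * B.length) R j))

/-- A common denominator. -/
def commonDen (x : List (List ℚ) × List ℚ) : ℕ :=
  (x.1.map fun r => (r.map fun c : ℚ => c.den).prod).prod * (x.2.map fun c : ℚ => c.den).prod

/-- Multiplication of a vector by a common denominator. -/
def clearDen (D : ℕ) (r : List ℚ) : List ℤ := r.map fun c => c.num * ((D / c.den : ℕ) : ℤ)

/-- The integral basis. -/
def intBasis (x : List (List ℚ) × List ℚ) : List (List ℤ) := x.1.map fun r => clearDen (commonDen x) r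

/-- The integral target. -/
def intTarget (x : List (List ℚ) × List ℚ) : List ℤ := clearDen (commonDen x) x.2

/-- The function computed by the reduction. -/
def reduction (O : Data → Data) (p : (List (List ℚ) × List ℚ) × ℕ) : List ℚ :=
  (searchClosest O (intBasis p.1) (intTarget p.1) p.2).map fun x => mkRat x (commonDen p.1)

/-! ### The reduction is computed in polynomial time. -/

section Cost
variable {α : Type} [Enc α]
variable {B : (Data → Data) → α → List (List ℤ)} {t v u : (Data → Data) → α → List ℤ}

theorem PolyTime.coeffs (hB : PolyTime B) (hv : PolyTime v) :
    PolyTime fun O a => coeffs (B O a) (v O a) := by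
  have hl := (hB.mulTr hB).leVerrier
  have hw : PolyTime fun O a => (B O a).map fun b => LatticeReduction.dotL (v O a) b :=
    .map (f := fun O a b => LatticeReduction.dotL (v O a) b) hB (.dotL hv.onFst .snd_op)
  refine .map (f := fun O a x => x / (0 - (LatticeReduction.leVerrier
    (LatticeReduction.mulTr (B O a) (B O a))).2)) (.map (f := fun O a r => LatticeReduction.dotL r
      ((B O a).map fun b => LatticeReduction.dotL (v O a) b)) hl.fst ?_) ?_
  · exact .dotL .snd_op (hw.onFst)
  · exact PolyTime.snd_op.int_div (((PolyTime.const 0).int_sub hl.snd).onFst)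

theorem PolyTime.combine {m : (Data → Data) → α → ℕ} (hB : PolyTime B) (hm : PolyTime m)
    (hs : SmallVal m) (hv : PolyTime v) :
    PolyTime fun O a => combine (B O a) (m O a) (v O a) := by
  refine .tabulate (f := fun O a j => LatticeReduction.dotL (v O a)
    ((B O a).map fun b => b.getD j 0)) hm hs fun k hk hks => .dotL hv.onFst ?_
  refine .map (l := fun O (p : α × ℕ) => B O p.1) (f := fun O p b => b.getD (k O p) 0)
    hB.onFst ?_
  exact .getD (n := fun O (p : (α × ℕ) × List ℤ) => k O p.1) .snd_op (hk.onFst)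
    (hks.onFst) 0

theorem PolyTime.subMul {c : (Data → Data) → α → ℤ} (hc : PolyTime c) (hu : PolyTime u)
    (hv : PolyTime v) : PolyTime fun O a => subMul (c O a) (u O a) (v O a) :=
  .zipWith (f := fun O a x y => x - c O a * y) hu hv
    (PolyTime.id.snd.fst.int_sub ((hc.onFst).int_mul PolyTime.id.snd.snd))

theorem PolyTime.sqDist (ht : PolyTime t) (hv : PolyTime v) :
    PolyTime fun O a => sqDist (t O a) (v O a) :=
  .dotL (.subMul (.const 1) ht hv) (.subMul (.const 1) ht hv)

theorem PolyTime.sizeBound (ht : PolyTime t) :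
    PolyTime fun O a => 2 * (LatticeReduction.dotL (t O a) (t O a)).natAbs + 1 :=
  ((PolyTime.const 2).nat_mul (ht.dotL ht).natAbs).nat_add (.const 1)

theorem PolyTime.coeffBits (ht : PolyTime t) : PolyTime fun O a => coeffBits (t O a) :=
  ((PolyTime.const 2).nat_mul (ht.length.nat_mul ht.sizeBound.nat_size)).nat_add (.const 10)

theorem SmallVal.coeffBits (ht : PolyTime t) : SmallVal fun O a => coeffBits (t O a) :=
  ((SmallVal.const 2).mul ((SmallVal.length ht).mul (.nat_size ht.sizeBound))).add (.const 10)

theorem PolyTime.answerBound (hB : PolyTime B) (ht : PolyTime t) :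
    PolyTime fun O a => (2 * LatticeReduction.dotL (t O a) (t O a)).natAbs +
      2 ^ LatticeReduction.coeffBits (t O a) *
        (LatticeReduction.dotL ((B O a).headD []) ((B O a).headD [])).natAbs :=
  ((PolyTime.const 2).int_mul (ht.dotL ht)).natAbs.nat_add
    ((ht.coeffBits.two_pow (.coeffBits ht)).nat_mul ((hB.headD []).dotL (hB.headD [])).natAbs)

theorem PolyTime.answerBits (hB : PolyTime B) (ht : PolyTime t) :
    PolyTime fun O a => answerBits (B O a) (t O a) :=
  (ht.length.nat_mul ((hB.answerBound ht).nat_size.nat_add (.const 5))).nat_add (.const 1)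

theorem SmallVal.answerBits (hB : PolyTime B) (ht : PolyTime t) :
    SmallVal fun O a => answerBits (B O a) (t O a) :=
  ((SmallVal.length ht).mul ((SmallVal.nat_size (hB.answerBound ht)).add (.const 5))).add
    (.const 1)

theorem PolyTime.digit {k w i : (Data → Data) → α → ℕ} (hk : PolyTime k) (hks : SmallVal k)
    (hw : PolyTime w) (hi : PolyTime i) (his : SmallVal i) :
    PolyTime fun O a => digit (k O a) (w O a) (i O a) :=
  (hw.nat_div ((hk.nat_mul hi).two_pow (hks.mul his))).nat_mod (hk.two_pow hks)

theorem PolyTime.coins {w : (Data → Data) → α → ℕ} (hB : PolyTime B) (ht : PolyTime t)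
    (hw : PolyTime w) : PolyTime fun O a => coins (B O a) (t O a) (w O a) := by
  refine .tabulate (f := fun O a i => LatticeReduction.digit (LatticeReduction.coeffBits (t O a))
    (w O a) i) hB.length (.length hB) fun k hk hks => ?_
  exact .digit (k := fun O p => LatticeReduction.coeffBits (t O p.1)) (w := fun O p => w O p.1)
    (ht.coeffBits.onFst) ((SmallVal.coeffBits ht).onFst) (hw.onFst) hk hks

theorem PolyTime.sparseBasis {q : (Data → Data) → α → ℕ} {z : (Data → Data) → α → List ℕ}
    (hB : PolyTime B) (hq : PolyTime q) (hz : PolyTime z) :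
    PolyTime fun O a => sparseBasis (B O a) (q O a) (z O a) := by
  refine (hq.natCast.smul (hB.headD [])).cons ?_
  refine .zipWith (f := fun O a b (e : ℕ) => LatticeReduction.subMul (0 - e) b ((B O a).headD []))
    hB.tail hz ?_
  exact .subMul (c := fun _ (p : α × List ℤ × ℕ) => 0 - (p.2.2 : ℤ))
    ((PolyTime.const 0).int_sub PolyTime.id.snd.snd.natCast) PolyTime.id.snd.fst
    ((hB.headD []).onFst)

theorem PolyTime.ratVec (hv : PolyTime v) :
    PolyTime fun O a => (v O a).map fun x : ℤ => (x : ℚ) :=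
  .map (f := fun _ _ (x : ℤ) => (x : ℚ)) hv PolyTime.snd_op.int_toRat

theorem PolyTime.queryInput {w k : (Data → Data) → α → ℕ} (hB : PolyTime B) (ht : PolyTime t)
    (hw : PolyTime w) (hk : PolyTime k) (hks : SmallVal k) :
    PolyTime fun O a => queryInput (B O a) (t O a) (w O a) (k O a) := by
  have hc := hB.coins ht hw
  refine .pair (.map (f := fun _ _ (r : List ℤ) => r.map fun x : ℤ => (x : ℚ))
    (hB.sparseBasis (hk.two_pow hks) hc.tail) PolyTime.snd_op.ratVec) ?_
  exact (PolyTime.subMul (hc.headD 0).natCast ht (hB.headD [])).ratVec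

theorem PolyTime.candidate {w k : (Data → Data) → α → ℕ} (hB : PolyTime B) (ht : PolyTime t)
    (hw : PolyTime w) (hk : PolyTime k) (hks : SmallVal k) :
    PolyTime fun O a => candidate O (B O a) (t O a) (w O a) (k O a) := by
  have hq : PolyTime fun O a => enc (LatticeReduction.queryInput (B O a) (t O a) (w O a) (k O a)) :=
    (hB.queryInput ht hw hk hks).recast fun _ _ => rfl
  exact .subMul ((PolyTime.const 0).int_sub ((hB.coins ht hw).headD 0).natCast)
    (.combine hB ht.length (.length ht) (.coeffs hB
      (PolyTime.query (hB.answerBits ht) hq (.answerBits hB ht)).readList)) (hB.headD [])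

theorem PolyTime.bestCandidate {w : (Data → Data) → α → ℕ} (hB : PolyTime B) (ht : PolyTime t)
    (hw : PolyTime w) : PolyTime fun O a => bestCandidate O (B O a) (t O a) (w O a) := by
  have hl : PolyTime fun O a => (List.range (LatticeReduction.coeffBits (t O a) + 1)).map
      fun k => LatticeReduction.candidate O (B O a) (t O a) (w O a) k :=
    .tabulate (f := fun O a k => LatticeReduction.candidate O (B O a) (t O a) (w O a) k)
      (ht.coeffBits.nat_add (.const 1)) ((SmallVal.coeffBits ht).add (.const 1))
      fun k hk hks => .candidate hB.onFst ht.onFst hw.onFst hk hks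
  exact .bestOf (g := fun O a => LatticeReduction.sqDist (t O a))
    (.sqDist ht.onFst .snd_op) (.smul (.const 0) ht) hl

theorem PolyTime.searchClosest {R : (Data → Data) → α → ℕ} (hB : PolyTime B) (ht : PolyTime t)
    (hR : PolyTime R) : PolyTime fun O a => searchClosest O (B O a) (t O a) (R O a) := by
  have hk : PolyTime fun O a => LatticeReduction.coeffBits (t O a) * (B O a).length :=
    ht.coeffBits.nat_mul hB.length
  have hks : SmallVal fun O a => LatticeReduction.coeffBits (t O a) * (B O a).length :=
    (SmallVal.coeffBits ht).mul (.length hB)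
  have hn : PolyTime fun O a => 48 * (LatticeReduction.coeffBits (t O a) + 1) :=
    (PolyTime.const 48).nat_mul (ht.coeffBits.nat_add (.const 1))
  have hns : SmallVal fun O a => 48 * (LatticeReduction.coeffBits (t O a) + 1) :=
    (SmallVal.const 48).mul ((SmallVal.coeffBits ht).add (.const 1))
  have hl : PolyTime fun O a => (List.range (48 * (LatticeReduction.coeffBits (t O a) + 1))).map
      fun j => LatticeReduction.bestCandidate O (B O a) (t O a)
        (LatticeReduction.digit (LatticeReduction.coeffBits (t O a) * (B O a).length) (R O a) j) :=
    .tabulate (f := fun O a j => LatticeReduction.bestCandidate O (B O a) (t O a)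
      (LatticeReduction.digit (LatticeReduction.coeffBits (t O a) * (B O a).length) (R O a) j))
      hn hns fun i hi his => .bestCandidate hB.onFst ht.onFst (.digit hk.onFst hks.onFst hR.onFst
        hi his)
  exact .bestOf (g := fun O a => LatticeReduction.sqDist (t O a))
    (.sqDist ht.onFst .snd_op) (.smul (.const 0) ht) hl

theorem PolyTime.denProd {r : (Data → Data) → α → List ℚ} (hr : PolyTime r) :
    PolyTime fun O a => ((r O a).map fun c => c.den).prod :=
  (PolyTime.map (f := fun _ _ (c : ℚ) => c.den) hr PolyTime.snd_op.rat_den).nat_prod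

variable {x : (Data → Data) → α → List (List ℚ) × List ℚ}

theorem PolyTime.commonDen (hx : PolyTime x) : PolyTime fun O a => commonDen (x O a) :=
  (PolyTime.map (f := fun _ _ (r : List ℚ) => (r.map fun c : ℚ => c.den).prod) hx.fst
    PolyTime.snd_op.denProd).nat_prod.nat_mul hx.snd.denProd

theorem PolyTime.clearDen {D : (Data → Data) → α → ℕ} {r : (Data → Data) → α → List ℚ}
    (hD : PolyTime D) (hr : PolyTime r) : PolyTime fun O a => clearDen (D O a) (r O a) :=
  .map (f := fun O a (c : ℚ) => c.num * ((D O a / c.den : ℕ) : ℤ)) hr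
    (PolyTime.snd_op.rat_num.int_mul ((hD.onFst).nat_div PolyTime.snd_op.rat_den).natCast)

theorem PolyTime.intBasis (hx : PolyTime x) : PolyTime fun O a => intBasis (x O a) :=
  .map (f := fun O a r => LatticeReduction.clearDen (LatticeReduction.commonDen (x O a)) r) hx.fst
    (.clearDen (hx.commonDen.onFst) .snd_op)

theorem PolyTime.intTarget (hx : PolyTime x) : PolyTime fun O a => intTarget (x O a) :=
  .clearDen hx.commonDen hx.snd

theorem polyTime_reduction : PolyTime reduction := by
  have hx : PolyTime fun _ (p : (List (List ℚ) × List ℚ) × ℕ) => p.1 := .fst_op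
  have hB := hx.intBasis
  have ht := hx.intTarget
  have hR : PolyTime fun _ (p : (List (List ℚ) × List ℚ) × ℕ) => p.2 := .snd_op
  have hs := PolyTime.searchClosest hB ht hR
  have hD : PolyTime fun _ (p : ((List (List ℚ) × List ℚ) × ℕ) × ℤ) => commonDen p.1.1 :=
    hx.commonDen.onFst
  have hz : PolyTime fun _ (p : ((List (List ℚ) × List ℚ) × ℕ) × ℤ) => p.2 := .snd_op
  have hm := hz.mkRat hD
  have h := PolyTime.map (f := fun _ (p : (List (List ℚ) × List ℚ) × ℕ) z =>
    mkRat z (commonDen p.1)) hs hm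
  unfold reduction
  exact h

end Cost

end LatticeReduction

namespace LatticeReduction

open Polynomial

/-! ### Correctness of the Faddeev-LeVerrier algorithm -/

section Charpoly
variable {n R : Type*} [Fintype n] [DecidableEq n] [CommRing R]

/-- The Leibniz rule applied to each product in the expansion of the determinant, regrouped by the
column that is differentiated. -/
theorem derivative_det (M : Matrix n n R[X]) :
    derivative M.det = ∑ i, (M.updateCol i fun j => derivative (M j i)).det := by
  simp only [Matrix.det_apply, derivative_sum]
  rw [Finset.sum_comm]
  refine Finset.sum_congr rfl fun σ _ => ?_
  rw [← Finset.smul_sum, Units.smul_def, Units.smul_def, derivative_smul, derivative_prod_finset]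
  congr 1
  refine Finset.sum_congr rfl fun i _ => ?_
  rw [← Finset.mul_prod_erase _ _ (Finset.mem_univ i), Matrix.updateCol_self, mul_comm]
  congr 1
  refine Finset.prod_congr rfl fun j hj => ?_
  rw [Matrix.updateCol_ne (Finset.ne_of_mem_erase hj)]

/-- Jacobi's formula: the derivative of `X - A` is the identity, so each differentiated column is a
unit vector and contributes a diagonal cofactor. -/
theorem trace_adjugate_charmatrix (A : Matrix n n R) :
    (A.charmatrix.adjugate).trace = derivative A.charpoly := by
  rw [Matrix.charpoly, derivative_det, Matrix.trace]
  refine Finset.sum_congr rfl fun i _ => ?_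
  rw [Matrix.diag_apply, ← Matrix.transpose_apply A.charmatrix.adjugate i i,
    Matrix.adjugate_transpose, Matrix.adjugate_apply,
    ← Matrix.det_transpose (Matrix.updateRow _ _ _), Matrix.updateRow_transpose,
    Matrix.transpose_transpose]
  congr 2
  funext j
  by_cases h : j = i
  · subst h; simp
  · simp [h]

/-- The matrix coefficients of the adjugate of the characteristic matrix. -/
noncomputable def adjCoeff (A : Matrix n n R) (j : ℕ) : Matrix n n R :=
  (matPolyEquiv A.charmatrix.adjugate).coeff j

theorem adjCoeff_apply (A : Matrix n n R) (j : ℕ) (i k : n) :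
    adjCoeff A j i k = (A.charmatrix.adjugate i k).coeff j :=
  matPolyEquiv_coeff_apply _ _ _ _

theorem trace_adjCoeff (A : Matrix n n R) (j : ℕ) :
    (adjCoeff A j).trace = A.charpoly.coeff (j + 1) * (j + 1) := by
  rw [← coeff_derivative, ← trace_adjugate_charmatrix, Matrix.trace, Matrix.trace, finsetSum_coeff]
  exact Finset.sum_congr rfl fun i _ => adjCoeff_apply _ _ _ _

theorem charmatrix_mul_adjCoeff (A : Matrix n n R) :
    (X - C A) * matPolyEquiv A.charmatrix.adjugate =
      A.charpoly.map (algebraMap R (Matrix n n R)) := by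
  rw [← Matrix.matPolyEquiv_charmatrix, ← map_mul, Matrix.mul_adjugate, ← matPolyEquiv_smul_one]
  rfl

theorem adjCoeff_mul_charmatrix (A : Matrix n n R) :
    matPolyEquiv A.charmatrix.adjugate * (X - C A) =
      A.charpoly.map (algebraMap R (Matrix n n R)) := by
  rw [← Matrix.matPolyEquiv_charmatrix, ← map_mul, Matrix.adjugate_mul, ← matPolyEquiv_smul_one]
  rfl

/-- Comparison of coefficients in (X - A)·adj(X - A) = χ(X)·1. This is the matrix half of the
Faddeev-LeVerrier recursion. -/
theorem adjCoeff_eq (A : Matrix n n R) (j : ℕ) :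
    adjCoeff A j = A * adjCoeff A (j + 1) + A.charpoly.coeff (j + 1) • 1 := by
  have h := congrArg (fun p => coeff p (j + 1)) (charmatrix_mul_adjCoeff A)
  simp only [sub_mul, coeff_sub, coeff_X_mul, coeff_C_mul, coeff_map,
    Algebra.algebraMap_eq_smul_one] at h
  rw [sub_eq_iff_eq_add'] at h
  exact h

theorem mul_adjCoeff_zero (A : Matrix n n R) :
    A * adjCoeff A 0 = -(A.charpoly.coeff 0 • 1) := by
  have h := congrArg (fun p => coeff p 0) (charmatrix_mul_adjCoeff A)
  simp only [sub_mul, coeff_sub, coeff_X_mul_zero, coeff_C_mul, coeff_map,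
    Algebra.algebraMap_eq_smul_one] at h
  rw [← h, zero_sub, neg_neg]
  rfl

theorem adjCoeff_zero_mul (A : Matrix n n R) :
    adjCoeff A 0 * A = -(A.charpoly.coeff 0 • 1) := by
  have h := congrArg (fun p => coeff p 0) (adjCoeff_mul_charmatrix A)
  simp only [mul_sub, coeff_sub, coeff_mul_X_zero, coeff_mul_C, coeff_map,
    Algebra.algebraMap_eq_smul_one] at h
  rw [← h, zero_sub, neg_neg]
  rfl

/-- Descending induction: the coefficients vanish above the degree of the polynomial, and for j ≥ n
the recursion carries the vanishing from j + 1 to j, because χ has degree n. -/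
theorem adjCoeff_eq_zero [Nontrivial R] (A : Matrix n n R) {j : ℕ} (hj : Fintype.card n ≤ j) :
    adjCoeff A j = 0 := by
  have key : ∀ d j, Fintype.card n ≤ j →
      (matPolyEquiv A.charmatrix.adjugate).natDegree < j + d → adjCoeff A j = 0 := by
    intro d
    induction d with
    | zero => intro j _ h; exact coeff_eq_zero_of_natDegree_lt h
    | succ d ih =>
      intro j hj h
      rw [adjCoeff_eq, ih (j + 1) (by omega) (by omega), coeff_eq_zero_of_natDegree_lt
        (by rw [A.charpoly_natDegree_eq_dim]; omega)]
      simp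
  exact key _ j hj (Nat.lt_add_left j (Nat.lt_succ_self _))

theorem adjCoeff_transpose {A : Matrix n n R} (hA : A.transpose = A) (j : ℕ) :
    (adjCoeff A j).transpose = adjCoeff A j := by
  have h : A.charmatrix.adjugate.transpose = A.charmatrix.adjugate := by
    rw [Matrix.adjugate_transpose, ← Matrix.charmatrix_transpose, hA]
  ext i k
  rw [Matrix.transpose_apply, adjCoeff_apply, adjCoeff_apply,
    ← Matrix.transpose_apply A.charmatrix.adjugate, h]

/-- The scalar half of the recursion: it expresses the next coefficient of χ by a trace that is
already available, up to division by n - j. -/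
theorem trace_mul_adjCoeff (A : Matrix n n R) (j : ℕ) :
    (A * adjCoeff A j).trace = A.charpoly.coeff j * (j - Fintype.card n) := by
  cases j with
  | zero =>
    rw [mul_adjCoeff_zero]
    simp
  | succ j =>
    have h := trace_adjCoeff A j
    rw [adjCoeff_eq] at h
    simp only [Matrix.trace_add, Matrix.trace_smul, Matrix.trace_one, smul_eq_mul] at h
    push_cast
    linear_combination h

end Charpoly

/-! ### Lists of lists as matrices -/

/-- The rows of a matrix as lists. -/
def matL {n m : ℕ} (M : Matrix (Fin n) (Fin m) ℤ) : List (List ℤ) :=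
  List.ofFn fun i => List.ofFn (M i)

theorem zipWith_ofFn {A B C : Type*} (f : A → B → C) {n : ℕ} (u : Fin n → A) (v : Fin n → B) :
    List.zipWith f (List.ofFn u) (List.ofFn v) = List.ofFn fun i => f (u i) (v i) := by
  apply List.ext_getElem <;> simp

theorem map_range_eq_ofFn {A : Type*} (n : ℕ) (f : ℕ → A) :
    (List.range n).map f = List.ofFn fun i : Fin n => f i := by
  apply List.ext_getElem <;> simp

theorem dotL_ofFn {n : ℕ} (u v : Fin n → ℤ) :
    dotL (List.ofFn u) (List.ofFn v) = u ⬝ᵥ v := by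
  rw [dotL, zipWith_ofFn, List.sum_ofFn]
  rfl

theorem mulTr_matL {n m k : ℕ} (M : Matrix (Fin n) (Fin m) ℤ) (N : Matrix (Fin k) (Fin m) ℤ) :
    mulTr (matL M) (matL N) = matL (M * N.transpose) := by
  simp only [mulTr, matL, List.map_ofFn, Function.comp_def, dotL_ofFn]
  rfl

theorem idL_eq (n : ℕ) : idL n = matL (1 : Matrix (Fin n) (Fin n) ℤ) := by
  simp only [idL, map_range_eq_ofFn, matL]
  congr 1
  funext i
  congr 1
  funext j
  simp [Matrix.one_apply, Fin.ext_iff]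

@[simp] theorem length_matL {n m : ℕ} (M : Matrix (Fin n) (Fin m) ℤ) : (matL M).length = n := by
  simp [matL]

theorem map_smul_matL {n m : ℕ} (c : ℤ) (M : Matrix (Fin n) (Fin m) ℤ) :
    ((matL M).map fun r => r.map fun x => c * x) = matL (c • M) := by
  simp only [matL, List.map_ofFn, Function.comp_def]
  rfl

/-- `mulTr` multiplies by a transpose, which is harmless since the matrices inherit the symmetry of
`A`. With j = n - (k + 1) the trace is -(k + 1) times the new coefficient, so the integer division
is exact. -/
theorem leVerrierStep_adjCoeff {n : ℕ} {A : Matrix (Fin n) (Fin n) ℤ} (hA : A.transpose = A)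
    {k : ℕ} (hk : k < n) :
    leVerrierStep (matL A) (matL (adjCoeff A (n - k)), A.charpoly.coeff (n - k)) k =
      (matL (adjCoeff A (n - (k + 1))), A.charpoly.coeff (n - (k + 1))) := by
  have hN : List.zipWith (fun r r' => List.zipWith (fun x y => x + y) r r')
      (mulTr (matL A) (matL (adjCoeff A (n - k))))
      ((idL (matL A).length).map fun r => r.map fun x => A.charpoly.coeff (n - k) * x) =
      matL (adjCoeff A (n - (k + 1))) := by
    rw [mulTr_matL, adjCoeff_transpose hA, idL_eq, map_smul_matL, length_matL,
      adjCoeff_eq A (n - (k + 1)), show n - (k + 1) + 1 = n - k by omega]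
    simp only [matL, zipWith_ofFn]
    rfl
  simp only [leVerrierStep, hN]
  congr 1
  have htr : (List.zipWith dotL (matL A) (matL (adjCoeff A (n - (k + 1))))).sum =
      (A * adjCoeff A (n - (k + 1))).trace := by
    simp only [matL, zipWith_ofFn, dotL_ofFn, List.sum_ofFn, Matrix.trace, Matrix.diag_apply]
    refine Finset.sum_congr rfl fun i _ => ?_
    rw [Matrix.mul_apply]
    refine Finset.sum_congr rfl fun j _ => ?_
    rw [← adjCoeff_transpose hA, Matrix.transpose_apply, adjCoeff_transpose hA]
  rw [htr, trace_mul_adjCoeff, Fintype.card_fin, Nat.cast_sub (by omega : k + 1 ≤ n)]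
  refine Int.ediv_eq_of_eq_mul_left (by positivity) ?_
  ring

theorem leVerrier_matL {n : ℕ} {A : Matrix (Fin n) (Fin n) ℤ} (hA : A.transpose = A) :
    leVerrier (matL A) = (matL (adjCoeff A 0), A.charpoly.coeff 0) := by
  -- The initial values 0 and 1 are the matrix coefficient at n and the leading coefficient of the
  -- monic χ.
  have h0 : (((idL (matL A).length).map fun r => r.map fun x => 0 * x, 1) : List (List ℤ) × ℤ) =
      (matL (adjCoeff A (n - 0)), A.charpoly.coeff (n - 0)) := by
    rw [idL_eq, map_smul_matL, zero_smul, length_matL, Nat.sub_zero, adjCoeff_eq_zero A (by simp)]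
    congr 1
    have := A.charpoly_monic.coeff_natDegree
    rw [A.charpoly_natDegree_eq_dim, Fintype.card_fin] at this
    exact this.symm
  have key : ∀ k ≤ n, (List.range k).foldl (leVerrierStep (matL A))
      ((idL (matL A).length).map fun r => r.map fun x => 0 * x, 1) =
      (matL (adjCoeff A (n - k)), A.charpoly.coeff (n - k)) := by
    intro k
    induction k with
    | zero => intro _; exact h0
    | succ k ih =>
      intro hk
      rw [List.range_succ, List.foldl_append, ih (by omega), List.foldl_cons, List.foldl_nil,
        leVerrierStep_adjCoeff hA (by omega)]
  have := key n le_rfl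
  rw [Nat.sub_self] at this
  rw [leVerrier, ← this, length_matL]

/-- The scalar products of xB with the rows of B form Gx, where G is the Gram matrix. Multiplication
by the last matrix of the recursion turns this into -χ(0)·x, and χ(0) ≠ 0 because det G ≠ 0. -/
theorem coeffs_vecMul {n m : ℕ} {B : Matrix (Fin n) (Fin m) ℤ} (hB : (B * B.transpose).det ≠ 0)
    (x : Fin n → ℤ) : coeffs (matL B) (List.ofFn (Matrix.vecMul x B)) = List.ofFn x := by
  have hA : (B * B.transpose).transpose = B * B.transpose := by
    rw [Matrix.transpose_mul, Matrix.transpose_transpose]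
  set A := B * B.transpose with hAdef
  have hc : A.charpoly.coeff 0 ≠ 0 := by
    intro h
    rw [Matrix.det_eq_sign_charpoly_coeff, h, mul_zero] at hB
    exact hB rfl
  rw [coeffs, mulTr_matL, ← hAdef, leVerrier_matL hA]
  have h1 : (matL B).map (fun b => dotL (List.ofFn (Matrix.vecMul x B)) b) =
      List.ofFn (A.mulVec x) := by
    simp only [matL, List.map_ofFn, Function.comp_def, dotL_ofFn]
    congr 1
    funext i
    rw [hAdef, ← Matrix.mulVec_mulVec, Matrix.mulVec_transpose, dotProduct_comm]
    rfl
  rw [h1]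
  simp only [matL, List.map_ofFn, Function.comp_def, dotL_ofFn]
  congr 1
  funext i
  have h2 : adjCoeff A 0 i ⬝ᵥ A.mulVec x = (-A.charpoly.coeff 0) * x i := by
    change (adjCoeff A 0).mulVec (A.mulVec x) i = _
    rw [Matrix.mulVec_mulVec, adjCoeff_zero_mul, Matrix.neg_mulVec, Matrix.smul_mulVec,
      Matrix.one_mulVec]
    simp
  rw [h2, zero_sub]
  exact Int.mul_ediv_cancel_left _ (neg_ne_zero.2 hc)

/-- Even a meaningless answer yields n integers, so what `combine` makes of it is always a lattice
vector. -/
theorem exists_coeffs_eq_ofFn {n m : ℕ} (B : Matrix (Fin n) (Fin m) ℤ) (v : List ℤ) :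
    ∃ x : Fin n → ℤ, coeffs (matL B) v = List.ofFn x := by
  have hA : (B * B.transpose).transpose = B * B.transpose := by
    rw [Matrix.transpose_mul, Matrix.transpose_transpose]
  have h : (coeffs (matL B) v).length = n := by
    rw [coeffs, mulTr_matL, leVerrier_matL hA]
    simp
  generalize coeffs (matL B) v = l at h
  subst h
  exact ⟨l.get, by simp⟩

theorem combine_matL {n m : ℕ} (B : Matrix (Fin n) (Fin m) ℤ) (x : Fin n → ℤ) :
    combine (matL B) m (List.ofFn x) = List.ofFn (Matrix.vecMul x B) := by
  simp only [combine, matL, List.map_ofFn, Function.comp_def, map_range_eq_ofFn, dotL_ofFn]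
  congr 1
  funext j
  simp [Matrix.vecMul]

theorem subMul_ofFn {m : ℕ} (c : ℤ) (u v : Fin m → ℤ) :
    subMul c (List.ofFn u) (List.ofFn v) = List.ofFn (u - c • v) := by
  rw [subMul, zipWith_ofFn]
  rfl

theorem sqDist_ofFn {m : ℕ} (t y : Fin m → ℤ) :
    sqDist (List.ofFn t) (List.ofFn y) = ∑ j, (t j - y j) ^ 2 := by
  rw [sqDist, subMul_ofFn, dotL_ofFn, one_smul]
  exact Finset.sum_congr rfl fun j _ => (sq _).symm

end LatticeReduction

namespace LatticeReduction

/-! ### Counting: random sublattices -/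

theorem pow_sub_dvd_of_dvd_mul {u w : ℤ} {j k : ℕ} (h : 2 ^ k ∣ u * w) (hw : ¬ 2 ^ (j + 1) ∣ w) :
    (2 : ℤ) ^ (k - j) ∣ u := by
  induction j generalizing k w with
  | zero => exact Int.prime_two.pow_dvd_of_dvd_mul_right k (by simpa using hw) h
  | succ j ih =>
    by_cases h2 : (2 : ℤ) ∣ w
    · obtain ⟨v, rfl⟩ := h2
      cases k with
      | zero => simp
      | succ k =>
        rw [Nat.add_sub_add_right]
        refine ih (w := v) ?_ fun hv => hw ?_
        · rw [pow_succ', mul_left_comm] at h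
          exact Int.dvd_of_mul_dvd_mul_left (by norm_num) h
        · rw [pow_succ']
          exact mul_dvd_mul_left 2 hv
    · exact (pow_dvd_pow 2 (Nat.sub_le _ _)).trans (Int.prime_two.pow_dvd_of_dvd_mul_right k h2 h)

/-- The linear form `x₀ - ∑ zᵢ xᵢ`. -/
def linForm {n Q : ℕ} (z : Fin n → Fin Q) (x : Fin (n + 1) → ℤ) : ℤ :=
  x 0 - ∑ i, ((z i : ℕ) : ℤ) * x i.succ

theorem linForm_sub {n Q : ℕ} (z : Fin n → Fin Q) (x y : Fin (n + 1) → ℤ) :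
    linForm z (x - y) = linForm z x - linForm z y := by
  simp only [linForm, Pi.sub_apply, mul_sub, Finset.sum_sub_distrib]
  ring

/-- If a coordinate of w with a random coefficient is not divisible by 2^(j+1), two solutions
differing only there differ by a multiple of 2^(k-j). So the shifts of that digit by 0, …, 2^(k-j) -
1, taken over all solutions, are distinct. Otherwise only w₀ fails the divisibility, and then the
form is never divisible by 2^(j+1). -/
theorem card_linForm_dvd_le {n K j k : ℕ} (hj : j < k) (hk : k ≤ K) {w : Fin (n + 1) → ℤ}
    (hw : ¬ ∀ i, (2 : ℤ) ^ (j + 1) ∣ w i) :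
    2 ^ (k - j) * {z : Fin n → Fin (2 ^ K) | (2 : ℤ) ^ k ∣ linForm z w}.ncard ≤
      (2 ^ K) ^ n := by
  by_cases hs : ∀ i : Fin n, (2 : ℤ) ^ (j + 1) ∣ w i.succ
  · have h0 : ¬ (2 : ℤ) ^ (j + 1) ∣ w 0 := fun h0 => hw (Fin.cases h0 hs)
    have : {z : Fin n → Fin (2 ^ K) | (2 : ℤ) ^ k ∣ linForm z w} = ∅ := by
      refine Set.eq_empty_of_forall_notMem fun z hz => h0 ?_
      have h1 : (2 : ℤ) ^ (j + 1) ∣ linForm z w := (pow_dvd_pow 2 hj).trans hz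
      have h2 : (2 : ℤ) ^ (j + 1) ∣ ∑ i, ((z i : ℕ) : ℤ) * w i.succ :=
        Finset.dvd_sum fun i _ => (hs i).mul_left _
      have := dvd_add h1 h2
      rwa [linForm, sub_add_cancel] at this
    rw [this]
    simp
  · push Not at hs
    obtain ⟨i, hi⟩ := hs
    let f : (Fin n → Fin (2 ^ K)) × Fin (2 ^ (k - j)) → Fin n → Fin (2 ^ K) := fun p =>
      Function.update p.1 i (Fin.ofNat (2 ^ K) (p.1 i + p.2))
    have hinj : Set.InjOn f
        ({z : Fin n → Fin (2 ^ K) | (2 : ℤ) ^ k ∣ linForm z w} ×ˢ Set.univ) := by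
      rintro ⟨z, a⟩ ⟨hz, -⟩ ⟨y, b⟩ ⟨hy, -⟩ h
      have hother : ∀ l, l ≠ i → z l = y l := fun l hl => by
        have := congrFun h l
        simpa [f, hl] using this
      have hmod : ((z i : ℕ) + a) % 2 ^ K = ((y i : ℕ) + b) % 2 ^ K := by
        have := congrArg Fin.val (congrFun h i)
        simpa [f, Fin.ofNat] using this
      have hdiff : linForm y w - linForm z w = (((z i : ℕ) : ℤ) - (y i : ℕ)) * w i.succ := by
        have : ∑ l, ((z l : ℕ) : ℤ) * w l.succ - ∑ l, ((y l : ℕ) : ℤ) * w l.succ =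
            (((z i : ℕ) : ℤ) - (y i : ℕ)) * w i.succ := by
          rw [← Finset.sum_sub_distrib, Finset.sum_eq_single i]
          · ring
          · intro l _ hl
            rw [hother l hl, sub_self]
          · simp
        rw [← this, linForm, linForm]
        ring
      have h1 : (2 : ℤ) ^ (k - j) ∣ ((z i : ℕ) : ℤ) - (y i : ℕ) :=
        pow_sub_dvd_of_dvd_mul (hdiff ▸ dvd_sub hy hz) hi
      have h2 : (2 : ℤ) ^ (k - j) ∣ ((y i : ℕ) : ℤ) + (b : ℕ) - ((z i : ℕ) + (a : ℕ)) := by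
        have h3 := (Nat.modEq_iff_dvd (n := 2 ^ K)).1 hmod
        push_cast at h3
        exact (pow_dvd_pow 2 (by omega)).trans h3
      have h3 : (2 : ℤ) ^ (k - j) ∣ ((b : ℕ) : ℤ) - ((a : ℕ) : ℤ) := by
        have := dvd_add h1 h2
        rwa [show ((z i : ℕ) : ℤ) - (y i : ℕ) + ((y i : ℕ) + (b : ℕ) - ((z i : ℕ) + (a : ℕ))) =
          ((b : ℕ) : ℤ) - ((a : ℕ) : ℤ) by ring] at this
      have h4 : a = b := by
        have h5 : (a : ℕ) ≡ b [MOD 2 ^ (k - j)] := Nat.modEq_iff_dvd.2 (by exact_mod_cast h3)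
        exact Fin.ext (h5.eq_of_lt_of_lt a.2 b.2)
      subst h4
      have h5 : z i = y i := Fin.ext (((Nat.ModEq.add_right_cancel' (a : ℕ) hmod)).eq_of_lt_of_lt
          (z i).2 (y i).2)
      refine Prod.ext (funext fun l => ?_) rfl
      by_cases hl : l = i
      · rw [hl]; exact h5
      · exact hother l hl
    have := Set.ncard_le_ncard_of_injOn (t := Set.univ) f (fun _ _ => Set.mem_univ _) hinj
    rw [Set.ncard_prod, Set.ncard_univ, Set.ncard_univ] at this
    simpa [mul_comm] using this

/-- A finite set that contains with a vector all its positive integral fractions. -/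
def RayClosed {n : ℕ} (W : Finset (Fin n → ℤ)) : Prop :=
  0 ∉ W ∧ ∀ (u : Fin n → ℤ) (c i : ℤ), 0 < i → i ≤ c → c • u ∈ W → i • u ∈ W

/-- Write w = d·u with u primitive and g ∣ d. The g vectors (d - a)·u with 0 ≤ a < g lie in `W`.
They determine w and a: the gcd of the coordinates is d - a, whose residue modulo g gives a. -/
theorem RayClosed.card_dvd_le {n : ℕ} {W : Finset (Fin (n + 1) → ℤ)} (hW : RayClosed W)
    (g : ℕ) : g * (W.filter fun w => ∀ i, (g : ℤ) ∣ w i).card ≤ W.card := by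
  have hex : ∀ w : Fin (n + 1) → ℤ, ∃ u : Fin (n + 1) → ℤ,
      (∀ i, w i = Finset.univ.gcd w * u i) ∧ Finset.univ.gcd u = 1 := fun w => by
    obtain ⟨u, h1, h2⟩ := Finset.extract_gcd w (s := Finset.univ) ⟨0, Finset.mem_univ _⟩
    exact ⟨u, fun i => h1 i (Finset.mem_univ i), h2⟩
  choose u hu hu1 using hex
  let f : (Fin (n + 1) → ℤ) × Fin g → Fin (n + 1) → ℤ := fun p =>
    (Finset.univ.gcd p.1 - ((p.2 : ℕ) : ℤ)) • u p.1
  have hnonneg : ∀ w : Fin (n + 1) → ℤ, 0 ≤ Finset.univ.gcd w := fun w => by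
    have := Finset.normalize_gcd (s := Finset.univ) (f := w)
    exact Int.nonneg_of_normalize_eq_self this
  have hpos : ∀ w ∈ W.filter fun w => ∀ i, (g : ℤ) ∣ w i,
      (g : ℤ) ∣ Finset.univ.gcd w ∧ (g : ℤ) ≤ Finset.univ.gcd w := by
    intro w hw
    rw [Finset.mem_filter] at hw
    have hd : (g : ℤ) ∣ Finset.univ.gcd w := Finset.dvd_gcd fun i _ => hw.2 i
    refine ⟨hd, Int.le_of_dvd (lt_of_le_of_ne (hnonneg w) fun h => hW.1 ?_) hd⟩
    convert hw.1
    ext i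
    exact ((Finset.gcd_eq_zero_iff.1 h.symm) i (Finset.mem_univ i)).symm
  have hcard := Finset.card_le_card_of_injOn (s := (W.filter fun w => ∀ i, (g : ℤ) ∣ w i) ×ˢ
    (Finset.univ : Finset (Fin g))) (t := W) f ?_ ?_
  · rwa [Finset.card_product, Finset.card_univ, Fintype.card_fin, mul_comm] at hcard
  · rintro ⟨w, a⟩ h
    have h := (Finset.mem_product.1 h).1
    obtain ⟨-, h2⟩ := hpos w h
    have ha := a.2
    refine hW.2 (u w) (Finset.univ.gcd w) _ (by simp only; omega) (by simp only; omega) ?_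
    convert (Finset.mem_filter.1 h).1
    ext i
    exact (hu w i).symm
  · rintro ⟨w, a⟩ h ⟨v, b⟩ h' heq
    obtain ⟨hd, hle⟩ := hpos w (Finset.mem_product.1 h).1
    obtain ⟨hd', hle'⟩ := hpos v (Finset.mem_product.1 h').1
    have ha := a.2
    have hb := b.2
    have hgcd : ∀ (c : ℤ) (w : Fin (n + 1) → ℤ), 0 < c → Finset.univ.gcd (c • u w) = c := by
      intro c w hc
      have : (c • u w) = fun i => c * u w i := rfl
      rw [this, Finset.gcd_mul_left, hu1, mul_one]
      exact Int.normalize_of_nonneg hc.le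
    have h1 : Finset.univ.gcd w - ((a : ℕ) : ℤ) = Finset.univ.gcd v - ((b : ℕ) : ℤ) := by
      rw [← hgcd (Finset.univ.gcd w - ((a : ℕ) : ℤ)) w (by omega),
        ← hgcd (Finset.univ.gcd v - ((b : ℕ) : ℤ)) v (by omega)]
      exact congrArg Finset.univ.gcd heq
    have h2 : a = b := by
      have h3 : (g : ℤ) ∣ ((b : ℕ) : ℤ) - ((a : ℕ) : ℤ) := by
        have := dvd_sub hd' hd
        rwa [show Finset.univ.gcd v - Finset.univ.gcd w = ((b : ℕ) : ℤ) - ((a : ℕ) : ℤ) by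
          omega] at this
      exact Fin.ext ((Nat.modEq_iff_dvd.2 h3).eq_of_lt_of_lt ha hb)
    subst h2
    have h3 : Finset.univ.gcd w = Finset.univ.gcd v := by omega
    refine Prod.ext (funext fun i => ?_) rfl
    have h4 : (Finset.univ.gcd w - ((a : ℕ) : ℤ)) * u w i =
        (Finset.univ.gcd v - ((a : ℕ) : ℤ)) * u v i := congrFun heq i
    rw [← h3] at h4
    have h5 := mul_left_cancel₀ (by omega) h4
    change w i = v i
    rw [hu w i, hu v i, h3, h5]

/-- A vector divisible by 2^j but not by 2^(j+1) is hit by at most a 2^(j-k) part of the z, and at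
most |W|/2^j vectors are divisible by 2^j. Each of the k + 1 values of j thus contributes at most
|W|/2^k. -/
theorem RayClosed.sum_card_le {n : ℕ} {W : Finset (Fin (n + 1) → ℤ)} (hW : RayClosed W) {k K : ℕ}
    (hk : k ≤ K) :
    2 ^ k * ∑ w ∈ W, {z : Fin n → Fin (2 ^ K) | (2 : ℤ) ^ k ∣ linForm z w}.ncard ≤
      (k + 1) * W.card * (2 ^ K) ^ n := by
  classical
  -- For each w a single term suffices, the one at the exact power of 2 in w capped at k. Bounding
  -- by the whole sum allows the order of summation to be exchanged.
  have hpt : ∀ w : Fin (n + 1) → ℤ,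
      2 ^ k * {z : Fin n → Fin (2 ^ K) | (2 : ℤ) ^ k ∣ linForm z w}.ncard ≤
      ∑ j ∈ Finset.range (k + 1), if ∀ i, (2 : ℤ) ^ j ∣ w i then 2 ^ j * (2 ^ K) ^ n else 0 := by
    intro w
    have hle : ∀ j ∈ Finset.range (k + 1), (∀ i, (2 : ℤ) ^ j ∣ w i) →
        2 ^ j * (2 ^ K) ^ n ≤ ∑ j ∈ Finset.range (k + 1),
          if ∀ i, (2 : ℤ) ^ j ∣ w i then 2 ^ j * (2 ^ K) ^ n else 0 := by
      intro j hj h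
      have := Finset.single_le_sum (f := fun j => if ∀ i, (2 : ℤ) ^ j ∣ w i then
        2 ^ j * (2 ^ K) ^ n else 0) (fun _ _ => Nat.zero_le _) hj
      simpa only [h, if_true, implies_true] using this
    by_cases hall : ∀ i, (2 : ℤ) ^ k ∣ w i
    · refine le_trans ?_ (hle k (by simp) hall)
      gcongr
      refine (Set.ncard_le_ncard (Set.subset_univ _)).trans ?_
      rw [Set.ncard_univ]
      simp
    · have hex : ∃ j, ¬ ∀ i, (2 : ℤ) ^ j ∣ w i := ⟨k, hall⟩
      have hspec := Nat.find_spec hex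
      have hmin := fun j => Nat.find_min (H := hex) (m := j)
      have hlek := Nat.find_min' hex hall
      cases hJ : Nat.find hex with
      | zero =>
        rw [hJ] at hspec
        simp at hspec
      | succ j =>
        rw [hJ] at hspec hlek
        have hj := not_not.1 (hmin j (by omega))
        refine le_trans ?_ (hle j (by simp; omega) hj)
        have h1 := card_linForm_dvd_le (K := K) (by omega : j < k) hk hspec
        calc _ = 2 ^ j * (2 ^ (k - j) *
              {z : Fin n → Fin (2 ^ K) | (2 : ℤ) ^ k ∣ linForm z w}.ncard) := by
              rw [← mul_assoc, ← pow_add]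
              congr 2
              omega
          _ ≤ _ := Nat.mul_le_mul_left _ h1
  rw [Finset.mul_sum]
  refine (Finset.sum_le_sum fun w _ => hpt w).trans ?_
  rw [Finset.sum_comm]
  have : ∀ j ∈ Finset.range (k + 1), (∑ w ∈ W, if ∀ i, (2 : ℤ) ^ j ∣ w i then
      2 ^ j * (2 ^ K) ^ n else 0) ≤ W.card * (2 ^ K) ^ n := by
    intro j _
    rw [← Finset.sum_filter, Finset.sum_const, smul_eq_mul]
    have := hW.card_dvd_le (2 ^ j)
    push_cast at this
    calc _ = (2 ^ j * (W.filter fun w => ∀ i, (2 : ℤ) ^ j ∣ w i).card) * (2 ^ K) ^ n := by ring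
      _ ≤ _ := Nat.mul_le_mul_right _ this
  refine (Finset.sum_le_sum this).trans ?_
  simp [mul_assoc]

theorem card_dvd_sub_ge {k K : ℕ} (hk : k ≤ K) (a : ℤ) :
    2 ^ K ≤ 2 ^ k * {c : Fin (2 ^ K) | (2 : ℤ) ^ k ∣ a - (c : ℕ)}.ncard := by
  have h2 : (0 : ℤ) < 2 ^ k := by positivity
  set r := (a % 2 ^ k).toNat with hr
  have hr1 : (r : ℤ) = a % 2 ^ k := Int.toNat_of_nonneg (Int.emod_nonneg _ h2.ne')
  have hr2 : r < 2 ^ k := by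
    have := Int.emod_lt_of_pos a h2
    rw [← hr1] at this
    exact_mod_cast this
  have hK : 2 ^ K = 2 ^ k * 2 ^ (K - k) := by rw [← pow_add]; congr 1; omega
  let f : Fin (2 ^ (K - k)) → Fin (2 ^ K) := fun i => ⟨r + 2 ^ k * i, by
    have h1 : 2 ^ k * ((i : ℕ) + 1) ≤ 2 ^ k * 2 ^ (K - k) := Nat.mul_le_mul_left _ i.2
    rw [hK]
    linarith⟩
  have hinj : Function.Injective f := by
    intro i j h
    have h := congrArg Fin.val h
    simp only [f] at h
    have : (0 : ℕ) < 2 ^ k := by positivity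
    exact Fin.ext (Nat.eq_of_mul_eq_mul_left this (by omega))
  have := Set.ncard_le_ncard_of_injOn (s := Set.univ)
    (t := {c : Fin (2 ^ K) | (2 : ℤ) ^ k ∣ a - (c : ℕ)}) f ?_ hinj.injOn
  · rw [Set.ncard_univ, Nat.card_eq_fintype_card, Fintype.card_fin] at this
    exact hK.le.trans (Nat.mul_le_mul_left _ this)
  · intro i _
    refine ⟨a / 2 ^ k - i, ?_⟩
    have := Int.mul_ediv_add_emod a (2 ^ k)
    simp only [f]
    push_cast
    rw [hr1]
    linear_combination -this

/-- The random digits `c, z` are good if the sublattice coset contains a point of `S` and the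
sublattice contains no point of `T`. -/
def GoodDigits {n K : ℕ} (S T : Finset (Fin (n + 1) → ℤ)) (k : ℕ)
    (d : Fin (2 ^ K) × (Fin n → Fin (2 ^ K))) : Prop :=
  (∃ x ∈ S, (2 : ℤ) ^ k ∣ linForm d.2 x - (d.1 : ℕ)) ∧ ∀ w ∈ T, ¬ (2 : ℤ) ^ k ∣ linForm d.2 w

/-- For x in S let Z(x) consist of the z that separate x from the rest of S modulo 2^k and avoid T.
There are at most 3|S| vectors to avoid, so the bad z form at most a part 3(k+1)|S|/2^k ≤ 1/2. A
2^(-k) part of the residues c hits x. Separation makes the events for different x disjoint, so their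
counts add up. -/
theorem card_goodDigits_ge {n k K : ℕ} {S T : Finset (Fin (n + 1) → ℤ)} (hk : k ≤ K)
    (hS : ∀ x ∈ S, RayClosed ((S.erase x).image fun y => y - x)) (hT : RayClosed T)
    (hTS : T.card ≤ 2 * S.card) (hq : 6 * (k + 1) * S.card ≤ 2 ^ k) :
    S.card * (2 ^ K) ^ (n + 1) ≤
      2 * 2 ^ k * {d : Fin (2 ^ K) × (Fin n → Fin (2 ^ K)) | GoodDigits S T k d}.ncard := by
  classical
  let Z : (Fin (n + 1) → ℤ) → Finset (Fin n → Fin (2 ^ K)) := fun x =>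
    Finset.univ.filter fun z => (∀ y ∈ S.erase x, ¬ (2 : ℤ) ^ k ∣ linForm z (y - x)) ∧
      ∀ w ∈ T, ¬ (2 : ℤ) ^ k ∣ linForm z w
  have hZ : ∀ x ∈ S, (2 ^ K) ^ n ≤ 2 * (Z x).card := by
    intro x hx
    have hcompl : (Finset.univ \ Z x) ⊆
        (((S.erase x).image fun y => y - x) ∪ T).biUnion fun w =>
          Finset.univ.filter fun z => (2 : ℤ) ^ k ∣ linForm z w := by
      intro z hz
      simp only [Z, Finset.mem_sdiff, Finset.mem_univ, true_and, Finset.mem_filter, not_and_or,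
        not_forall, not_not] at hz
      rw [Finset.mem_biUnion]
      rcases hz with ⟨y, hy, h⟩ | ⟨w, hw, h⟩
      · exact ⟨y - x, Finset.mem_union_left _ (Finset.mem_image_of_mem _ hy), by simpa using h⟩
      · exact ⟨w, Finset.mem_union_right _ hw, by simpa using h⟩
    have hN : ∀ w : Fin (n + 1) → ℤ,
        (Finset.univ.filter fun z : Fin n → Fin (2 ^ K) => (2 : ℤ) ^ k ∣ linForm z w).card =
        {z : Fin n → Fin (2 ^ K) | (2 : ℤ) ^ k ∣ linForm z w}.ncard := fun w => by
      rw [← Set.ncard_coe_finset]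
      simp
    have h1 : (Finset.univ \ Z x).card ≤
        ∑ w ∈ (S.erase x).image (fun y => y - x),
          {z : Fin n → Fin (2 ^ K) | (2 : ℤ) ^ k ∣ linForm z w}.ncard +
        ∑ w ∈ T, {z : Fin n → Fin (2 ^ K) | (2 : ℤ) ^ k ∣ linForm z w}.ncard := by
      refine (Finset.card_le_card hcompl).trans (Finset.card_biUnion_le.trans ?_)
      simp only [hN]
      rw [← Finset.sum_union_inter]
      exact Nat.le_add_right _ _
    have h2 := (hS x hx).sum_card_le hk
    have h3 := hT.sum_card_le hk
    have h4 : ((S.erase x).image fun y => y - x).card ≤ S.card :=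
      Finset.card_image_le.trans (Finset.card_le_card (Finset.erase_subset _ _))
    have h5 : (Finset.univ \ Z x).card + (Z x).card = (2 ^ K) ^ n := by
      rw [Finset.card_sdiff_add_card_eq_card (Finset.subset_univ _)]
      simp
    have h6 : 2 ^ k * (Finset.univ \ Z x).card ≤ 3 * (k + 1) * S.card * (2 ^ K) ^ n := by
      calc _ ≤ _ := Nat.mul_le_mul_left _ h1
        _ ≤ (k + 1) * ((S.erase x).image fun y => y - x).card * (2 ^ K) ^ n +
            (k + 1) * T.card * (2 ^ K) ^ n := by rw [mul_add]; exact add_le_add h2 h3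
        _ ≤ (k + 1) * S.card * (2 ^ K) ^ n + (k + 1) * (2 * S.card) * (2 ^ K) ^ n := by gcongr
        _ = _ := by ring
    have h7 : 2 ^ k * (2 * (Finset.univ \ Z x).card) ≤ 2 ^ k * (2 ^ K) ^ n := by
      calc _ = 2 * (2 ^ k * (Finset.univ \ Z x).card) := by ring
        _ ≤ 2 * (3 * (k + 1) * S.card * (2 ^ K) ^ n) := Nat.mul_le_mul_left _ h6
        _ = (6 * (k + 1) * S.card) * (2 ^ K) ^ n := by ring
        _ ≤ _ := Nat.mul_le_mul_right _ hq
    have h8 := Nat.le_of_mul_le_mul_left h7 (by positivity)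
    omega
  let G : (Fin (n + 1) → ℤ) → Finset (Fin (2 ^ K) × (Fin n → Fin (2 ^ K))) := fun x =>
    (Z x).biUnion fun z => (Finset.univ.filter fun c : Fin (2 ^ K) =>
      (2 : ℤ) ^ k ∣ linForm z x - (c : ℕ)).image fun c => (c, z)
  have hmemG : ∀ x d, d ∈ G x ↔ d.2 ∈ Z x ∧ (2 : ℤ) ^ k ∣ linForm d.2 x - (d.1 : ℕ) := by
    intro x ⟨c, z⟩
    simp only [G, Finset.mem_biUnion, Finset.mem_image, Finset.mem_filter, Finset.mem_univ,
      true_and, Prod.mk.injEq]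
    constructor
    · rintro ⟨z', hz', c', hc', rfl, rfl⟩
      exact ⟨hz', hc'⟩
    · rintro ⟨hz, hc⟩
      exact ⟨z, hz, c, hc, rfl, rfl⟩
  have hGcard : ∀ x, (Z x).card * 2 ^ K ≤ 2 ^ k * (G x).card := by
    intro x
    rw [Finset.card_biUnion, Finset.mul_sum, ← smul_eq_mul, ← Finset.sum_const]
    · refine Finset.sum_le_sum fun z _ => ?_
      rw [Finset.card_image_of_injective _ fun c c' h => congrArg Prod.fst h]
      refine (card_dvd_sub_ge hk (linForm z x)).trans (Nat.mul_le_mul_left _ ?_)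
      rw [← Set.ncard_coe_finset]
      simp
    · intro z _ z' _ hzz'
      refine Finset.disjoint_left.2 fun d hd hd' => hzz' ?_
      obtain ⟨c, -, rfl⟩ := Finset.mem_image.1 hd
      obtain ⟨c', -, h⟩ := Finset.mem_image.1 hd'
      exact (congrArg Prod.snd h).symm
  have hdisj : ∀ x ∈ S, ∀ y ∈ S, x ≠ y → Disjoint (G x) (G y) := by
    intro x _ y hy hxy
    refine Finset.disjoint_left.2 fun d hd hd' => ?_
    obtain ⟨h1, h2⟩ := (hmemG x d).1 hd
    obtain ⟨-, h3⟩ := (hmemG y d).1 hd'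
    refine (Finset.mem_filter.1 h1).2.1 y (Finset.mem_erase.2 ⟨hxy.symm, hy⟩) ?_
    rw [linForm_sub]
    have := dvd_sub h3 h2
    rwa [sub_sub_sub_cancel_right] at this
  have hsub : ((S.biUnion G : Finset _) : Set (Fin (2 ^ K) × (Fin n → Fin (2 ^ K)))) ⊆
      {d | GoodDigits S T k d} := by
    intro d hd
    obtain ⟨x, hx, hxd⟩ := Finset.mem_biUnion.1 (Finset.mem_coe.1 hd)
    obtain ⟨h1, h2⟩ := (hmemG x d).1 hxd
    exact ⟨⟨x, hx, h2⟩, (Finset.mem_filter.1 h1).2.2⟩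
  have hcard : ∑ x ∈ S, (G x).card ≤
      {d : Fin (2 ^ K) × (Fin n → Fin (2 ^ K)) | GoodDigits S T k d}.ncard := by
    rw [← Finset.card_biUnion hdisj, ← Set.ncard_coe_finset]
    exact Set.ncard_le_ncard hsub
  calc S.card * (2 ^ K) ^ (n + 1) = ∑ x ∈ S, (2 ^ K) ^ n * 2 ^ K := by
        rw [Finset.sum_const, smul_eq_mul, pow_succ]
    _ ≤ ∑ x ∈ S, 2 * 2 ^ k * (G x).card := Finset.sum_le_sum fun x hx => by
        calc _ ≤ 2 * (Z x).card * 2 ^ K := Nat.mul_le_mul_right _ (hZ x hx)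
          _ = 2 * ((Z x).card * 2 ^ K) := by ring
          _ ≤ 2 * (2 ^ k * (G x).card) := Nat.mul_le_mul_left _ (hGcard x)
          _ = _ := by ring
    _ = 2 * 2 ^ k * ∑ x ∈ S, (G x).card := by rw [Finset.mul_sum]
    _ ≤ _ := Nat.mul_le_mul_left _ hcard

/-- The least k with the first inequality violates it at k - 1, which gives the second one. The
bound 2E + 10 works since 6(2E + 11) ≤ 2^(E + 10). -/
theorem exists_level {E s : ℕ} (hs : 0 < s) (hsE : s ≤ 2 ^ E) :
    ∃ k ≤ 2 * E + 10, 6 * (k + 1) * s ≤ 2 ^ k ∧ 2 ^ k ≤ 12 * (2 * E + 10 + 1) * s := by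
  have hlast : 6 * (2 * E + 10 + 1) * s ≤ 2 ^ (2 * E + 10) := by
    have h1 : E + 1 ≤ 2 ^ E := Nat.lt_two_pow_self
    have h2 : 6 * (2 * E + 10 + 1) ≤ 1024 * 2 ^ E := by omega
    calc _ ≤ 1024 * 2 ^ E * 2 ^ E := Nat.mul_le_mul h2 hsE
      _ = _ := by ring
  have hex : ∃ k, 6 * (k + 1) * s ≤ 2 ^ k := ⟨_, hlast⟩
  have hle : Nat.find hex ≤ 2 * E + 10 := Nat.find_min' hex hlast
  refine ⟨Nat.find hex, hle, Nat.find_spec hex, ?_⟩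
  cases hk : Nat.find hex with
  | zero =>
    have := Nat.find_spec hex
    rw [hk] at this
    omega
  | succ k =>
    have h := Nat.find_min hex (m := k) (by omega)
    push Not at h
    rw [pow_succ]
    rw [hk] at hle
    have : 6 * (k + 1) * s ≤ 6 * (2 * E + 10 + 1) * s := by gcongr; omega
    nlinarith

theorem exists_level_card_ge {n E : ℕ} {S T : Finset (Fin (n + 1) → ℤ)} (hne : S.Nonempty)
    (hSE : S.card ≤ 2 ^ E) (hS : ∀ x ∈ S, RayClosed ((S.erase x).image fun y => y - x))
    (hT : RayClosed T) (hTS : T.card ≤ 2 * S.card) :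
    ∃ k ≤ 2 * E + 10, (2 ^ (2 * E + 10)) ^ (n + 1) ≤ 24 * (2 * E + 10 + 1) *
      {d : Fin (2 ^ (2 * E + 10)) × (Fin n → Fin (2 ^ (2 * E + 10))) |
        GoodDigits S T k d}.ncard := by
  have hpos := hne.card_pos
  obtain ⟨k, hk, h1, h2⟩ := exists_level hpos hSE
  refine ⟨k, hk, ?_⟩
  have h3 := card_goodDigits_ge hk hS hT hTS h1
  set g := {d : Fin (2 ^ (2 * E + 10)) × (Fin n → Fin (2 ^ (2 * E + 10))) |
    GoodDigits S T k d}.ncard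
  refine Nat.le_of_mul_le_mul_left ?_ hpos
  calc _ ≤ _ := h3
    _ ≤ 2 * (12 * (2 * E + 10 + 1) * S.card) * g := by gcongr
    _ = _ := by ring

end LatticeReduction

namespace LatticeReduction

/-! ### Counting: independent trials -/

theorem card_filter_mod_div (W M : ℕ) (A B : ℕ → Prop) [DecidablePred A] [DecidablePred B] :
    ((Finset.range (W * M)).filter fun R => A (R % W) ∧ B (R / W)).card =
      ((Finset.range W).filter A).card * ((Finset.range M).filter B).card := by
  rcases Nat.eq_zero_or_pos W with rfl | hW
  · simp
  rw [← Finset.card_product]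
  refine Finset.card_bij' (fun R _ => (R % W, R / W)) (fun p _ => p.1 + W * p.2) ?_ ?_ ?_ ?_
  · intro R hR
    simp only [Finset.mem_filter, Finset.mem_range, Finset.mem_product] at hR ⊢
    exact ⟨⟨Nat.mod_lt _ hW, hR.2.1⟩, Nat.div_lt_of_lt_mul hR.1, hR.2.2⟩
  · rintro ⟨r, q⟩ h
    simp only [Finset.mem_filter, Finset.mem_range, Finset.mem_product] at h ⊢
    obtain ⟨⟨hr, hA⟩, hq, hB⟩ := h
    have h1 : (r + W * q) % W = r := by rw [Nat.add_mul_mod_self_left, Nat.mod_eq_of_lt hr]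
    have h2 : (r + W * q) / W = q := by
      rw [Nat.add_mul_div_left _ _ hW, Nat.div_eq_of_lt hr, zero_add]
    rw [h1, h2]
    refine ⟨?_, hA, hB⟩
    have : W * (q + 1) ≤ W * M := Nat.mul_le_mul_left _ hq
    linarith
  · intro R _
    exact Nat.mod_add_div R W
  · rintro ⟨r, q⟩ h
    simp only [Finset.mem_filter, Finset.mem_range, Finset.mem_product] at h
    ext
    · simp [Nat.mod_eq_of_lt h.1.1]
    · simp [Nat.add_mul_div_left _ _ hW, Nat.div_eq_of_lt h.1.1]

/-- Distinct digits of a uniform number are independent; surplus high bits contribute only the power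
of 2 at the end. -/
theorem card_all_digits (a : ℕ) (P : ℕ → Prop) [DecidablePred P] (J b : ℕ) (hb : a * J ≤ b) :
    ((Finset.range (2 ^ b)).filter fun R => ∀ j < J, P (digit a R j)).card =
      ((Finset.range (2 ^ a)).filter P).card ^ J * 2 ^ (b - a * J) := by
  induction J generalizing b with
  | zero => simp
  | succ J ih =>
    have hab : a ≤ b := le_trans (Nat.le_mul_of_pos_right a (Nat.succ_pos J)) hb
    have h2 : 2 ^ b = 2 ^ a * 2 ^ (b - a) := by rw [← pow_add]; congr 1; omega
    have hdigit : ∀ R, (∀ j < J + 1, P (digit a R j)) ↔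
        P (R % 2 ^ a) ∧ ∀ j < J, P (digit a (R / 2 ^ a) j) := by
      intro R
      have h0 : digit a R 0 = R % 2 ^ a := by simp [digit]
      have hs : ∀ j, digit a R (j + 1) = digit a (R / 2 ^ a) j := by
        intro j
        rw [digit, digit, Nat.div_div_eq_div_mul, ← pow_add]
        congr 3
        ring
      constructor
      · intro h
        exact ⟨h0 ▸ h 0 (by omega), fun j hj => hs j ▸ h (j + 1) (by omega)⟩
      · rintro ⟨h1, h2⟩ j hj
        cases j with
        | zero => rw [h0]; exact h1
        | succ j => rw [hs]; exact h2 j (by omega)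
    have hmul : a * (J + 1) = a * J + a := by ring
    simp only [hdigit]
    rw [h2, card_filter_mod_div (2 ^ a) (2 ^ (b - a)) P (fun R => ∀ j < J, P (digit a R j)),
      ih (b - a) (by omega), pow_succ, show b - a - a * J = b - a * (J + 1) by omega]
    ring

theorem card_exists_digit_ge (a K b : ℕ) (P : ℕ → Prop) [DecidablePred P]
    (hP : 2 ^ a ≤ 24 * (K + 1) * ((Finset.range (2 ^ a)).filter P).card)
    (hb : a * (48 * (K + 1)) ≤ b) :
    (2 / 3 : ℝ) * 2 ^ b ≤
      ((Finset.range (2 ^ b)).filter fun R => ∃ j < 48 * (K + 1), P (digit a R j)).card := by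
  set J := 48 * (K + 1) with hJ
  set g := ((Finset.range (2 ^ a)).filter P).card with hg
  have h1 := card_all_digits a (fun w => ¬ P w) J b hb
  have h2 : ((Finset.range (2 ^ b)).filter fun R => ∃ j < J, P (digit a R j)).card +
      ((Finset.range (2 ^ b)).filter fun R => ∀ j < J, ¬ P (digit a R j)).card = 2 ^ b := by
    have := Finset.card_filter_add_card_filter_not (s := Finset.range (2 ^ b))
      (p := fun R => ∃ j < J, P (digit a R j))
    rw [Finset.card_range] at this
    simpa only [not_exists, not_and] using this
  have h3 : g + ((Finset.range (2 ^ a)).filter fun w => ¬ P w).card = 2 ^ a := by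
    have := Finset.card_filter_add_card_filter_not (s := Finset.range (2 ^ a)) (p := P)
    rwa [Finset.card_range] at this
  set f := ((Finset.range (2 ^ a)).filter fun w => ¬ P w).card
  have hW : (0 : ℝ) < 2 ^ a := by positivity
  have hK : (0 : ℝ) < K + 1 := by positivity
  have h3' : (g : ℝ) + f = 2 ^ a := by exact_mod_cast h3
  have hP' : (2 : ℝ) ^ a ≤ 24 * (K + 1) * g := by exact_mod_cast hP
  have hf : (f : ℝ) ≤ 2 ^ a * Real.exp (-(1 / (24 * (K + 1)))) := by
    have h4 : (f : ℝ) ≤ 2 ^ a * (1 - 1 / (24 * (K + 1))) := by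
      have : (2 : ℝ) ^ a * (1 / (24 * (K + 1))) ≤ g := by
        rw [mul_one_div, div_le_iff₀ (by positivity)]
        linarith
      linarith
    have h5 := Real.one_sub_le_exp_neg (1 / (24 * ((K : ℝ) + 1)))
    exact h4.trans (mul_le_mul_of_nonneg_left h5 hW.le)
  have hexp : Real.exp (-(1 / (24 * ((K : ℝ) + 1)))) ^ J ≤ 1 / 3 := by
    rw [← Real.exp_nat_mul, hJ]
    -- The number of trials is twice the reciprocal of the success probability, which leaves e⁻²,
    -- and e² ≥ 3.
    have : ((48 * (K + 1) : ℕ) : ℝ) * -(1 / (24 * ((K : ℝ) + 1))) = -2 := by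
      push_cast
      field_simp
      norm_num
    rw [this, Real.exp_neg, inv_eq_one_div]
    refine one_div_le_one_div_of_le (by norm_num) ?_
    have := Real.add_one_le_exp (2 : ℝ)
    linarith
  have hfail : ((f ^ J * 2 ^ (b - a * J) : ℕ) : ℝ) ≤ 1 / 3 * 2 ^ b := by
    push_cast
    calc (f : ℝ) ^ J * 2 ^ (b - a * J)
        ≤ (2 ^ a * Real.exp (-(1 / (24 * (K + 1))))) ^ J * 2 ^ (b - a * J) := by gcongr
      _ = Real.exp (-(1 / (24 * (K + 1)))) ^ J * (2 ^ (a * J) * 2 ^ (b - a * J)) := by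
          rw [mul_pow, ← pow_mul]
          ring
      _ ≤ 1 / 3 * 2 ^ b := by
          rw [← pow_add, Nat.add_sub_cancel' hb]
          gcongr
  rw [← h1] at hfail
  have h2' : (((Finset.range (2 ^ b)).filter fun R => ∃ j < J, P (digit a R j)).card : ℝ) +
      ((Finset.range (2 ^ b)).filter fun R => ∀ j < J, ¬ P (digit a R j)).card = 2 ^ b := by
    exact_mod_cast h2
  linarith

/-- Vectors of digits as numbers. -/
theorem card_digits_ge {n K : ℕ} (G : Fin (2 ^ K) × (Fin n → Fin (2 ^ K)) → Prop) (P : ℕ → Prop)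
    [DecidablePred P]
    (h : ∀ d, G d → ∀ w, digit K w 0 = d.1 → (∀ i : Fin n, digit K w (i + 1) = d.2 i) → P w) :
    {d | G d}.ncard ≤ ((Finset.range (2 ^ (K * (n + 1)))).filter P).card := by
  let f : Fin (2 ^ K) × (Fin n → Fin (2 ^ K)) → ℕ := fun d =>
    (finFunctionFinEquiv (Fin.cons d.1 d.2 : Fin (n + 1) → Fin (2 ^ K)) : ℕ)
  have hf : Function.Injective f := by
    intro d e hde
    have := finFunctionFinEquiv.injective (Fin.ext hde)
    exact Prod.ext (by simpa using congrFun this 0)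
      (funext fun i => by simpa using congrFun this i.succ)
  have hdigit : ∀ d (i : Fin (n + 1)), digit K (f d) i =
      (Fin.cons d.1 d.2 : Fin (n + 1) → Fin (2 ^ K)) i := by
    intro d i
    have := congrArg Fin.val (congrFun (finFunctionFinEquiv.symm_apply_apply
      (Fin.cons d.1 d.2 : Fin (n + 1) → Fin (2 ^ K))) i)
    rw [← this, digit, pow_mul]
    rfl
  rw [← Set.ncard_coe_finset]
  refine Set.ncard_le_ncard_of_injOn f ?_ hf.injOn (Finset.finite_toSet _)
  intro d hd
  simp only [Finset.coe_filter, Finset.mem_range, Set.mem_ofPred_eq]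
  refine ⟨?_, h d hd _ ?_ fun i => ?_⟩
  · rw [pow_mul]
    exact Fin.is_lt _
  · simpa using hdigit d 0
  · simpa using hdigit d i.succ

end LatticeReduction

namespace LatticeReduction

/-! ### Distances and integral quadratic forms -/

/-- Squared distance of the lattice vector with coefficients `x` from `t`. -/
def resid {n m : ℕ} (B : Matrix (Fin n) (Fin m) ℤ) (t : Fin m → ℤ) (x : Fin n → ℤ) : ℤ :=
  ∑ j, (t j - Matrix.vecMul x B j) ^ 2

section Resid
variable {n m : ℕ} (B : Matrix (Fin n) (Fin m) ℤ) (t : Fin m → ℤ)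

theorem resid_nonneg (x : Fin n → ℤ) : 0 ≤ resid B t x :=
  Finset.sum_nonneg fun _ _ => sq_nonneg _

theorem natAbs_le_of_resid_le {x : Fin n → ℤ} {N : ℕ} (h : resid B t x ≤ N) (j : Fin m) :
    |t j - Matrix.vecMul x B j| ≤ N := by
  have h1 : (t j - Matrix.vecMul x B j) ^ 2 ≤ resid B t x :=
    Finset.single_le_sum (f := fun j => (t j - Matrix.vecMul x B j) ^ 2)
      (fun _ _ => sq_nonneg _) (Finset.mem_univ j)
  have h2 := Int.le_self_sq |t j - Matrix.vecMul x B j|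
  rw [sq_abs] at h2
  linarith

/-- Stewart's identity for the points x, x + iu, x + cu on a line; dropping the term with `resid B 0
u` leaves the convexity of the squared distance. -/
theorem resid_ray (x u : Fin n → ℤ) (c i : ℤ) :
    c * resid B t (x + i • u) + i * c * (c - i) * resid B 0 u =
      (c - i) * resid B t x + i * resid B t (x + c • u) := by
  simp only [resid, Finset.mul_sum, ← Finset.sum_add_distrib]
  refine Finset.sum_congr rfl fun j _ => ?_
  simp only [Matrix.add_vecMul, Matrix.smul_vecMul, Pi.add_apply, Pi.smul_apply, Pi.zero_apply,
    smul_eq_mul]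
  ring

/-- The parallelogram law around t - xB. -/
theorem resid_add_sub (x v : Fin n → ℤ) :
    resid B t (x + v) + resid B t (x - v) = 2 * resid B t x + 2 * resid B 0 v := by
  simp only [resid, Finset.mul_sum, ← Finset.sum_add_distrib]
  refine Finset.sum_congr rfl fun j _ => ?_
  simp only [Matrix.add_vecMul, Matrix.sub_vecMul, Pi.add_apply, Pi.sub_apply, Pi.zero_apply]
  ring

theorem resid_zero_smul (c : ℤ) (u : Fin n → ℤ) : resid B 0 (c • u) = c ^ 2 * resid B 0 u := by
  simp only [resid, Finset.mul_sum]
  refine Finset.sum_congr rfl fun j _ => ?_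
  simp only [Matrix.smul_vecMul, Pi.smul_apply, Pi.zero_apply, smul_eq_mul]
  ring

variable {B t}

theorem resid_eq_zero {x : Fin n → ℤ} (h : resid B 0 x = 0) : Matrix.vecMul x B = 0 := by
  funext j
  have := (Finset.sum_eq_zero_iff_of_nonneg fun j _ =>
    sq_nonneg ((0 : Fin m → ℤ) j - Matrix.vecMul x B j)).1 h j (Finset.mem_univ j)
  simpa using this

/-- The rows of the matrix are independent over the integers. -/
def RowsIndep (B : Matrix (Fin n) (Fin m) ℤ) : Prop := ∀ x, Matrix.vecMul x B = 0 → x = 0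

theorem RowsIndep.injective (hB : RowsIndep B) : Function.Injective fun x => Matrix.vecMul x B :=
  fun x y h => sub_eq_zero.1 (hB _ (by
    rw [Matrix.sub_vecMul]
    exact sub_eq_zero.2 h))

/-- A singular integral Gram matrix has a nonzero integral kernel vector w, and then ‖wB‖² = wGwᵀ =
0. -/
theorem RowsIndep.det_ne_zero (hB : RowsIndep B) : (B * B.transpose).det ≠ 0 := by
  intro h
  obtain ⟨w, hw, h0⟩ := Matrix.exists_mulVec_eq_zero_iff.2 h
  refine hw (hB w (resid_eq_zero ?_))
  have h1 : resid B 0 w = w ⬝ᵥ (B * B.transpose).mulVec w := by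
    rw [← Matrix.mulVec_mulVec, Matrix.dotProduct_mulVec, Matrix.mulVec_transpose]
    exact Finset.sum_congr rfl fun j _ => by simp [sq]
  rw [h1, h0, dotProduct_zero]

/-- For an integral vector every coordinate is bounded by the squared norm, so the points embed into
a box. -/
theorem RowsIndep.finite_card (hB : RowsIndep B) (t : Fin m → ℤ) (N : ℕ) :
    {x | resid B t x ≤ N}.Finite ∧ {x | resid B t x ≤ N}.ncard ≤ (2 * N + 1) ^ m := by
  let f : (Fin n → ℤ) → Fin m → ℤ := fun x => t - Matrix.vecMul x B
  have hf : Function.Injective f := fun x y h => hB.injective (sub_right_injective h)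
  let box : Finset (Fin m → ℤ) := Fintype.piFinset fun _ => Finset.Icc (-(N : ℤ)) N
  have hmaps : ∀ x ∈ {x | resid B t x ≤ N}, f x ∈ (box : Set (Fin m → ℤ)) := by
    intro x hx
    simp only [box, Finset.mem_coe, Fintype.mem_piFinset, Finset.mem_Icc]
    intro j
    exact abs_le.1 (natAbs_le_of_resid_le B t hx j)
  have hbox : (box : Set (Fin m → ℤ)).ncard = (2 * N + 1) ^ m := by
    rw [Set.ncard_coe_finset, Fintype.card_piFinset_const, Int.card_Icc]
    congr 1
    omega
  exact ⟨Set.Finite.of_injOn hmaps hf.injOn box.finite_toSet,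
    hbox ▸ Set.ncard_le_ncard_of_injOn f hmaps hf.injOn box.finite_toSet⟩

end Resid

theorem exists_min_of_nonneg {α : Type*} {p : α → Prop} (hp : ∃ x, p x) {h : α → ℤ}
    (h0 : ∀ x, 0 ≤ h x) : ∃ x, p x ∧ ∀ y, p y → h x ≤ h y := by
  classical
  have hex : ∃ k : ℕ, ∃ x, p x ∧ h x = k := by
    obtain ⟨x, hx⟩ := hp
    exact ⟨(h x).toNat, x, hx, (Int.toNat_of_nonneg (h0 x)).symm⟩
  obtain ⟨x, hx, hk⟩ := Nat.find_spec hex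
  refine ⟨x, hx, fun y hy => ?_⟩
  have := Nat.find_min' hex ⟨y, hy, (Int.toNat_of_nonneg (h0 y)).symm⟩
  have := Int.toNat_of_nonneg (h0 y)
  omega

/-! ### The problem in integral coordinates -/

/-- Multiplication by `D` makes the basis of `I` the matrix `B` and the target `t`. -/
structure Scaled (I : CVPInput) (D : ℕ) (B : Matrix (Fin I.n) (Fin I.m) ℤ) (t : Fin I.m → ℤ) :
    Prop where
  pos : 0 < D
  basis_eq : ∀ i j, (B i j : ℚ) = D * I.basis i j
  target_eq : ∀ j, (t j : ℚ) = D * I.target j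

namespace Scaled
variable {I : CVPInput} {D : ℕ} {B : Matrix (Fin I.n) (Fin I.m) ℤ} {t : Fin I.m → ℤ}

theorem mem_lattice (h : Scaled I D B t) (p : EuclideanSpace ℝ (Fin I.m)) :
    p ∈ I.lattice ↔ ∃ x : Fin I.n → ℤ, ∀ j, (D : ℝ) * p j = (Matrix.vecMul x B j : ℤ) := by
  have hD : (D : ℝ) ≠ 0 := Nat.cast_ne_zero.2 h.pos.ne'
  have hb : ∀ i j, (B i j : ℝ) = D * (I.basis i j : ℝ) := fun i j => by
    exact_mod_cast congrArg (fun q : ℚ => (q : ℝ)) (h.basis_eq i j)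
  have hsum : ∀ (x : Fin I.n → ℤ) j, (D : ℝ) * (∑ i, x i • toEuclidean (I.basis i)) j =
      (Matrix.vecMul x B j : ℤ) := by
    intro x j
    have : (∑ i, x i • toEuclidean (I.basis i)) j = ∑ i, (x i : ℝ) * (I.basis i j : ℝ) := by
      rw [WithLp.ofLp_sum, Finset.sum_apply]
      refine Finset.sum_congr rfl fun i _ => ?_
      rw [WithLp.ofLp_smul, Pi.smul_apply, zsmul_eq_mul]
      rfl
    rw [this, Finset.mul_sum]
    simp only [Matrix.vecMul, dotProduct]
    push_cast
    refine Finset.sum_congr rfl fun i _ => ?_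
    rw [hb]
    ring
  rw [CVPInput.lattice, Submodule.mem_span_range_iff_exists_fun]
  constructor
  · rintro ⟨x, rfl⟩
    exact ⟨x, hsum x⟩
  · rintro ⟨x, hx⟩
    refine ⟨x, ?_⟩
    ext j
    exact mul_left_cancel₀ hD ((hsum x j).trans (hx j).symm)

theorem rowsIndep (h : Scaled I D B t) : RowsIndep B := by
  intro x hx
  have hD : (D : ℝ) ≠ 0 := Nat.cast_ne_zero.2 h.pos.ne'
  have hb : ∀ i j, (B i j : ℝ) = D * (I.basis i j : ℝ) := fun i j => by
    exact_mod_cast congrArg (fun q : ℚ => (q : ℝ)) (h.basis_eq i j)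
  have hz : ∑ i, (x i : ℝ) • toEuclidean (I.basis i) = 0 := by
    ext j
    have hj := congrArg (fun z : ℤ => (z : ℝ)) (congrFun hx j)
    simp only [Matrix.vecMul, dotProduct] at hj
    push_cast at hj
    rw [WithLp.ofLp_sum, Finset.sum_apply]
    refine mul_left_cancel₀ hD ?_
    rw [Finset.mul_sum]
    refine Eq.trans (Finset.sum_congr rfl fun i _ => ?_) (hj.trans (by simp))
    rw [hb, WithLp.ofLp_smul, Pi.smul_apply, smul_eq_mul]
    change (D : ℝ) * ((x i : ℝ) * (I.basis i j : ℝ)) = _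
    ring
  have := Fintype.linearIndependent_iff.1 I.linearIndependent _ hz
  funext i
  exact_mod_cast this i

theorem norm_sub_eq (h : Scaled I D B t) {p : EuclideanSpace ℝ (Fin I.m)} {x : Fin I.n → ℤ}
    (hx : ∀ j, (D : ℝ) * p j = (Matrix.vecMul x B j : ℤ)) :
    (D : ℝ) * ‖toEuclidean I.target - p‖ = √(resid B t x : ℝ) := by
  have ht : ∀ j, (t j : ℝ) = D * (I.target j : ℝ) := fun j => by
    exact_mod_cast congrArg (fun q : ℚ => (q : ℝ)) (h.target_eq j)
  rw [eq_comm, Real.sqrt_eq_iff_mul_self_eq (by exact_mod_cast resid_nonneg B t x) (by positivity),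
    ← sq, mul_pow, EuclideanSpace.real_norm_sq_eq, Finset.mul_sum]
  simp only [resid]
  push_cast
  refine Finset.sum_congr rfl fun j _ => ?_
  rw [← hx j, ht j, PiLp.sub_apply]
  change _ = (D : ℝ) ^ 2 * ((I.target j : ℝ) - p j) ^ 2
  ring

theorem norm_eq (h : Scaled I D B t) {p : EuclideanSpace ℝ (Fin I.m)} {x : Fin I.n → ℤ}
    (hx : ∀ j, (D : ℝ) * p j = (Matrix.vecMul x B j : ℤ)) :
    (D : ℝ) * ‖p‖ = √(resid B 0 x : ℝ) := by
  have hD : (D : ℝ) ≠ 0 := Nat.cast_ne_zero.2 h.pos.ne'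
  rw [eq_comm, Real.sqrt_eq_iff_mul_self_eq (by exact_mod_cast resid_nonneg B 0 x) (by positivity),
    ← sq, mul_pow, EuclideanSpace.real_norm_sq_eq, Finset.mul_sum]
  simp only [resid]
  push_cast
  refine Finset.sum_congr rfl fun j _ => ?_
  rw [← hx j]
  simp [mul_pow]

/-- The lattice point with given coefficients. -/
theorem exists_point (h : Scaled I D B t) (x : Fin I.n → ℤ) :
    ∃ p : EuclideanSpace ℝ (Fin I.m), ∀ j, (D : ℝ) * p j = (Matrix.vecMul x B j : ℤ) := by
  have hD : (D : ℝ) ≠ 0 := Nat.cast_ne_zero.2 h.pos.ne'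
  refine ⟨WithLp.toLp 2 fun j => ((Matrix.vecMul x B j : ℤ) : ℝ) / D, fun j => ?_⟩
  change (D : ℝ) * (((Matrix.vecMul x B j : ℤ) : ℝ) / D) = _
  field_simp

theorem targetDist_eq (h : Scaled I D B t) {x : Fin I.n → ℤ}
    (hx : ∀ y, resid B t x ≤ resid B t y) :
    (D : ℝ) * I.targetDist = √(resid B t x : ℝ) := by
  have hD : (0 : ℝ) < D := Nat.cast_pos.2 h.pos
  refine le_antisymm ?_ ?_
  · obtain ⟨p, hp⟩ := h.exists_point x
    rw [← h.norm_sub_eq hp]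
    refine mul_le_mul_of_nonneg_left ?_ hD.le
    rw [← dist_eq_norm]
    exact Metric.infDist_le_dist_of_mem ((h.mem_lattice p).2 ⟨x, hp⟩)
  · rw [← div_le_iff₀' hD]
    refine (Metric.le_infDist ⟨0, I.lattice.zero_mem⟩).2 fun {p} hp => ?_
    obtain ⟨y, hy⟩ := (h.mem_lattice p).1 hp
    rw [div_le_iff₀' hD, dist_eq_norm, h.norm_sub_eq hy]
    exact Real.sqrt_le_sqrt (by exact_mod_cast hx y)

/-- Squared lengths are integers after scaling, so the infimum is attained; this preserves the
strict inequality that the promise needs. -/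
theorem lt_lambdaOne (h : Scaled I D B t) {M : ℝ} (hM : ∀ y ≠ 0, M < resid B 0 y) (hM0 : 0 ≤ M) :
    √M < D * lambdaOne I.lattice := by
  have hD : (0 : ℝ) < D := Nat.cast_pos.2 h.pos
  have hne : ∃ x : Fin I.n → ℤ, x ≠ 0 :=
    ⟨fun _ => 1, fun h0 => by simpa using congrFun h0 ⟨0, I.n_pos⟩⟩
  obtain ⟨x, hx, hmin⟩ := exists_min_of_nonneg hne (resid_nonneg B 0)
  have hle : √(resid B 0 x : ℝ) / D ≤ lambdaOne I.lattice := by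
    obtain ⟨p, hp⟩ := h.exists_point x
    refine le_csInf ⟨‖p‖, p, (h.mem_lattice p).2 ⟨x, hp⟩, ?_, rfl⟩ ?_
    · rintro rfl
      refine hx (h.rowsIndep x (funext fun j => ?_))
      have := hp j
      simp only [PiLp.zero_apply, mul_zero] at this
      exact_mod_cast this.symm
    · rintro r ⟨q, hq, hq0, rfl⟩
      obtain ⟨y, hy⟩ := (h.mem_lattice q).1 hq
      rw [div_le_iff₀' hD, h.norm_eq hy]
      have hy0 : y ≠ 0 → (resid B 0 x : ℝ) ≤ resid B 0 y := fun h => by exact_mod_cast hmin y h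
      refine Real.sqrt_le_sqrt (hy0 ?_)
      rintro rfl
      refine hq0 ?_
      ext j
      have := hy j
      simp only [Matrix.zero_vecMul, Pi.zero_apply, Int.cast_zero, mul_eq_zero, hD.ne',
        false_or] at this
      exact this
  rw [div_le_iff₀' hD] at hle
  exact (Real.sqrt_lt_sqrt hM0 (hM x hx)).trans_le hle

/-- An output is acceptable if its integral coordinates are. -/
theorem isApproxClosest (h : Scaled I D B t) {x y : Fin I.n → ℤ} {v : Fin I.m → ℚ} {a : ℝ}
    (ha : 0 ≤ a) (hx : ∀ y, resid B t x ≤ resid B t y)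
    (hv : ∀ j, (D : ℚ) * v j = (Matrix.vecMul y B j : ℤ))
    (hy : (resid B t y : ℝ) ≤ a ^ 2 * resid B t x) :
    I.IsApproxClosest a (Data.ofVec v) := by
  have hD : (0 : ℝ) < D := Nat.cast_pos.2 h.pos
  have hv' : ∀ j, (D : ℝ) * toEuclidean v j = (Matrix.vecMul y B j : ℤ) := fun j => by
    change (D : ℝ) * ((v j : ℚ) : ℝ) = _
    exact_mod_cast congrArg (fun q : ℚ => (q : ℝ)) (hv j)
  refine ⟨v, rfl, (h.mem_lattice _).2 ⟨y, hv'⟩, le_of_mul_le_mul_left ?_ hD⟩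
  rw [h.norm_sub_eq hv', mul_left_comm, h.targetDist_eq hx]
  rw [← Real.sqrt_sq ha, ← Real.sqrt_mul (sq_nonneg a)]
  exact Real.sqrt_le_sqrt hy

/-- The integral coordinates of an acceptable output. -/
theorem exists_of_isApproxClosest (h : Scaled I D B t) {x : Fin I.n → ℤ} {a : ℝ} {d : Data}
    (ha : 0 ≤ a) (hx : ∀ y, resid B t x ≤ resid B t y) (hd : I.IsApproxClosest a d) :
    ∃ (v : Fin I.m → ℚ) (y : Fin I.n → ℤ), d = Data.ofVec v ∧
      (∀ j, (D : ℚ) * v j = (Matrix.vecMul y B j : ℤ)) ∧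
      (resid B t y : ℝ) ≤ a ^ 2 * resid B t x := by
  obtain ⟨v, rfl, hmem, hle⟩ := hd
  obtain ⟨y, hy⟩ := (h.mem_lattice _).1 hmem
  refine ⟨v, y, rfl, fun j => ?_, ?_⟩
  · have := hy j
    change (D : ℝ) * ((v j : ℚ) : ℝ) = _ at this
    exact_mod_cast this
  · have h1 := mul_le_mul_of_nonneg_left hle (Nat.cast_nonneg (α := ℝ) D)
    rw [h.norm_sub_eq hy, mul_left_comm, h.targetDist_eq hx] at h1
    rw [← Real.sqrt_sq ha, ← Real.sqrt_mul (sq_nonneg a)] at h1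
    refine (Real.sqrt_le_sqrt_iff ?_).1 h1
    exact mul_nonneg (sq_nonneg a) (by exact_mod_cast resid_nonneg B t x)

end Scaled

end LatticeReduction

namespace LatticeReduction

open Enc

/-! ### Queries -/

theorem ofVec_eq_enc {m : ℕ} (v : Fin m → ℚ) : Data.ofVec v = enc (List.ofFn v) := by
  simp only [Data.ofVec, enc, List.map_ofFn, Function.comp_def]

theorem encode_eq_enc (I : CVPInput) :
    I.encode = enc (List.ofFn fun i => List.ofFn (I.basis i), List.ofFn I.target) := by
  rw [CVPInput.encode, ofVec_eq_enc]
  simp only [ofVec_eq_enc]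
  change Data.pair _ _ = Data.pair (Data.ofList (List.map enc (List.ofFn _))) _
  rw [List.map_ofFn]
  rfl

/-- The Gram determinant is a nonzero integer, hence a nonzero real number, so independence passes
from ℤ to ℝ and the sparse matrix is a legitimate instance. -/
theorem RowsIndep.linearIndependent {n m : ℕ} {B : Matrix (Fin n) (Fin m) ℤ} (hB : RowsIndep B) :
    LinearIndependent ℝ fun i => toEuclidean fun j => (B i j : ℚ) := by
  rw [Fintype.linearIndependent_iff]
  intro c hc
  let R : Matrix (Fin n) (Fin m) ℝ := B.map (Int.castRingHom ℝ)
  have h1 : Matrix.vecMul c R = 0 := by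
    funext j
    have := congrArg (fun p : EuclideanSpace ℝ (Fin m) => p j) hc
    simp only [WithLp.ofLp_sum, Finset.sum_apply, WithLp.ofLp_smul, Pi.smul_apply] at this
    change ∑ i, c i * R i j = 0
    refine Eq.trans (Finset.sum_congr rfl fun i _ => ?_) this
    simp [R, toEuclidean]
  have h2 : (R * R.transpose).det ≠ 0 := by
    have : R * R.transpose = (B * B.transpose).map (Int.castRingHom ℝ) := by
      rw [Matrix.map_mul, Matrix.transpose_map]
    rw [this, ← RingHom.mapMatrix_apply, ← RingHom.map_det]
    exact Int.cast_ne_zero.2 hB.det_ne_zero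
  have h3 : (R * R.transpose).mulVec c = 0 := by
    rw [← Matrix.mulVec_mulVec, Matrix.mulVec_transpose, h1, Matrix.mulVec_zero]
  exact congrFun (Matrix.eq_zero_of_mulVec_eq_zero h2 h3)

/-- The instance with given integral data. -/
def intInput {n m : ℕ} {B : Matrix (Fin (n + 1)) (Fin m) ℤ} (hB : RowsIndep B) (t : Fin m → ℤ) :
    CVPInput where
  n := n + 1
  m := m
  n_pos := n.succ_pos
  basis i j := B i j
  linearIndependent := hB.linearIndependent
  target j := t j

theorem intInput_scaled {n m : ℕ} {B : Matrix (Fin (n + 1)) (Fin m) ℤ} (hB : RowsIndep B)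
    (t : Fin m → ℤ) : Scaled (intInput hB t) 1 B t :=
  ⟨one_pos, fun i j => by simp [intInput], fun j => by simp [intInput]⟩

theorem encode_intInput {n m : ℕ} {B : Matrix (Fin (n + 1)) (Fin m) ℤ} (hB : RowsIndep B)
    (t : Fin m → ℤ) : (intInput hB t).encode =
      enc ((matL B).map fun r => r.map fun x : ℤ => (x : ℚ),
        (List.ofFn t).map fun x : ℤ => (x : ℚ)) := by
  rw [encode_eq_enc]
  simp only [matL, List.map_ofFn, Function.comp_def]
  rfl

/-- A basis of the sublattice of the vectors whose `linForm` is divisible by `q`. -/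
def sparseM {n m Q : ℕ} (B : Matrix (Fin (n + 1)) (Fin m) ℤ) (q : ℕ) (z : Fin n → Fin Q) :
    Matrix (Fin (n + 1)) (Fin m) ℤ :=
  Fin.cons ((q : ℤ) • B 0) fun i => B i.succ + ((z i : ℕ) : ℤ) • B 0

/-- Coefficients in the original basis of a vector of the sublattice. -/
def liftCoeffs {n Q : ℕ} (q : ℕ) (z : Fin n → Fin Q) (x : Fin (n + 1) → ℤ) : Fin (n + 1) → ℤ :=
  Fin.cons (q * x 0 + ∑ i, ((z i : ℕ) : ℤ) * x i.succ) fun i => x i.succ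

section Sparse
variable {n m Q : ℕ} (B : Matrix (Fin (n + 1)) (Fin m) ℤ) (q : ℕ) (z : Fin n → Fin Q)

theorem vecMul_sparseM (x : Fin (n + 1) → ℤ) :
    Matrix.vecMul x (sparseM B q z) = Matrix.vecMul (liftCoeffs q z x) B := by
  funext j
  simp only [Matrix.vecMul, dotProduct, Fin.sum_univ_succ, sparseM, liftCoeffs, Fin.cons_zero,
    Fin.cons_succ, Pi.smul_apply, Pi.add_apply, smul_eq_mul, mul_add, add_mul, Finset.sum_mul,
    Finset.sum_add_distrib]
  have : ∑ i : Fin n, x i.succ * (((z i : ℕ) : ℤ) * B 0 j) =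
      ∑ i : Fin n, ((z i : ℕ) : ℤ) * x i.succ * B 0 j :=
    Finset.sum_congr rfl fun i _ => by ring
  rw [this]
  ring

theorem linForm_liftCoeffs (x : Fin (n + 1) → ℤ) : linForm z (liftCoeffs q z x) = q * x 0 := by
  simp [linForm, liftCoeffs]

variable {q z}

/-- The coefficient of b₀ in the form is 1, so the defining congruence can be solved for x₀; this is
why the sublattice has such a simple basis. -/
theorem exists_liftCoeffs {x : Fin (n + 1) → ℤ} (h : (q : ℤ) ∣ linForm z x) :
    ∃ y, liftCoeffs q z y = x := by
  obtain ⟨a, ha⟩ := h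
  refine ⟨Fin.cons a fun i => x i.succ, ?_⟩
  funext i
  refine Fin.cases ?_ (fun i => ?_) i
  · simp only [liftCoeffs, Fin.cons_zero, Fin.cons_succ]
    rw [← ha, linForm]
    ring
  · simp [liftCoeffs]

theorem liftCoeffs_ne_zero (hq : 0 < q) {x : Fin (n + 1) → ℤ} (hx : x ≠ 0) :
    liftCoeffs q z x ≠ 0 := by
  intro h
  refine hx (funext fun i => ?_)
  have hs : ∀ i : Fin n, x i.succ = 0 := fun i => by
    simpa [liftCoeffs] using congrFun h i.succ
  refine Fin.cases ?_ hs i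
  have h0 := congrFun h 0
  simp only [liftCoeffs, Fin.cons_zero, hs, mul_zero, Finset.sum_const_zero, add_zero,
    Pi.zero_apply, mul_eq_zero] at h0
  simpa [hq.ne'] using h0

variable {B}

theorem RowsIndep.sparseM (hB : RowsIndep B) (hq : 0 < q) : RowsIndep (sparseM B q z) := by
  intro x hx
  by_contra h
  exact liftCoeffs_ne_zero (z := z) hq h (hB _ (by rwa [vecMul_sparseM] at hx))

theorem vecMul_add_single (x : Fin (n + 1) → ℤ) (c : ℤ) :
    Matrix.vecMul (x + Pi.single 0 c) B = Matrix.vecMul x B + c • B 0 := by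
  rw [Matrix.add_vecMul, Matrix.single_vecMul]
  rfl

theorem resid_sparseM (t : Fin m → ℤ) (c : ℤ) (x : Fin (n + 1) → ℤ) :
    resid (LatticeReduction.sparseM B q z) (t - c • B 0) x =
      resid B t (liftCoeffs q z x + Pi.single 0 c) := by
  simp only [resid, vecMul_sparseM, vecMul_add_single, Pi.sub_apply, Pi.add_apply]
  exact Finset.sum_congr rfl fun j _ => by ring

theorem headD_matL : (matL B).headD [] = List.ofFn (B 0) := by
  simp [matL, List.ofFn_succ]

theorem sparseBasis_matL :
    sparseBasis (matL B) q (List.ofFn fun i => (z i : ℕ)) =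
      matL (LatticeReduction.sparseM B q z) := by
  rw [sparseBasis, headD_matL]
  simp only [matL, List.ofFn_succ (f := fun i => List.ofFn (B i)), List.tail_cons,
    List.ofFn_succ (f := fun i => List.ofFn (LatticeReduction.sparseM B q z i)), zipWith_ofFn,
    subMul_ofFn, List.map_ofFn, Function.comp_def]
  congr 1
  congr 1
  funext i
  congr 1
  funext j
  simp [LatticeReduction.sparseM]

end Sparse

/-! ### Answers -/

theorem readList_ofVec {m : ℕ} {v : Fin m → ℚ} {y : Fin m → ℤ} (h : ∀ j, v j = y j) :
    (Data.ofVec v).readList = List.ofFn y := by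
  have key : ∀ l : List ℤ,
      (Data.ofList ((l.map fun x : ℤ => (x : ℚ)).map Data.ofRat)).readList = l := by
    intro l
    induction l with
    | nil => rfl
    | cons a l ih =>
      simp only [List.map_cons, Data.ofList, Data.readList, ih]
      simp [Data.ofRat, Data.readInt]
  have := key (List.ofFn y)
  simp only [List.map_ofFn, Function.comp_def] at this
  simpa only [Data.ofVec, h] using this

theorem size_ofVec_le {m V : ℕ} {v : Fin m → ℚ} {y : Fin m → ℤ} (h : ∀ j, v j = y j)
    (hy : ∀ j, (y j).natAbs ≤ V) : (Data.ofVec v).size ≤ m * (Nat.size V + 5) + 1 := by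
  rw [ofVec_eq_enc]
  refine (esize_list_le (s := Nat.size V + 4) fun r hr => ?_).trans (by simp)
  obtain ⟨j, rfl⟩ := List.mem_ofFn.1 hr
  have h1 := Nat.size_le_size (hy j)
  rw [h j]
  change ((Data.pair (.int (y j : ℚ).num) (.int ((y j : ℚ).den : ℕ))).size) ≤ _
  simp only [Data.size, Rat.num_intCast, Rat.den_intCast, Nat.cast_one, Int.natAbs_one,
    Nat.size_one]
  omega

/-! ### What a single query yields. -/

section Candidate
variable {n m : ℕ} {B : Matrix (Fin (n + 1)) (Fin m) ℤ} {t : Fin m → ℤ}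

/-- Membership in the lattice needs no assumption on the oracle, so bad queries never spoil the
final minimum. -/
theorem exists_candidate (O : Data → Data) (w k : ℕ) :
    ∃ x, candidate O (matL B) (List.ofFn t) w k = List.ofFn (Matrix.vecMul x B) := by
  rw [candidate, headD_matL, List.length_ofFn]
  obtain ⟨x, hx⟩ := exists_coeffs_eq_ofFn B (reply O (.pair (.int (answerBits (matL B)
    (List.ofFn t))) (enc (queryInput (matL B) (List.ofFn t) w k)))).readList
  refine ⟨x + Pi.single 0 (((coins (matL B) (List.ofFn t) w).headD 0 : ℕ) : ℤ), ?_⟩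
  rw [hx, combine_matL, subMul_ofFn, vecMul_add_single, zero_sub, neg_smul, sub_neg_eq_add]

theorem sqDist_vecMul (x : Fin (n + 1) → ℤ) :
    sqDist (List.ofFn t) (List.ofFn (Matrix.vecMul x B)) = resid B t x := sqDist_ofFn _ _

theorem zero_eq_vecMul : ((List.ofFn t).map fun x => 0 * x) =
    List.ofFn (Matrix.vecMul (0 : Fin (n + 1) → ℤ) B) := by
  rw [List.map_ofFn, Matrix.zero_vecMul]
  congr 1
  funext j
  simp

theorem coins_eq {w : ℕ} {d : Fin (2 ^ coeffBits (List.ofFn t)) ×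
      (Fin n → Fin (2 ^ coeffBits (List.ofFn t)))}
    (h0 : digit (coeffBits (List.ofFn t)) w 0 = d.1)
    (hs : ∀ i : Fin n, digit (coeffBits (List.ofFn t)) w (i + 1) = d.2 i) :
    coins (matL B) (List.ofFn t) w = (d.1 : ℕ) :: List.ofFn fun i => (d.2 i : ℕ) := by
  rw [coins, length_matL, map_range_eq_ofFn, List.ofFn_succ]
  congr 1
  congr 1
  funext i
  rw [← hs i]
  rfl

/-- Good digits put a point of `S` in the coset and keep `T` out of the sublattice, which
establishes the promise. The first alternative is the escape for an answer that is not delivered: it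
can be so long only if the zero vector is at least as near to t. -/
theorem candidate_good (hB : RowsIndep B) {O : Data → Data} {τ a : ℝ} (hτ : 0 < τ) (ha : 0 ≤ a)
    {x₀ : Fin (n + 1) → ℤ} {S T : Finset (Fin (n + 1) → ℤ)}
    (hS : ∀ x ∈ S, (resid B t x : ℝ) ≤ (1 + τ ^ 2) * resid B t x₀)
    (hT : ∀ x ≠ 0, (resid B 0 x : ℝ) ≤ τ ^ 2 * resid B t x₀ → x ∈ T)
    {k : ℕ} {d : Fin (2 ^ coeffBits (List.ofFn t)) ×
      (Fin n → Fin (2 ^ coeffBits (List.ofFn t)))} (hd : GoodDigits S T k d) {w : ℕ}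
    (h0 : digit (coeffBits (List.ofFn t)) w 0 = d.1)
    (hs : ∀ i : Fin n, digit (coeffBits (List.ofFn t)) w (i + 1) = d.2 i)
    (hO : ∀ {C : Matrix (Fin (n + 1)) (Fin m) ℤ} (hC : RowsIndep C) (u : Fin m → ℤ),
      (intInput hC u).targetDist < √(1 + τ⁻¹ ^ 2) * lambdaOne (intInput hC u).lattice →
      (intInput hC u).IsApproxClosest a (O (intInput hC u).encode)) :
    (resid B t 0 : ℝ) ≤ a ^ 2 * ((1 + τ ^ 2) * resid B t x₀) ∨
      (sqDist (List.ofFn t) (candidate O (matL B) (List.ofFn t) w k) : ℝ) ≤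
        a ^ 2 * ((1 + τ ^ 2) * resid B t x₀) := by
  obtain ⟨c, z⟩ := d
  obtain ⟨⟨x, hxS, hx⟩, hshort⟩ := hd
  simp only at h0 hs hx hshort
  have hq : 0 < 2 ^ k := by positivity
  set C := sparseM B (2 ^ k) z with hCdef
  have hC : RowsIndep C := hB.sparseM hq
  set u := t - ((c : ℕ) : ℤ) • B 0 with hu
  have hsc := intInput_scaled hC u
  have hres : ∀ y, resid C u y =
      resid B t (liftCoeffs (2 ^ k) z y + Pi.single 0 ((c : ℕ) : ℤ)) := resid_sparseM t _
  have hF : (0 : ℝ) ≤ resid B t x₀ := by exact_mod_cast resid_nonneg B t x₀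
  obtain ⟨y₀, -, hy₀⟩ := exists_min_of_nonneg (p := fun _ : Fin (n + 1) → ℤ => True) ⟨0, trivial⟩
    (resid_nonneg C u)
  replace hy₀ := fun y => hy₀ y trivial
  have hxlift : ∃ y, liftCoeffs (2 ^ k) z y = x - Pi.single 0 ((c : ℕ) : ℤ) := by
    refine exists_liftCoeffs ?_
    rw [linForm_sub]
    have : linForm z (Pi.single 0 ((c : ℕ) : ℤ)) = ((c : ℕ) : ℤ) := by
      simp [linForm]
    rw [this]
    push_cast
    exact hx
  obtain ⟨y, hy⟩ := hxlift
  have hy0le : (resid C u y₀ : ℝ) ≤ (1 + τ ^ 2) * resid B t x₀ := by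
    refine le_trans ?_ (hS x hxS)
    have := hy₀ y
    rw [hres y, hy, sub_add_cancel] at this
    exact_mod_cast this
  have hlong : ∀ y ≠ 0, τ ^ 2 * resid B t x₀ < resid C 0 y := by
    intro y hy
    by_contra hle
    have h1 : resid C 0 y = resid B 0 (liftCoeffs (2 ^ k) z y) := by
      simp only [resid, hCdef, vecMul_sparseM]
    rw [h1, not_lt] at hle
    refine hshort _ (hT _ (liftCoeffs_ne_zero hq hy) hle) ?_
    rw [linForm_liftCoeffs]
    push_cast
    exact dvd_mul_right _ _
  have hpromise : (intInput hC u).targetDist <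
      √(1 + τ⁻¹ ^ 2) * lambdaOne (intInput hC u).lattice := by
    have h1 := hsc.targetDist_eq hy₀
    have h2 := hsc.lt_lambdaOne hlong (by positivity)
    rw [Nat.cast_one, one_mul] at h1 h2
    rw [h1]
    -- The threshold of the promise arises from (1 + τ²)F = (1 + τ⁻²)·τ²F.
    calc √(resid C u y₀ : ℝ) ≤ √((1 + τ⁻¹ ^ 2) * (τ ^ 2 * resid B t x₀)) := by
          refine Real.sqrt_le_sqrt (hy0le.trans_eq ?_)
          field_simp
          ring
      _ = √(1 + τ⁻¹ ^ 2) * √(τ ^ 2 * resid B t x₀) := Real.sqrt_mul (by positivity) _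
      _ < _ := mul_lt_mul_of_pos_left h2 (Real.sqrt_pos.2 (by positivity))
  obtain ⟨v, y₁, hv, hvint, hle⟩ : ∃ (v : Fin m → ℚ) (y₁ : Fin (n + 1) → ℤ),
      O (intInput hC u).encode = Data.ofVec v ∧ (∀ j, v j = (Matrix.vecMul y₁ C j : ℤ)) ∧
        (resid C u y₁ : ℝ) ≤ a ^ 2 * resid C u y₀ := by
    obtain ⟨v, y₁, hv, hvy, hle⟩ := hsc.exists_of_isApproxClosest ha hy₀ (hO hC u hpromise)
    refine ⟨v, y₁, hv, fun j => ?_, hle⟩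
    have := hvy j
    rwa [Nat.cast_one, one_mul] at this
  replace hle : (resid C u y₁ : ℝ) ≤ a ^ 2 * ((1 + τ ^ 2) * resid B t x₀) :=
    hle.trans (mul_le_mul_of_nonneg_left hy0le (sq_nonneg a))
  have hcoins := coins_eq (B := B) (d := (c, z)) h0 hs
  have hquery : enc (queryInput (matL B) (List.ofFn t) w k) = (intInput hC u).encode := by
    rw [encode_intInput, queryInput, hcoins, headD_matL, List.tail_cons, List.headD_cons,
      sparseBasis_matL, subMul_ofFn]
  by_cases hsize : (O (intInput hC u).encode).size ≤ answerBits (matL B) (List.ofFn t)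
  · right
    have hreply : reply O (.pair (.int (answerBits (matL B) (List.ofFn t)))
        (enc (queryInput (matL B) (List.ofFn t) w k))) = Data.ofVec v := by
      rw [hquery, reply, Int.toNat_natCast, if_pos hsize, hv]
    have hcand : candidate O (matL B) (List.ofFn t) w k = List.ofFn (Matrix.vecMul
        (liftCoeffs (2 ^ k) z y₁ + Pi.single 0 ((c : ℕ) : ℤ)) B) := by
      rw [candidate, hreply, readList_ofVec hvint, hCdef, vecMul_sparseM B (2 ^ k) z y₁,
        coeffs_vecMul hB.det_ne_zero, List.length_ofFn, combine_matL, headD_matL, hcoins,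
        List.headD_cons, subMul_ofFn, vecMul_add_single, zero_sub, neg_smul, sub_neg_eq_add]
    rw [hcand, sqDist_vecMul]
    rwa [hres y₁] at hle
  -- If the answer were nearer to the shifted target than 0 is to t, its coordinates would be at
  -- most 2‖t‖² + 2^K·‖b₀‖² in absolute value, and it would fit into `answerBits`.
  · left
    refine le_trans ?_ hle
    by_contra hlt
    rw [not_le] at hlt
    have hlt : resid C u y₁ < resid B t 0 := by exact_mod_cast hlt
    refine hsize ?_
    rw [hv]
    have ht0 : resid B t 0 = t ⬝ᵥ t := by
      simp only [resid, Matrix.zero_vecMul, Pi.zero_apply, sub_zero, sq, dotProduct]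
    have hself : ∀ (r : Fin m → ℤ) j, |r j| ≤ r ⬝ᵥ r := by
      intro r j
      have h1 : r j * r j ≤ r ⬝ᵥ r := Finset.single_le_sum (f := fun j => r j * r j)
        (fun _ _ => mul_self_nonneg _) (Finset.mem_univ j)
      have h2 := Int.le_self_sq |r j|
      rw [sq_abs, sq] at h2
      exact h2.trans h1
    have hnn : ∀ r : Fin m → ℤ, 0 ≤ r ⬝ᵥ r := fun r =>
      Finset.sum_nonneg fun _ _ => mul_self_nonneg _
    rw [answerBits, List.length_ofFn, headD_matL, dotL_ofFn, dotL_ofFn]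
    refine size_ofVec_le hvint fun j => ?_
    have h1 : |u j - Matrix.vecMul y₁ C j| ≤ t ⬝ᵥ t := by
      have := natAbs_le_of_resid_le C u (N := (t ⬝ᵥ t).toNat) (x := y₁)
        (by rw [Int.toNat_of_nonneg (hnn t), ← ht0]; exact hlt.le) j
      rwa [Int.toNat_of_nonneg (hnn t)] at this
    have h2 : u j = t j - ((c : ℕ) : ℤ) * B 0 j := rfl
    have h3 := hself t j
    have h4 := hself (B 0) j
    have h5 : |((c : ℕ) : ℤ) * B 0 j| ≤ 2 ^ coeffBits (List.ofFn t) * (B 0 ⬝ᵥ B 0) := by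
      rw [abs_mul, Nat.abs_cast]
      have : ((c : ℕ) : ℤ) ≤ 2 ^ coeffBits (List.ofFn t) := by exact_mod_cast c.2.le
      exact mul_le_mul this h4 (abs_nonneg _) (by positivity)
    have h6 : |Matrix.vecMul y₁ C j| ≤ 2 * (t ⬝ᵥ t) +
        2 ^ coeffBits (List.ofFn t) * (B 0 ⬝ᵥ B 0) := by
      rw [h2] at h1
      rw [abs_le] at *
      constructor <;> linarith [h1.1, h1.2, h3.1, h3.2, h5.1, h5.2]
    zify
    rw [abs_of_nonneg (hnn (B 0)), abs_of_nonneg (mul_nonneg zero_le_two (hnn t))]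
    exact h6

end Candidate

end LatticeReduction

namespace LatticeReduction

open Enc

/-! ### Success probability -/

section Success
variable {n m : ℕ} {B : Matrix (Fin (n + 1)) (Fin m) ℤ} {t : Fin m → ℤ}

theorem resid_apply_zero : resid B t 0 = dotL (List.ofFn t) (List.ofFn t) := by
  rw [dotL_ofFn]
  simp only [resid, Matrix.zero_vecMul, Pi.zero_apply, sub_zero, sq, dotProduct]

/-- A ball around t that contains x and x + cu contains the points x + iu between them. -/
theorem rayClosed_sub {S : Finset (Fin (n + 1) → ℤ)} {M : ℝ}
    (hS : ∀ x, x ∈ S ↔ (resid B t x : ℝ) ≤ M) {x : Fin (n + 1) → ℤ} (hx : x ∈ S) :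
    RayClosed ((S.erase x).image fun y => y - x) := by
  have hmem : ∀ v, v ∈ (S.erase x).image (fun y => y - x) ↔ v ≠ 0 ∧ x + v ∈ S := by
    intro v
    simp only [Finset.mem_image, Finset.mem_erase]
    constructor
    · rintro ⟨y, ⟨hyx, hy⟩, rfl⟩
      exact ⟨sub_ne_zero.2 hyx, by rwa [add_sub_cancel]⟩
    · rintro ⟨hv, h⟩
      exact ⟨x + v, ⟨fun h => hv (by simpa using h), h⟩, add_sub_cancel_left x v⟩
  refine ⟨fun h => ((hmem 0).1 h).1 rfl, fun u c i hi hic h => ?_⟩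
  rw [hmem] at h ⊢
  refine ⟨smul_ne_zero hi.ne' fun hu => h.1 (by rw [hu, smul_zero]), ?_⟩
  have h1 := (hS _).1 hx
  have h2 := (hS _).1 h.2
  rw [hS]
  have h3 : (c : ℝ) * resid B t (x + i • u) + i * c * (c - i) * resid B 0 u =
      (c - i) * resid B t x + i * resid B t (x + c • u) := by
    exact_mod_cast congrArg (fun z : ℤ => (z : ℝ)) (resid_ray B t x u c i)
  have h4 : (0 : ℝ) ≤ resid B 0 u := by exact_mod_cast resid_nonneg B 0 u
  have hi' : (0 : ℝ) < i := by exact_mod_cast hi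
  have hic' : (i : ℝ) ≤ c := by exact_mod_cast hic
  have hc : (0 : ℝ) < c := hi'.trans_le hic'
  have h5 : 0 ≤ (i : ℝ) * c * (c - i) * resid B 0 u :=
    mul_nonneg (mul_nonneg (mul_nonneg hi'.le hc.le) (sub_nonneg.2 hic')) h4
  refine le_of_mul_le_mul_left ?_ hc
  linarith [mul_le_mul_of_nonneg_left h1 (sub_nonneg.2 hic'), mul_le_mul_of_nonneg_left h2 hi'.le]

theorem rayClosed_short {T : Finset (Fin (n + 1) → ℤ)} {M : ℝ}
    (hT : ∀ x, x ∈ T ↔ x ≠ 0 ∧ (resid B 0 x : ℝ) ≤ M) : RayClosed T := by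
  refine ⟨fun h => ((hT 0).1 h).1 rfl, fun u c i hi hic h => ?_⟩
  rw [hT] at h ⊢
  refine ⟨smul_ne_zero hi.ne' fun hu => h.1 (by rw [hu, smul_zero]), le_trans ?_ h.2⟩
  rw [resid_zero_smul, resid_zero_smul]
  exact_mod_cast mul_le_mul_of_nonneg_right (pow_le_pow_left₀ hi.le hic 2) (resid_nonneg B 0 u)

/-- The hypothesis that 0 is no nearer than the threshold places `S` in the ball of radius ‖t‖
around t, so that |S| ≤ (2‖t‖² + 1)^m. This is the origin of the number of bits in `coeffBits`. -/
theorem exists_good_level (hB : RowsIndep B) (τ : ℝ) (x₀ : Fin (n + 1) → ℤ)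
    (h0 : (1 + τ ^ 2) * resid B t x₀ ≤ resid B t 0) :
    ∃ S T : Finset (Fin (n + 1) → ℤ),
      (∀ x ∈ S, (resid B t x : ℝ) ≤ (1 + τ ^ 2) * resid B t x₀) ∧
      (∀ x ≠ 0, (resid B 0 x : ℝ) ≤ τ ^ 2 * resid B t x₀ → x ∈ T) ∧
      ∃ k ≤ coeffBits (List.ofFn t), (2 ^ coeffBits (List.ofFn t)) ^ (n + 1) ≤
        24 * (coeffBits (List.ofFn t) + 1) *
          {d : Fin (2 ^ coeffBits (List.ofFn t)) × (Fin n → Fin (2 ^ coeffBits (List.ofFn t))) |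
            GoodDigits S T k d}.ncard := by
  classical
  have hF : (0 : ℝ) ≤ resid B t x₀ := by exact_mod_cast resid_nonneg B t x₀
  set N := (dotL (List.ofFn t) (List.ofFn t)).natAbs with hN
  have hN0 : resid B t 0 = N := by
    rw [hN, ← resid_apply_zero (B := B), Int.natAbs_of_nonneg (resid_nonneg B t 0)]
  rw [hN0, Int.cast_natCast] at h0
  obtain ⟨hfin, hcard⟩ := hB.finite_card t N
  have hsub : {x | (resid B t x : ℝ) ≤ (1 + τ ^ 2) * resid B t x₀} ⊆ {x | resid B t x ≤ N} :=
    fun x hx => by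
      have : (resid B t x : ℝ) ≤ N := le_trans hx h0
      exact_mod_cast this
  have hTfin : {x | x ≠ 0 ∧ (resid B 0 x : ℝ) ≤ τ ^ 2 * resid B t x₀}.Finite :=
    (hB.finite_card 0 N).1.subset fun x hx => by
      have : (resid B 0 x : ℝ) ≤ N := by linarith [hx.2]
      exact_mod_cast this
  let S := (hfin.subset hsub).toFinset
  let T := hTfin.toFinset
  have hS : ∀ x, x ∈ S ↔ (resid B t x : ℝ) ≤ (1 + τ ^ 2) * resid B t x₀ := fun x => by simp [S]
  have hT : ∀ x, x ∈ T ↔ x ≠ 0 ∧ (resid B 0 x : ℝ) ≤ τ ^ 2 * resid B t x₀ := fun x => by simp [T]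
  have hx₀ : x₀ ∈ S := (hS x₀).2 (le_mul_of_one_le_left hF (by nlinarith))
  have hSE : S.card ≤ 2 ^ (m * Nat.size (2 * N + 1)) := by
    calc S.card = {x | (resid B t x : ℝ) ≤ (1 + τ ^ 2) * resid B t x₀}.ncard :=
          (Set.ncard_eq_toFinset_card _ _).symm
      _ ≤ (2 * N + 1) ^ m := (Set.ncard_le_ncard hsub hfin).trans hcard
      _ ≤ (2 ^ Nat.size (2 * N + 1)) ^ m := Nat.pow_le_pow_left (Nat.lt_size_self _).le m
      _ = _ := by rw [← pow_mul, mul_comm]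
  have hTS : T.card ≤ 2 * S.card := by
    -- By the parallelogram law around the point `x₀`, at least one of x₀ + v and x₀ - v lies in
    -- `S`.
    have hcover : T ⊆ (S.image fun y => y - x₀) ∪ S.image fun y => x₀ - y := by
      intro v hv
      have h1 : (resid B t (x₀ + v) : ℝ) + resid B t (x₀ - v) =
          2 * resid B t x₀ + 2 * resid B 0 v := by
        exact_mod_cast congrArg (fun z : ℤ => (z : ℝ)) (resid_add_sub B t x₀ v)
      have h2 := ((hT v).1 hv).2
      rw [Finset.mem_union, Finset.mem_image, Finset.mem_image]
      by_cases h3 : x₀ + v ∈ S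
      · exact Or.inl ⟨_, h3, add_sub_cancel_left _ _⟩
      · refine Or.inr ⟨x₀ - v, (hS _).2 ?_, sub_sub_cancel _ _⟩
        rw [hS, not_le] at h3
        linarith
    refine (Finset.card_le_card hcover).trans ((Finset.card_union_le _ _).trans ?_)
    rw [two_mul]
    exact Nat.add_le_add Finset.card_image_le Finset.card_image_le
  refine ⟨S, T, fun x => (hS x).1, fun x h1 h2 => (hT x).2 ⟨h1, h2⟩, ?_⟩
  have hK : coeffBits (List.ofFn t) = 2 * (m * Nat.size (2 * N + 1)) + 10 := by
    rw [coeffBits, List.length_ofFn]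
  rw [hK]
  exact exists_level_card_ge ⟨x₀, hx₀⟩ hSE (fun x => rayClosed_sub hS) (rayClosed_short hT) hTS

variable (B t) in
theorem exists_bestCandidate (O : Data → Data) (w : ℕ) :
    ∃ x, bestCandidate O (matL B) (List.ofFn t) w = List.ofFn (Matrix.vecMul x B) := by
  have h := bestOf_mem (sqDist (List.ofFn t)) ((List.ofFn t).map fun x => 0 * x)
    ((List.range (coeffBits (List.ofFn t) + 1)).map fun k =>
      candidate O (matL B) (List.ofFn t) w k)
  rcases List.mem_cons.1 h with h | h
  · exact ⟨0, h.trans zero_eq_vecMul⟩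
  · obtain ⟨k, -, hk⟩ := List.mem_map.1 h
    obtain ⟨x, hx⟩ := exists_candidate (B := B) (t := t) O w k
    exact ⟨x, hk.symm.trans hx⟩

variable (B t) in
theorem exists_searchClosest (O : Data → Data) (R : ℕ) :
    ∃ x, searchClosest O (matL B) (List.ofFn t) R = List.ofFn (Matrix.vecMul x B) := by
  have h := bestOf_mem (sqDist (List.ofFn t)) ((List.ofFn t).map fun x => 0 * x)
    ((List.range (48 * (coeffBits (List.ofFn t) + 1))).map fun j =>
      bestCandidate O (matL B) (List.ofFn t)
        (digit (coeffBits (List.ofFn t) * (matL B).length) R j))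
  rcases List.mem_cons.1 h with h | h
  · exact ⟨0, h.trans zero_eq_vecMul⟩
  · obtain ⟨j, -, hj⟩ := List.mem_map.1 h
    obtain ⟨x, hx⟩ := exists_bestCandidate B t O
      (digit (coeffBits (List.ofFn t) * (matL B).length) R j)
    exact ⟨x, hj.symm.trans hx⟩

/-- Either 0 meets the bound, and then every run does, or a ≥ 1 gives the hypothesis of
`exists_good_level`, and a single good trial at a single good level suffices since the nearest
candidate is kept. -/
theorem card_searchClosest_ge (hB : RowsIndep B) {O : Data → Data} {τ a : ℝ} (hτ : 0 < τ)
    (ha : 1 ≤ a) (x₀ : Fin (n + 1) → ℤ)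
    (hO : ∀ {C : Matrix (Fin (n + 1)) (Fin m) ℤ} (hC : RowsIndep C) (u : Fin m → ℤ),
      (intInput hC u).targetDist < √(1 + τ⁻¹ ^ 2) * lambdaOne (intInput hC u).lattice →
      (intInput hC u).IsApproxClosest a (O (intInput hC u).encode)) {b : ℕ}
    (hb : coeffBits (List.ofFn t) * (n + 1) * (48 * (coeffBits (List.ofFn t) + 1)) ≤ b)
    (P : ℕ → Prop) [DecidablePred P]
    (hP : ∀ R, (sqDist (List.ofFn t) (searchClosest O (matL B) (List.ofFn t) R) : ℝ) ≤
      a ^ 2 * ((1 + τ ^ 2) * resid B t x₀) → P R) :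
    (2 / 3 : ℝ) * 2 ^ b ≤ ((Finset.range (2 ^ b)).filter P).card := by
  classical
  have hF : (0 : ℝ) ≤ resid B t x₀ := by exact_mod_cast resid_nonneg B t x₀
  by_cases h0 : (resid B t 0 : ℝ) ≤ a ^ 2 * ((1 + τ ^ 2) * resid B t x₀)
  · rw [Finset.filter_true_of_mem fun R _ => hP R (le_trans ?_ h0), Finset.card_range]
    · push_cast
      have : (0 : ℝ) < 2 ^ b := by positivity
      linarith
    · rw [← sqDist_vecMul, ← zero_eq_vecMul]
      exact_mod_cast bestOf_le _ List.mem_cons_self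
  have h1 : (1 + τ ^ 2) * resid B t x₀ ≤ resid B t 0 :=
    (le_mul_of_one_le_left (by positivity) (one_le_pow₀ ha)).trans (not_le.1 h0).le
  obtain ⟨S, T, hS, hT, k, hk, hcount⟩ := exists_good_level hB τ x₀ h1
  let Q : ℕ → Prop := fun w => (sqDist (List.ofFn t) (bestCandidate O (matL B) (List.ofFn t) w) : ℝ)
    ≤ a ^ 2 * ((1 + τ ^ 2) * resid B t x₀)
  have hQ : ∀ d : Fin (2 ^ coeffBits (List.ofFn t)) × (Fin n → Fin (2 ^ coeffBits (List.ofFn t))),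
      GoodDigits S T k d → ∀ w, digit (coeffBits (List.ofFn t)) w 0 = d.1 →
      (∀ i : Fin n, digit (coeffBits (List.ofFn t)) w (i + 1) = d.2 i) → Q w := by
    intro d hd w hw0 hws
    have := candidate_good hB hτ (zero_le_one.trans ha) hS hT hd hw0 hws hO
    refine le_trans ?_ (this.resolve_left h0)
    exact_mod_cast bestOf_le _ (List.mem_cons_of_mem _ (List.mem_map.2
      ⟨k, List.mem_range.2 (Nat.lt_succ_of_le hk), rfl⟩))
  have h2 := card_exists_digit_ge (coeffBits (List.ofFn t) * (n + 1)) (coeffBits (List.ofFn t)) b Q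
    ((pow_mul 2 _ _).trans_le (hcount.trans (Nat.mul_le_mul_left _ (card_digits_ge _ Q hQ)))) hb
  refine h2.trans (Nat.cast_le.2 (Finset.card_le_card ?_))
  refine Finset.monotone_filter_right _ fun R _ hR => ?_
  obtain ⟨j, hj, hR⟩ := hR
  refine hP R (le_trans ?_ hR)
  refine Int.cast_le.2 (bestOf_le _ (List.mem_cons_of_mem _ (List.mem_map.2
    ⟨j, List.mem_range.2 hj, ?_⟩)))
  rw [length_matL]

end Success

/-! ### Rational instances -/

/-- The product of all denominators serves as common denominator; it is far from minimal, but its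
length is polynomial. -/
theorem exists_scaled (I : CVPInput) (x : List (List ℚ) × List ℚ)
    (hx : x = (List.ofFn fun i => List.ofFn (I.basis i), List.ofFn I.target)) :
    ∃ (B : Matrix (Fin I.n) (Fin I.m) ℤ) (t : Fin I.m → ℤ), Scaled I (commonDen x) B t ∧
      intBasis x = matL B ∧ intTarget x = List.ofFn t := by
  have hentry : ∀ {D : ℕ} {c : ℚ}, c.den ∣ D →
      ((c.num * ((D / c.den : ℕ) : ℤ) : ℤ) : ℚ) = D * c := by
    rintro D c ⟨e, rfl⟩
    rw [Nat.mul_div_cancel_left _ c.den_pos]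
    push_cast
    rw [mul_right_comm, Rat.den_mul_eq_num, mul_comm]
  have hpos : ∀ l : List ℚ, 0 < (l.map fun c : ℚ => c.den).prod := fun l =>
    List.prod_pos fun d hd => by
      obtain ⟨c, -, rfl⟩ := List.mem_map.1 hd
      exact c.den_pos
  refine ⟨fun i j => (I.basis i j).num * ((commonDen x / (I.basis i j).den : ℕ) : ℤ),
    fun j => (I.target j).num * ((commonDen x / (I.target j).den : ℕ) : ℤ),
    ⟨?_, fun i j => hentry ?_, fun j => hentry ?_⟩, ?_, ?_⟩
  · refine Nat.mul_pos (List.prod_pos fun d hd => ?_) (hpos _)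
    obtain ⟨c, -, rfl⟩ := List.mem_map.1 hd
    exact hpos c
  · refine Dvd.dvd.mul_right ?_ _
    refine dvd_trans (List.dvd_prod (List.mem_map.2 ⟨I.basis i j, ?_, rfl⟩))
      (List.dvd_prod (List.mem_map.2 ⟨List.ofFn (I.basis i), ?_, rfl⟩))
    · exact List.mem_ofFn.2 ⟨j, rfl⟩
    · rw [hx]
      exact List.mem_ofFn.2 ⟨i, rfl⟩
  · refine Dvd.dvd.mul_left (List.dvd_prod (List.mem_map.2 ⟨I.target j, ?_, rfl⟩)) _
    rw [hx]
    exact List.mem_ofFn.2 ⟨j, rfl⟩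
  · rw [intBasis, hx]
    simp only [clearDen, List.map_ofFn, matL, Function.comp_def]
  · rw [intTarget, hx]
    simp only [clearDen, List.map_ofFn, Function.comp_def]

end LatticeReduction

/-! ### Assembly of the randomized program. -/

namespace LatticeReduction

open Polynomial Enc

/-- The lists that encode an instance. -/
def CVPInput.toLists (I : CVPInput) : List (List ℚ) × List ℚ :=
  (List.ofFn fun i => List.ofFn (I.basis i), List.ofFn I.target)

/-- Number of random bits used on an instance. -/
def randomBits (x : List (List ℚ) × List ℚ) : ℕ :=
  coeffBits (intTarget x) * (intBasis x).length * (48 * (coeffBits (intTarget x) + 1))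

theorem smallVal_randomBits : SmallVal fun _ x => randomBits x := by
  have hB : PolyTime fun _ (x : List (List ℚ) × List ℚ) => intBasis x := PolyTime.id.intBasis
  have ht : PolyTime fun _ (x : List (List ℚ) × List ℚ) => intTarget x := PolyTime.id.intTarget
  exact ((SmallVal.coeffBits ht).mul (.length hB)).mul
    ((SmallVal.const 48).mul ((SmallVal.coeffBits ht).add (.const 1)))

/-- The oracle is assumed correct only on instances of the same rank and dimension, since no others
are queried. This is what makes the full-rank version follow as well. -/
theorem card_reduction_ge (I : CVPInput) {O : Data → Data} {τ a : ℝ} (hτ : 0 < τ) (ha : 1 ≤ a)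
    (hO : ∀ J : CVPInput, J.n = I.n → J.m = I.m →
      J.targetDist < √(1 + τ⁻¹ ^ 2) * lambdaOne J.lattice → J.IsApproxClosest a (O J.encode))
    {b : ℕ} (hb : randomBits I.toLists ≤ b) (P : ℕ → Prop) [DecidablePred P]
    (hP : ∀ R, I.IsApproxClosest (a * √(1 + τ ^ 2)) (enc (reduction O (I.toLists, R))) → P R) :
    (2 / 3 : ℝ) * 2 ^ b ≤ ((Finset.range (2 ^ b)).filter P).card := by
  obtain ⟨B, t, hsc, hB, ht⟩ := exists_scaled I I.toLists rfl
  obtain ⟨n, m, n_pos, basis, hli, target⟩ := I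
  obtain ⟨n, rfl⟩ := Nat.exists_eq_succ_of_ne_zero n_pos.ne'
  obtain ⟨x₀, -, hx₀⟩ := exists_min_of_nonneg (p := fun _ : Fin (n + 1) → ℤ => True) ⟨0, trivial⟩
    (resid_nonneg B t)
  rw [randomBits, hB, ht, length_matL] at hb
  refine card_searchClosest_ge hsc.rowsIndep hτ ha x₀ (fun hC u => hO (intInput hC u) rfl rfl) hb P
    fun R hR => hP R ?_
  obtain ⟨y, hy⟩ := exists_searchClosest B t O R
  rw [hy, sqDist_vecMul] at hR
  have hred : enc (reduction O (CVPInput.toLists ⟨n + 1, m, n_pos, basis, hli, target⟩, R)) =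
      Data.ofVec fun j => mkRat (Matrix.vecMul y B j)
        (commonDen (CVPInput.toLists ⟨n + 1, m, n_pos, basis, hli, target⟩)) := by
    rw [ofVec_eq_enc, reduction, hB, ht, hy, List.map_ofFn]
    rfl
  rw [hred]
  refine hsc.isApproxClosest (by positivity) (fun y => hx₀ y trivial) (fun j => ?_) (hR.trans_eq ?_)
  · rw [Rat.mkRat_eq_div, mul_div_cancel₀]
    exact Nat.cast_ne_zero.2 hsc.pos.ne'
  · rw [mul_pow, Real.sq_sqrt (by positivity), mul_assoc]

theorem exists_program : ∃ (M : Prog) (bits time : ℕ[X]), ∀ (O : Data → Data) (I : CVPInput),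
    randomBits I.toLists ≤ bits.eval I.encode.size ∧
    ∀ R : ℕ, R < 2 ^ bits.eval I.encode.size → ∃ c,
      Runs O M (.pair I.encode (.int R)) (enc (reduction O (I.toLists, R))) c ∧
        c ≤ time.eval I.encode.size := by
  obtain ⟨p, hp⟩ := smallVal_randomBits
  obtain ⟨M, q, hM⟩ := polyTime_reduction
  -- The program also reads the random bits, of length at most `p`; the 2 accounts for the overhead
  -- of an integer and of a pair.
  refine ⟨M, p, q.comp (X + p + 2), fun O I => ?_⟩
  have henc : I.encode = enc I.toLists := encode_eq_enc I
  rw [henc]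
  refine ⟨hp O I.toLists, fun R hR => ?_⟩
  obtain ⟨c, hc, hle⟩ := hM O (I.toLists, R)
  refine ⟨c, hc, hle.trans ?_⟩
  rw [eval_comp]
  refine eval_le_eval _ ?_
  have h1 : Nat.size R ≤ p.eval (enc I.toLists).size := Nat.size_le.2 hR
  change (enc I.toLists).size + (Nat.size (R : ℤ).natAbs + 1) + 1 ≤ _
  simp only [Int.natAbs_natCast, eval_add, eval_X, eval_ofNat]
  omega

/-- The program is chosen before τ and a, which here are mere real numbers; they can therefore be
taken as the values of arbitrary functions at the rank of the input. -/
theorem exists_randomized_program : ∃ (M : Prog) (bits time : ℕ[X]),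
    ∀ (O : Data → Data) (I : CVPInput),
      (∀ R : Fin (2 ^ bits.eval I.encode.size), ∃ (y : Data) (c : ℕ),
        Runs O M (.pair I.encode (.int (R : ℕ))) y c ∧ c ≤ time.eval I.encode.size) ∧
      ∀ τ a : ℝ, 0 < τ → 1 ≤ a →
        (∀ J : CVPInput, J.n = I.n → J.m = I.m →
          J.targetDist < √(1 + τ⁻¹ ^ 2) * lambdaOne J.lattice → J.IsApproxClosest a (O J.encode)) →
        (2 / 3 : ℝ) * 2 ^ bits.eval I.encode.size ≤
          ({R : Fin (2 ^ bits.eval I.encode.size) | ∃ (y : Data) (c : ℕ),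
            Runs O M (.pair I.encode (.int (R : ℕ))) y c ∧
              I.IsApproxClosest (a * √(1 + τ ^ 2)) y}.ncard : ℝ) := by
  classical
  obtain ⟨M, bits, time, h⟩ := exists_program
  refine ⟨M, bits, time, fun O I => ⟨fun R => ?_, fun τ a hτ ha hO => ?_⟩⟩
  · obtain ⟨c, hc⟩ := (h O I).2 R R.2
    exact ⟨_, c, hc⟩
  · have hcard := card_reduction_ge I hτ ha hO (h O I).1
      (fun R => I.IsApproxClosest (a * √(1 + τ ^ 2)) (enc (reduction O (I.toLists, R))))
      fun _ => id
    refine hcard.trans (Nat.cast_le.2 ?_)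
    rw [← Set.ncard_coe_finset]
    refine (Set.ncard_le_ncard ?_ (Set.toFinite _)).trans
      (Set.ncard_image_le (f := fun R : Fin (2 ^ bits.eval I.encode.size) => (R : ℕ))
        (Set.toFinite _))
    intro R hR
    rw [Finset.mem_coe, Finset.mem_filter, Finset.mem_range] at hR
    obtain ⟨c, hc, -⟩ := (h O I).2 R hR.1
    exact ⟨⟨R, hR.1⟩, ⟨_, c, hc, hR.2⟩, rfl⟩

end LatticeReduction

open LatticeReduction in
theorem theorem6p1 (τ γ : ℕ → ℝ) (hτ : ∀ n, 0 < n → 0 < τ n) (hγ : ∀ n, 0 < n → 1 ≤ γ n) :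
    (CVP fun n => γ n * √(1 + τ n ^ 2)).RandPolyTimeReducesTo
        (PromiseCVP γ fun n _ L => √(1 + (τ n)⁻¹ ^ 2) * lambdaOne L) ∧
      ((CVP fun n => γ n * √(1 + τ n ^ 2)).restrict CVPInput.FullRank).RandPolyTimeReducesTo
        ((PromiseCVP γ fun n _ L => √(1 + (τ n)⁻¹ ^ 2) * lambdaOne L).restrict
          CVPInput.FullRank) := by
  obtain ⟨M, bits, time, h⟩ := exists_randomized_program
  constructor
  · refine ⟨M, bits, time, fun O (I : CVPInput) => ⟨(h O I).1, fun hO => ?_⟩⟩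
    refine (h O I).2 (τ I.n) (γ I.n) (hτ _ I.n_pos) (hγ _ I.n_pos) fun J hn _ hJ => ?_
    rw [← hn] at hJ ⊢
    exact hO J hJ
  · refine ⟨M, bits, time, fun O (I : {I : CVPInput // I.FullRank}) =>
      ⟨(h O I.1).1, fun hO => ?_⟩⟩
    refine (h O I.1).2 (τ I.1.n) (γ I.1.n) (hτ _ I.1.n_pos) (hγ _ I.1.n_pos)
      fun J hn hm hJ => ?_
    rw [← hn] at hJ ⊢
    -- A query has the rank and the dimension of the input, so it is again of full rank.
    exact hO ⟨J, hn.trans (I.2.trans hm.symm)⟩ hJ
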